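/- Let $\mathbb S^4\subset\mathbb R^5$ be the round unit sphere, $dw$ its surface measure normalized so that $\int_{\mathbb S^4}dw=1$, $\Delta$ its Laplace--Beltrami operator, and $P_4=\Delta^2-2\Delta$ the Paneitz operator. Let $H^2(\mathbb S^4)$ be the Sobolev space of order two, that is, the completion of $C^\infty(\mathbb S^4)$ in the $H^2$ norm. For $u\in H^2(\mathbb S^4)$ and $\alpha\in\mathbb R$ put $$\mathcal J_\alpha(u)=\frac\alpha2\int_{\mathbb S^4}u\,(P_4u)\,dw+6\int_{\mathbb S^4}u\,dw-\frac34\ln\left(\Big(\int_{\mathbb S^4}e^{4u}\,dw\Big)^2-\sum_{i=1}^5\Big(\int_{\mathbb S^4}e^{4u}\xi_i\,dw\Big)^2\right),$$ where $\int_{\mathbb S^4} u\,(P_4u)\,dw$ denotes the continuous extension to $H^2(\mathbb S^4)$ of the quadratic form $f\mapsto\int_{\mathbb S^4} f\,(P_4f)\,dw$ on $C^\infty(\mathbb S^4)$. For $t>0$ let $\phi_t:\mathbb S^4\to\mathbb S^4$ be the conformal dilation $\phi_t=\pi^{-1}\circ(y\mapsto ty)\circ\pi$, $\phi_t(P_0)=P_0$,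 where $\pi$ is the stereographic projection of $\mathbb S^4$ from $P_0=(1,0,0,0,0)$ to the equatorial plane, and let $|\det d\phi_t|$ be the modulus of its Jacobian determinant with respect to the round metric. Then, for every $u\in H^2(\mathbb S^4)$ and every $t>0$, the function $$v(\xi)=u(\phi_t(\xi))+\frac5{16}\ln|\det d\phi_t(\xi)|,\qquad \xi\in\mathbb S^4,$$ belongs to $H^2(\mathbb S^4)$, and $$\mathcal J_{4/5}(u)=\mathcal J_{4/5}(v).$$ -/

import Mathlib

open MeasureTheory Filter Topology
open scoped Manifold ContDiff

noncomputable section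

/-- Euclidean space of dimension five. -/
abbrev E5 : Type := EuclideanSpace ℝ (Fin 5)

/-- The round unit sphere of dimension four. -/
abbrev S4 : Type := Metric.sphere (0 : E5) 1

/-- The normalized surface measure `dw`, of total mass one. -/
def sphereMeasure : Measure S4 :=
  ((volume : Measure E5).toSphere Set.univ)⁻¹ • (volume : Measure E5).toSphere

/-- The pole `P₀ = (1, 0, 0, 0, 0)`. -/
def pole : S4 := ⟨EuclideanSpace.single 0 1, by simp⟩

/-- The radial projection `x ↦ x / ‖x‖` onto the sphere (with an irrelevant value at the origin). -/
def radialProj (x : E5) : S4 :=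
  if h : x = 0 then pole else ⟨‖x‖⁻¹ • x, by simp [norm_smul, h]⟩

/-- The extension `x ↦ f (x / ‖x‖)` of a function on the sphere, homogeneous of degree zero.
Its radial derivative vanishes, so at a point of the sphere its gradient is the (tangential)
gradient of `f`, its Laplacian is the Laplace-Beltrami operator of `f`, and its second derivative,
restricted to the tangent space, is the covariant Hessian of `f`. -/
def homExt (f : S4 → ℝ) : E5 → ℝ := fun x => f (radialProj x)

/-- Smooth real functions on the sphere. -/
def SmoothOnSphere (f : S4 → ℝ) : Prop := ContMDiff (𝓡 4) 𝓘(ℝ, ℝ) ∞ f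

/-- The Laplace-Beltrami operator of the round sphere, on smooth functions. -/
def sphereLaplacian (f : S4 → ℝ) : S4 → ℝ := fun ξ => Laplacian.laplacian (homExt f) (ξ : E5)

/-- The Paneitz operator `P₄ = Δ² - 2 Δ`, on smooth functions. -/
def paneitz (f : S4 → ℝ) : S4 → ℝ :=
  fun ξ => sphereLaplacian (sphereLaplacian f) ξ - 2 * sphereLaplacian f ξ

/-- The `H²` norm of a smooth function: the sum of the `L²` norms of the function, of its gradient
and of its second derivative. (The components of the second derivative of `homExt f` in which a
radial direction occurs are `0` and minus those of the gradient, so this norm is equivalent to the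
one with the covariant Hessian.) -/
def h2Norm (f : S4 → ℝ) : ENNReal :=
  eLpNorm f 2 sphereMeasure
    + eLpNorm (fun ξ : S4 => fderiv ℝ (homExt f) (ξ : E5)) 2 sphereMeasure
    + eLpNorm (fun ξ : S4 => iteratedFDeriv ℝ 2 (homExt f) (ξ : E5)) 2 sphereMeasure

/-- `φ` is a sequence of smooth functions that is Cauchy for the `H²` norm and tends to `u`
in `L²`. -/
structure IsH2Approx (u : S4 → ℝ) (φ : ℕ → S4 → ℝ) : Prop where
  smooth : ∀ n, SmoothOnSphere (φ n)
  cauchy : Tendsto (fun p : ℕ × ℕ => h2Norm (φ p.1 - φ p.2)) atTop (𝓝 0)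
  tendsto : Tendsto (fun n => eLpNorm (φ n - u) 2 sphereMeasure) atTop (𝓝 0)

/-- The Sobolev space `H²(𝕊⁴)`: the completion of the smooth functions for the `H²` norm,
realized inside `L²`. -/
def MemH2 (u : S4 → ℝ) : Prop :=
  MemLp u 2 sphereMeasure ∧ ∃ φ, IsH2Approx u φ

open Classical in
/-- The quadratic form `∫ u (P₄ u) dw` on `H²(𝕊⁴)`: the continuous extension of the form
`f ↦ ∫ f (P₄ f) dw` on smooth functions, that is, the number to which `∫ φₙ (P₄ φₙ) dw` tends for
every sequence of smooth functions `φₙ` that tends to `u` in `H²`. -/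
def paneitzForm (u : S4 → ℝ) : ℝ :=
  if h : ∃ Q : ℝ, ∀ φ, IsH2Approx u φ →
      Tendsto (fun n => ∫ ξ, φ n ξ * paneitz (φ n) ξ ∂sphereMeasure) atTop (𝓝 Q)
  then h.choose else 0

/-- The first momentum functional `𝓙_α`. -/
def momentumJ (α : ℝ) (u : S4 → ℝ) : ℝ :=
  α / 2 * paneitzForm u + 6 * ∫ ξ, u ξ ∂sphereMeasure
    - 3 / 4 * Real.log ((∫ ξ, Real.exp (4 * u ξ) ∂sphereMeasure) ^ 2
        - ∑ i : Fin 5, (∫ ξ, Real.exp (4 * u ξ) * (ξ : E5) i ∂sphereMeasure) ^ 2)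

open Classical in
/-- The conformal dilation `φ_t = π⁻¹ ∘ (t ·) ∘ π`, where `π` is the stereographic projection from
`P₀`; it fixes `P₀`. (Mathlib's `stereographic` is twice the projection to the equatorial
plane; the factor two cancels.) -/
def dilation (t : ℝ) (ξ : S4) : S4 :=
  if ξ = pole then pole
  else (stereographic (norm_eq_of_mem_sphere pole)).symm
    (t • stereographic (norm_eq_of_mem_sphere pole) ξ)

/-- The modulus `|det dψ|` of the Jacobian determinant, for the round metric, of a
map `ψ` of the sphere to itself. The derivative at `ξ` of the extension `x ↦ ‖x‖ ψ (x / ‖x‖)`,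
homogeneous of degree one, sends the unit normal `ξ` to the unit normal `ψ ξ` and is `dψ` between
their orthogonal complements, the tangent spaces, so the two determinants have the same modulus. -/
def absJacobian (ψ : S4 → S4) (ξ : S4) : ℝ :=
  |(fderiv ℝ (fun x : E5 => ‖x‖ • (ψ (radialProj x) : E5)) (ξ : E5)).det|

/-- The transform `v = u ∘ φ_t + (5 / 16) ln |det dφ_t|` of `u`. -/
def conformalTransform (t : ℝ) (u : S4 → ℝ) : S4 → ℝ :=
  fun ξ => u (dilation t ξ) + 5 / 16 * Real.log (absJacobian (dilation t) ξ)

end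

/-! A point ξ of the sphere spans the null ray of (1, ξ) in Lorentzian space ℝ^{1,5}, and φ_t is the
action on null rays of the boost with c = (t + 1/t)/2, s = (t − 1/t)/2 (`dilation_eq_boostMap`).
With q(ξ) = c + s ξ₀ the boost sends (1, ξ) to q(ξ) (1, φ_t ξ), and |det dφ_t| = q⁻⁴
(`absJacobian_boostMap`). Hence v = u ∘ φ_t + a w, where w = −ln q and a = 5/4.

Logarithmic term: e^{4v} = q⁻⁴ · q⁻¹ e^{4u ∘ φ_t}. The factor q⁻⁴ is the Jacobian, and q⁻¹ (1, ξ) is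
the inverse boost of (1, φ_t ξ). So the vector (∫ e^{4v}, ∫ e^{4v} ξ) is the inverse boost of (∫
e^{4u}, ∫ e^{4u} ξ), and the argument of the logarithm is its Lorentz square
(`sq_sub_sum_sq_integral_exp`).

Quadratic term: P₄ is conformally covariant, P₄(f ∘ φ_t) = q⁻⁴ (P₄ f) ∘ φ_t (`paneitz_comp`), and P₄
w = 6 q⁻⁴ − 6 (`paneitz_logFactor`). Since ∫ q⁻⁴ w = −∫ w, expanding the form at v adds 12a (∫ u − ∫
u ∘ φ_t) − 12a² ∫ w (`paneitzForm_comp_add`). After multiplication by α/2 this cancels the change of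
6 ∫ u exactly when αa = 1, which is the case for α = 4/5.

Both facts on P₄ come from flat space: on extensions F homogeneous of degree zero, P₄ is the
bi-Laplacian of ℝ⁵ (`paneitz_eq`), and the bi-Laplacian commutes with x ↦ spatial part of the boost
of (|x|, x) (`lap_lap_comp`).

Analysis enters twice. The form extends to H² because Δ is symmetric and the bilinear form is
bounded in H² (`tendsto_paneitzForm`). The moments transform linearly because e^{4u} is integrable
for u in H² (`MemH2.integrable_exp`), a weak Adams inequality obtained from Sobolev embeddings in
four-dimensional charts. -/

/-! ### Radial projection and functions on the punctured space -/

/-- Functions that are smooth away from the origin. -/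
def SmoothOff (F : E5 → ℝ) : Prop := ContDiffOn ℝ ∞ F {0}ᶜ

theorem radialProj_coe {x : E5} (hx : x ≠ 0) : (radialProj x : E5) = ‖x‖⁻¹ • x := by
  simp [radialProj, hx]

theorem norm_coe_sphere (ξ : S4) : ‖(ξ : E5)‖ = 1 := norm_eq_of_mem_sphere ξ

theorem coe_sphere_ne_zero (ξ : S4) : (ξ : E5) ≠ 0 := by
  intro h
  simpa [h] using norm_coe_sphere ξ

theorem radialProj_coe_sphere (ξ : S4) : radialProj (ξ : E5) = ξ := by
  apply Subtype.ext
  rw [radialProj_coe (coe_sphere_ne_zero ξ), norm_coe_sphere]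
  simp

theorem norm_smul_radialProj {x : E5} (hx : x ≠ 0) : ‖x‖ • (radialProj x : E5) = x := by
  rw [radialProj_coe hx, smul_smul, mul_inv_cancel₀ (norm_ne_zero_iff.2 hx), one_smul]

theorem radialProj_smul {r : ℝ} (hr : 0 < r) {x : E5} (hx : x ≠ 0) :
    radialProj (r • x) = radialProj x := by
  apply Subtype.ext
  rw [radialProj_coe hx, radialProj_coe (smul_ne_zero hr.ne' hx), norm_smul, smul_smul,
    Real.norm_of_nonneg hr.le]
  congr 1
  field_simp

theorem homExt_coe (f : S4 → ℝ) (ξ : S4) : homExt f ξ = f ξ := by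
  simp [homExt, radialProj_coe_sphere]

theorem homExt_smul (f : S4 → ℝ) {r : ℝ} (hr : 0 < r) {x : E5} (hx : x ≠ 0) :
    homExt f (r • x) = homExt f x := by
  simp [homExt, radialProj_smul hr hx]

theorem isOpen_ne_zero : IsOpen ({0}ᶜ : Set E5) := isOpen_compl_singleton

theorem compl_zero_mem_nhds {x : E5} (hx : x ≠ 0) : ({0}ᶜ : Set E5) ∈ 𝓝 x :=
  isOpen_ne_zero.mem_nhds hx

theorem SmoothOff.contDiffAt {F : E5 → ℝ} (hF : SmoothOff F) {x : E5} (hx : x ≠ 0) :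
    ContDiffAt ℝ ∞ F x := ContDiffOn.contDiffAt hF (compl_zero_mem_nhds hx)

theorem SmoothOff.differentiableAt {F : E5 → ℝ} (hF : SmoothOff F) {x : E5} (hx : x ≠ 0) :
    DifferentiableAt ℝ F x := (hF.contDiffAt hx).differentiableAt (by simp)

theorem SmoothOff.of_contDiffAt {F : E5 → ℝ} (h : ∀ x, x ≠ 0 → ContDiffAt ℝ ∞ F x) :
    SmoothOff F := fun x hx => (h x hx).contDiffWithinAt

theorem contDiffAt_coe_radialProj {x : E5} (hx : x ≠ 0) :
    ContDiffAt ℝ ∞ (fun y : E5 => (radialProj y : E5)) x := by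
  have h : ContDiffAt ℝ ∞ (fun y : E5 => ‖y‖⁻¹ • y) x :=
    ((contDiffAt_norm ℝ hx).inv (norm_ne_zero_iff.2 hx)).smul contDiffAt_id
  refine h.congr_of_eventuallyEq ?_
  filter_upwards [compl_zero_mem_nhds hx] with y hy
  exact radialProj_coe hy

theorem finrank_E5 : Module.finrank ℝ E5 = 4 + 1 := by simp

theorem SmoothOnSphere.smoothOff {f : S4 → ℝ} (hf : SmoothOnSphere f) : SmoothOff (homExt f) := by
  refine SmoothOff.of_contDiffAt fun x hx => ?_
  have : Fact (Module.finrank ℝ E5 = 4 + 1) := ⟨finrank_E5⟩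
  -- The punctured space is viewed as an open submanifold, so that the radial projection becomes a
  -- globally smooth map into the sphere.
  let U : TopologicalSpace.Opens E5 := ⟨{0}ᶜ, isOpen_ne_zero⟩
  let x' : U := ⟨x, hx⟩
  have h1 : ContMDiff 𝓘(ℝ, E5) 𝓘(ℝ, E5) ∞ (fun y : U => (radialProj (y : E5) : E5)) := by
    intro y
    have h2 := (contDiffAt_coe_radialProj (x := (y : E5)) y.2).contMDiffAt
    exact (contMDiffAt_subtype_iff (f := fun y : E5 => (radialProj y : E5))).2 h2
  have h3 := h1.codRestrict_sphere (n := 4) (fun y => (radialProj (y : E5)).2)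
  have h4 : ContMDiff 𝓘(ℝ, E5) 𝓘(ℝ, ℝ) ∞ (fun y : U => homExt f (y : E5)) := hf.comp h3
  have h5 := (contMDiffAt_subtype_iff (f := homExt f) (x := x')).1 (h4 x')
  exact h5.contDiffAt

theorem SmoothOff.smoothOnSphere {F : E5 → ℝ} (hF : SmoothOff F) :
    SmoothOnSphere (fun ξ : S4 => F ξ) := by
  have : Fact (Module.finrank ℝ E5 = 4 + 1) := ⟨finrank_E5⟩
  intro ξ
  exact (hF.contDiffAt (coe_sphere_ne_zero ξ)).contMDiffAt.comp ξ
    (contMDiff_coe_sphere (n := 4) (m := ∞) ξ)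

theorem smoothOnSphere_of_homExt {f : S4 → ℝ} (h : SmoothOff (homExt f)) : SmoothOnSphere f := by
  have := h.smoothOnSphere
  simpa only [homExt_coe] using this

theorem SmoothOnSphere.continuous {f : S4 → ℝ} (hf : SmoothOnSphere f) : Continuous f :=
  ContMDiff.continuous hf

/-! ### Partial derivatives -/

/-- The derivative in the direction `v`. -/
noncomputable def pd (v : E5) (F : E5 → ℝ) : E5 → ℝ := fun x => fderiv ℝ F x v

/-- The standard basis vectors. -/
noncomputable abbrev bv (i : Fin 5) : E5 := EuclideanSpace.single i 1

/-- The Laplacian as a sum of iterated partial derivatives. -/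
noncomputable def lap (F : E5 → ℝ) : E5 → ℝ := fun x => ∑ i, pd (bv i) (pd (bv i) F) x

theorem SmoothOff.fderiv {F : E5 → ℝ} (hF : SmoothOff F) {x : E5} (hx : x ≠ 0) :
    ContDiffAt ℝ ∞ (fderiv ℝ F) x :=
  (hF.contDiffAt hx).fderiv_right (by simp)

theorem SmoothOff.pd {F : E5 → ℝ} (hF : SmoothOff F) (v : E5) : SmoothOff (pd v F) :=
  SmoothOff.of_contDiffAt fun _ hx => (hF.fderiv hx).clm_apply contDiffAt_const

theorem SmoothOff.lap {F : E5 → ℝ} (hF : SmoothOff F) : SmoothOff (lap F) :=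
  ContDiffOn.sum fun i _ => (hF.pd (bv i)).pd (bv i)

theorem pd_congr {F G : E5 → ℝ} (h : ∀ x, x ≠ 0 → F x = G x) (v : E5) {x : E5} (hx : x ≠ 0) :
    pd v F x = pd v G x := by
  unfold pd
  rw [Filter.EventuallyEq.fderiv_eq]
  filter_upwards [compl_zero_mem_nhds hx] with y hy using h y hy

theorem lap_congr {F G : E5 → ℝ} (h : ∀ x, x ≠ 0 → F x = G x) {x : E5} (hx : x ≠ 0) :
    lap F x = lap G x := by
  unfold lap
  refine Finset.sum_congr rfl fun i _ => ?_
  exact pd_congr (fun y hy => pd_congr h _ hy) _ hx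

theorem pd_pd {F : E5 → ℝ} (hF : SmoothOff F) (v w : E5) {x : E5} (hx : x ≠ 0) :
    pd v (pd w F) x = fderiv ℝ (fderiv ℝ F) x v w := by
  have h : DifferentiableAt ℝ (_root_.fderiv ℝ F) x := (hF.fderiv hx).differentiableAt (by simp)
  change fderiv ℝ (fun y => fderiv ℝ F y w) x v = _
  rw [fderiv_clm_apply h (differentiableAt_const _)]
  simp

theorem laplacian_eq_lap {F : E5 → ℝ} (hF : SmoothOff F) {x : E5} (hx : x ≠ 0) :
    Laplacian.laplacian F x = lap F x := by
  rw [InnerProductSpace.laplacian_eq_iteratedFDeriv_orthonormalBasis F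
    (EuclideanSpace.basisFun (Fin 5) ℝ)]
  refine Finset.sum_congr rfl fun i _ => ?_
  rw [iteratedFDeriv_two_apply, pd_pd hF _ _ hx]
  simp [bv]

theorem pd_add {F G : E5 → ℝ} (hF : SmoothOff F) (hG : SmoothOff G) (v : E5) {x : E5}
    (hx : x ≠ 0) : pd v (fun y => F y + G y) x = pd v F x + pd v G x := by
  simp [pd, fderiv_fun_add (hF.differentiableAt hx) (hG.differentiableAt hx)]

theorem pd_mul {F G : E5 → ℝ} (hF : SmoothOff F) (hG : SmoothOff G) (v : E5) {x : E5}
    (hx : x ≠ 0) : pd v (fun y => F y * G y) x = F x * pd v G x + G x * pd v F x := by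
  simp [pd, fderiv_fun_mul (hF.differentiableAt hx) (hG.differentiableAt hx)]

theorem pd_const_mul {F : E5 → ℝ} (hF : SmoothOff F) (a : ℝ) (v : E5) {x : E5}
    (hx : x ≠ 0) : pd v (fun y => a * F y) x = a * pd v F x := by
  simp [pd, fderiv_const_mul (hF.differentiableAt hx)]

theorem SmoothOff.add {F G : E5 → ℝ} (hF : SmoothOff F) (hG : SmoothOff G) :
    SmoothOff (fun y => F y + G y) := ContDiffOn.add hF hG

theorem SmoothOff.mul {F G : E5 → ℝ} (hF : SmoothOff F) (hG : SmoothOff G) :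
    SmoothOff (fun y => F y * G y) := ContDiffOn.mul hF hG

theorem SmoothOff.const_mul {F : E5 → ℝ} (hF : SmoothOff F) (a : ℝ) :
    SmoothOff (fun y => a * F y) := ContDiffOn.mul contDiffOn_const hF

theorem lap_add {F G : E5 → ℝ} (hF : SmoothOff F) (hG : SmoothOff G) {x : E5}
    (hx : x ≠ 0) : lap (fun y => F y + G y) x = lap F x + lap G x := by
  unfold lap
  rw [← Finset.sum_add_distrib]
  refine Finset.sum_congr rfl fun i _ => ?_
  rw [pd_congr (fun y hy => pd_add hF hG _ hy) _ hx, pd_add (hF.pd _) (hG.pd _) _ hx]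

theorem lap_const_mul {F : E5 → ℝ} (hF : SmoothOff F) (a : ℝ) {x : E5}
    (hx : x ≠ 0) : lap (fun y => a * F y) x = a * lap F x := by
  unfold lap
  rw [Finset.mul_sum]
  refine Finset.sum_congr rfl fun i _ => ?_
  rw [pd_congr (fun y hy => pd_const_mul hF a _ hy) _ hx, pd_const_mul (hF.pd _) _ _ hx]

theorem lap_mul {F G : E5 → ℝ} (hF : SmoothOff F) (hG : SmoothOff G) {x : E5} (hx : x ≠ 0) :
    lap (fun y => F y * G y) x =
      F x * lap G x + 2 * ∑ i, pd (bv i) F x * pd (bv i) G x + G x * lap F x := by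
  unfold lap
  rw [Finset.mul_sum, Finset.mul_sum, Finset.mul_sum, ← Finset.sum_add_distrib,
    ← Finset.sum_add_distrib]
  refine Finset.sum_congr rfl fun i _ => ?_
  rw [pd_congr (fun y hy => pd_mul hF hG _ hy) _ hx,
    pd_add (hF.mul (hG.pd _)) (hG.mul (hF.pd _)) _ hx, pd_mul hF (hG.pd _) _ hx,
    pd_mul hG (hF.pd _) _ hx]
  ring

theorem pd_comm {F : E5 → ℝ} (hF : SmoothOff F) (v w : E5) {x : E5} (hx : x ≠ 0) :
    pd v (pd w F) x = pd w (pd v F) x := by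
  have hs : IsSymmSndFDerivAt ℝ F x := (hF.contDiffAt hx).isSymmSndFDerivAt (by
    simp [minSmoothness_of_isRCLikeNormedField]
    exact WithTop.coe_le_coe.2 (le_top : (2 : ℕ∞) ≤ ⊤))
  rw [pd_pd hF _ _ hx, pd_pd hF _ _ hx]
  exact hs v w

theorem pd_lap {F : E5 → ℝ} (hF : SmoothOff F) (v : E5) {x : E5} (hx : x ≠ 0) :
    pd v (lap F) x = lap (pd v F) x := by
  have h1 : pd v (lap F) x = ∑ i, pd v (pd (bv i) (pd (bv i) F)) x := by
    change fderiv ℝ (fun y => ∑ i, pd (bv i) (pd (bv i) F) y) x v = _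
    rw [fderiv_fun_sum fun i _ => ((hF.pd (bv i)).pd (bv i)).differentiableAt hx]
    simp [pd]
  rw [h1]
  refine Finset.sum_congr rfl fun i _ => ?_
  rw [pd_comm (hF.pd _) _ _ hx]
  exact pd_congr (fun y hy => pd_comm hF _ _ hy) _ hx

theorem sum_mul_pd (F : E5 → ℝ) (x y : E5) : ∑ i, y i * pd (bv i) F x = fderiv ℝ F x y := by
  have h := (EuclideanSpace.basisFun (Fin 5) ℝ).sum_repr y
  conv_rhs => rw [← h]
  simp [pd, bv]

/-! ### Homogeneous functions -/

/-- Positive homogeneity of degree `d` away from the origin. -/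
def HomDeg (d : ℤ) (F : E5 → ℝ) : Prop :=
  ∀ x, x ≠ 0 → ∀ r : ℝ, 0 < r → F (r • x) = r ^ d * F x

theorem homDeg_homExt (f : S4 → ℝ) : HomDeg 0 (homExt f) := fun x hx r hr => by
  simp [homExt_smul f hr hx]

theorem HomDeg.pd {d : ℤ} {F : E5 → ℝ} (h : HomDeg d F) (hF : SmoothOff F) (v : E5) :
    HomDeg (d - 1) (pd v F) := by
  intro x hx r hr
  have hrx : r • x ≠ 0 := smul_ne_zero hr.ne' hx
  have h1 : HasFDerivAt (fun y : E5 => r • y) (r • ContinuousLinearMap.id ℝ E5) x :=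
    (hasFDerivAt_id x).const_smul r
  have h2 := (hF.differentiableAt hrx).hasFDerivAt.comp x h1
  have h3 : HasFDerivAt (fun y => r ^ d * F y) (r ^ d • fderiv ℝ F x) x :=
    (hF.differentiableAt hx).hasFDerivAt.const_mul _
  have h4 : (F ∘ fun y : E5 => r • y) =ᶠ[𝓝 x] fun y => r ^ d * F y := by
    filter_upwards [compl_zero_mem_nhds hx] with y hy using h y hy r hr
  have h5 := congrArg (fun A : E5 →L[ℝ] ℝ => A v) (h2.unique (h3.congr_of_eventuallyEq h4))
  simp at h5
  unfold _root_.pd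
  rw [zpow_sub_one₀ hr.ne']
  field_simp
  linarith

theorem HomDeg.lap {d : ℤ} {F : E5 → ℝ} (h : HomDeg d F) (hF : SmoothOff F) :
    HomDeg (d - 2) (lap F) := by
  intro x hx r hr
  unfold _root_.lap
  rw [Finset.mul_sum]
  refine Finset.sum_congr rfl fun i _ => ?_
  rw [((h.pd hF (bv i)).pd (hF.pd _) (bv i)) x hx r hr]
  congr 2
  ring

theorem HomDeg.euler {d : ℤ} {F : E5 → ℝ} (h : HomDeg d F) (hF : SmoothOff F) {x : E5}
    (hx : x ≠ 0) : fderiv ℝ F x x = d * F x := by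
  have h1 : HasDerivAt (fun r : ℝ => r • x) x 1 := by
    simpa using (hasDerivAt_id (1 : ℝ)).smul_const x
  have h0 : HasFDerivAt F (fderiv ℝ F x) ((1 : ℝ) • x) := by
    simpa using (hF.differentiableAt hx).hasFDerivAt
  have h2 := h0.comp_hasDerivAt 1 h1
  have h3 : HasDerivAt (fun r : ℝ => r ^ d * F x) (d * F x) 1 := by
    simpa using (hasDerivAt_zpow d (1 : ℝ) (Or.inl one_ne_zero)).mul_const (F x)
  have h4 : (F ∘ fun r : ℝ => r • x) =ᶠ[𝓝 1] fun r => r ^ d * F x := by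
    filter_upwards [lt_mem_nhds (zero_lt_one' ℝ)] with r hr using h x hx r hr
  exact h2.unique (h3.congr_of_eventuallyEq h4)

theorem HomDeg.sum_mul_pd {d : ℤ} {F : E5 → ℝ} (h : HomDeg d F) (hF : SmoothOff F) {x : E5}
    (hx : x ≠ 0) : ∑ i, x i * _root_.pd (bv i) F x = d * F x := by
  rw [_root_.sum_mul_pd, h.euler hF hx]

/-! ### Radial functions -/

theorem contDiffAt_coord (i : Fin 5) (x : E5) : ContDiffAt ℝ ∞ (fun y : E5 => y i) x :=
  (EuclideanSpace.proj (𝕜 := ℝ) i).contDiff.contDiffAt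

theorem smoothOff_coord (i : Fin 5) : SmoothOff (fun y : E5 => y i) :=
  SmoothOff.of_contDiffAt fun x _ => contDiffAt_coord i x

theorem pd_coord (v : E5) (i : Fin 5) (x : E5) : pd v (fun y => y i) x = v i := by
  let A : E5 →L[ℝ] ℝ := EuclideanSpace.proj i
  change fderiv ℝ A x v = A v
  rw [A.fderiv]

theorem smoothOff_norm : SmoothOff (fun y => ‖y‖) :=
  SmoothOff.of_contDiffAt fun _ hx => contDiffAt_norm ℝ hx

theorem smoothOff_norm_zpow (p : ℤ) : SmoothOff (fun y => ‖y‖ ^ p) := by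
  refine SmoothOff.of_contDiffAt fun x hx => ?_
  have h := contDiffAt_norm (n := ∞) ℝ hx
  have hx' := norm_ne_zero_iff.2 hx
  obtain ⟨n, rfl | rfl⟩ := p.eq_nat_or_neg
  · simpa using h.pow n
  · simp only [zpow_neg, zpow_natCast]
    exact (h.pow n).inv (pow_ne_zero n hx')

theorem smoothOff_log_norm : SmoothOff (fun y => Real.log ‖y‖) :=
  SmoothOff.of_contDiffAt fun _ hx => (contDiffAt_norm ℝ hx).log (norm_ne_zero_iff.2 hx)

theorem pd_norm (v : E5) {x : E5} (hx : x ≠ 0) : pd v (fun y => ‖y‖) x = inner ℝ x v / ‖x‖ := by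
  have h1 := (contDiffAt_norm (n := ∞) ℝ hx).differentiableAt (by simp)
  have h2 := h1.hasFDerivAt.pow 2
  have h3 := (hasStrictFDerivAt_norm_sq x).hasFDerivAt
  have h4 := congrArg (fun A : E5 →L[ℝ] ℝ => A v) (h2.unique h3)
  have hx' := norm_ne_zero_iff.2 hx
  simp at h4
  unfold pd
  field_simp
  linarith

theorem inner_bv (x : E5) (i : Fin 5) : inner ℝ x (bv i) = x i := by
  simp [bv, EuclideanSpace.inner_single_right]

theorem pd_real_comp {G : E5 → ℝ} {k : ℝ → ℝ} {k' : ℝ} (v : E5) {x : E5}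
    (hG : DifferentiableAt ℝ G x) (hk : HasDerivAt k k' (G x)) :
    pd v (fun y => k (G y)) x = k' * pd v G x := by
  have h := hk.comp_hasFDerivAt x hG.hasFDerivAt
  unfold pd
  have h' : fderiv ℝ (fun y => k (G y)) x = k' • fderiv ℝ G x := h.fderiv
  rw [h']
  simp

theorem pd_norm_zpow (p : ℤ) (i : Fin 5) {x : E5} (hx : x ≠ 0) :
    pd (bv i) (fun y => ‖y‖ ^ p) x = p * (‖x‖ ^ (p - 2) * x i) := by
  have hx' := norm_ne_zero_iff.2 hx
  rw [pd_real_comp (k := fun t => t ^ p) _ (smoothOff_norm.differentiableAt hx)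
    (hasDerivAt_zpow p _ (Or.inl hx')), pd_norm _ hx, inner_bv, zpow_sub₀ hx', zpow_sub₀ hx']
  field_simp

theorem pd_log_norm (i : Fin 5) {x : E5} (hx : x ≠ 0) :
    pd (bv i) (fun y => Real.log ‖y‖) x = ‖x‖ ^ (-2 : ℤ) * x i := by
  have hx' := norm_ne_zero_iff.2 hx
  rw [pd_real_comp (k := Real.log) _ (smoothOff_norm.differentiableAt hx)
    (Real.hasDerivAt_log hx'), pd_norm _ hx, inner_bv]
  simp [zpow_neg]
  field_simp

theorem sum_sq_coord (x : E5) : ∑ i, x i * x i = ‖x‖ ^ 2 := by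
  rw [EuclideanSpace.norm_sq_eq]
  exact Finset.sum_congr rfl fun i _ => by rw [Real.norm_eq_abs, sq_abs, sq]

/-- The gradient is the field |x|^p x, whose divergence in dimension five is (p + 5)|x|^p. Covers
powers of the norm and its logarithm at once. -/
theorem lap_of_pd_radial {F : E5 → ℝ} (p : ℤ)
    (h : ∀ i x, x ≠ 0 → pd (bv i) F x = ‖x‖ ^ p * x i) {x : E5} (hx : x ≠ 0) :
    lap F x = (p + 5) * ‖x‖ ^ p := by
  have hx' := norm_ne_zero_iff.2 hx
  have h1 : ∀ i, pd (bv i) (pd (bv i) F) x = ‖x‖ ^ p + p * ‖x‖ ^ (p - 2) * (x i * x i) := by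
    intro i
    rw [pd_congr (h i) _ hx, pd_mul (smoothOff_norm_zpow p) (smoothOff_coord i) _ hx,
      pd_norm_zpow p i hx, pd_coord]
    simp [bv]
    ring
  unfold lap
  rw [Finset.sum_congr rfl fun i _ => h1 i, Finset.sum_add_distrib, ← Finset.mul_sum,
    sum_sq_coord, zpow_sub₀ hx']
  simp
  field_simp
  ring

theorem lap_norm_zpow (p : ℤ) {x : E5} (hx : x ≠ 0) :
    lap (fun y => ‖y‖ ^ p) x = p * (p + 3) * ‖x‖ ^ (p - 2) := by
  -- The function |y|^p / p used below requires p ≠ 0; for p = 0 the power is constant.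
  rcases eq_or_ne p 0 with rfl | hp
  · have h0 : ∀ i y, y ≠ 0 → pd (bv i) (fun y : E5 => ‖y‖ ^ (0 : ℤ)) y = 0 := fun i y _ => by
      simp [pd]
    unfold lap
    rw [Finset.sum_eq_zero fun i _ => ?_]
    · simp
    · rw [pd_congr (h0 i) _ hx]
      simp [pd]
  have hp' : (p : ℝ) ≠ 0 := by exact_mod_cast hp
  have h1 := lap_of_pd_radial (F := fun y => (p : ℝ)⁻¹ * ‖y‖ ^ p) (p - 2) (fun i y hy => by
    rw [pd_const_mul (smoothOff_norm_zpow p) _ _ hy, pd_norm_zpow p i hy]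
    field_simp) hx
  rw [lap_const_mul (smoothOff_norm_zpow p) _ hx] at h1
  push_cast at h1
  field_simp at h1
  rw [h1]
  ring

theorem lap_norm {x : E5} (hx : x ≠ 0) : lap (fun y => ‖y‖) x = 4 * ‖x‖⁻¹ := by
  have := lap_norm_zpow 1 hx
  norm_num at this
  exact this

theorem lap_log_norm {x : E5} (hx : x ≠ 0) :
    lap (fun y => Real.log ‖y‖) x = 3 * ‖x‖ ^ (-2 : ℤ) := by
  rw [lap_of_pd_radial (-2) (fun i y hy => pd_log_norm i hy) hx]
  norm_num

theorem lap_lap_log_norm {x : E5} (hx : x ≠ 0) :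
    lap (lap fun y => Real.log ‖y‖) x = -6 * ‖x‖ ^ (-4 : ℤ) := by
  rw [lap_congr (fun y hy => lap_log_norm hy) hx, lap_const_mul (smoothOff_norm_zpow _) _ hx,
    lap_norm_zpow _ hx]
  norm_num
  ring

/-! ### The Lorentz boost acting on the light cone -/

/-- The vertical displacement of the boost. -/
noncomputable def boostShift (c s : ℝ) (x : E5) : ℝ := (c - 1) * x 0 + s * ‖x‖

/-- The spatial part of the Lorentz boost of the light-like vector `(‖x‖, x)`. -/
noncomputable def boost (c s : ℝ) (x : E5) : E5 := x + boostShift c s x • bv 0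

/-- The temporal part of the Lorentz boost of the light-like vector `(‖x‖, x)`. -/
noncomputable def boostTime (c s : ℝ) (x : E5) : ℝ := c * ‖x‖ + s * x 0

/-- The parameters of a boost. -/
structure IsBoost (c s : ℝ) : Prop where
  sq_sub : c ^ 2 - s ^ 2 = 1
  pos : 0 < c

theorem IsBoost.abs_lt {c s : ℝ} (h : IsBoost c s) : |s| < c := by
  rw [← abs_of_pos h.pos]
  exact sq_lt_sq.1 (by linarith [h.sq_sub])

theorem IsBoost.neg {c s : ℝ} (h : IsBoost c s) : IsBoost c (-s) :=
  ⟨by simpa using h.sq_sub, h.pos⟩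

theorem abs_coord_le (x : E5) (i : Fin 5) : |x i| ≤ ‖x‖ := PiLp.norm_apply_le x i

theorem IsBoost.boostTime_pos {c s : ℝ} (h : IsBoost c s) {x : E5} (hx : x ≠ 0) :
    0 < boostTime c s x := by
  have h1 : |s * x 0| ≤ |s| * ‖x‖ := by
    rw [abs_mul]
    exact mul_le_mul_of_nonneg_left (abs_coord_le x 0) (abs_nonneg s)
  have h2 : |s| * ‖x‖ < c * ‖x‖ := mul_lt_mul_of_pos_right h.abs_lt (norm_pos_iff.2 hx)
  have h3 := neg_abs_le (s * x 0)
  unfold boostTime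
  linarith

theorem boost_zero_coord (c s : ℝ) (x : E5) : boost c s x 0 = c * x 0 + s * ‖x‖ := by
  simp [boost, boostShift]
  ring

theorem boost_coord (c s : ℝ) (x : E5) {i : Fin 5} (hi : i ≠ 0) : boost c s x i = x i := by
  simp [boost, hi]

theorem norm_sq_eq_add_sum (x : E5) : ‖x‖ ^ 2 = x 0 ^ 2 + ∑ i : Fin 4, x i.succ ^ 2 := by
  rw [← sum_sq_coord, Fin.sum_univ_succ]
  simp [sq]

/-- Boosts preserve the Lorentz square, so null vectors stay null; positivity of the temporal part
selects the sign of the root. -/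
theorem IsBoost.norm_boost {c s : ℝ} (h : IsBoost c s) (x : E5) :
    ‖boost c s x‖ = boostTime c s x := by
  rcases eq_or_ne x 0 with rfl | hx
  · simp [boost, boostShift, boostTime]
  have h1 : ‖boost c s x‖ ^ 2 = boostTime c s x ^ 2 := by
    rw [norm_sq_eq_add_sum, boost_zero_coord]
    simp only [boost_coord c s x (Fin.succ_ne_zero _)]
    have h2 := norm_sq_eq_add_sum x
    unfold boostTime
    linear_combination (x 0 ^ 2 - ‖x‖ ^ 2) * h.sq_sub - h2
  exact (pow_left_inj₀ (norm_nonneg _) (h.boostTime_pos hx).le two_ne_zero).1 h1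

theorem IsBoost.boost_ne_zero {c s : ℝ} (h : IsBoost c s) {x : E5} (hx : x ≠ 0) :
    boost c s x ≠ 0 := by
  rw [← norm_pos_iff, h.norm_boost]
  exact h.boostTime_pos hx

theorem boost_smul (c s : ℝ) {r : ℝ} (hr : 0 ≤ r) (x : E5) :
    boost c s (r • x) = r • boost c s x := by
  ext i
  rcases eq_or_ne i 0 with rfl | hi
  · simp [boost_zero_coord, norm_smul, abs_of_nonneg hr]
    ring
  · simp [boost_coord _ _ _ hi]

theorem boostTime_smul (c s : ℝ) {r : ℝ} (hr : 0 ≤ r) (x : E5) :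
    boostTime c s (r • x) = r * boostTime c s x := by
  simp [boostTime, norm_smul, abs_of_nonneg hr]
  ring

theorem IsBoost.boost_neg_boost {c s : ℝ} (h : IsBoost c s) (x : E5) :
    boost c (-s) (boost c s x) = x := by
  ext i
  rcases eq_or_ne i 0 with rfl | hi
  · rw [boost_zero_coord, boost_zero_coord, h.norm_boost]
    unfold boostTime
    linear_combination x 0 * h.sq_sub
  · simp [boost_coord _ _ _ hi]

theorem IsBoost.boostTime_neg_boost {c s : ℝ} (h : IsBoost c s) (x : E5) :
    boostTime c (-s) (boost c s x) = ‖x‖ := by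
  rw [← h.neg.norm_boost, h.boost_neg_boost]

theorem smoothOff_boostShift (c s : ℝ) : SmoothOff (boostShift c s) :=
  ((smoothOff_coord 0).const_mul (c - 1)).add (smoothOff_norm.const_mul s)

theorem smoothOff_boostTime (c s : ℝ) : SmoothOff (boostTime c s) :=
  (smoothOff_norm.const_mul c).add ((smoothOff_coord 0).const_mul s)

theorem contDiffAt_boost (c s : ℝ) {x : E5} (hx : x ≠ 0) : ContDiffAt ℝ ∞ (boost c s) x :=
  contDiffAt_id.add (((smoothOff_boostShift c s).contDiffAt hx).smul contDiffAt_const)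

theorem hasFDerivAt_boost (c s : ℝ) {x : E5} (hx : x ≠ 0) :
    HasFDerivAt (boost c s)
      (ContinuousLinearMap.id ℝ E5 + (fderiv ℝ (boostShift c s) x).smulRight (bv 0)) x :=
  (hasFDerivAt_id x).add
    (((smoothOff_boostShift c s).differentiableAt hx).hasFDerivAt.smul_const (bv 0))

theorem IsBoost.smoothOff_comp {c s : ℝ} (h : IsBoost c s) {F : E5 → ℝ} (hF : SmoothOff F) :
    SmoothOff (fun y => F (boost c s y)) :=
  SmoothOff.of_contDiffAt fun x hx =>
    (hF.contDiffAt (h.boost_ne_zero hx)).comp x (contDiffAt_boost c s hx)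

theorem IsBoost.homDeg_comp {c s : ℝ} (h : IsBoost c s) {d : ℤ} {F : E5 → ℝ} (hF : HomDeg d F) :
    HomDeg d (fun y => F (boost c s y)) := fun x hx r hr => by
  simp only [boost_smul c s hr.le]
  exact hF _ (h.boost_ne_zero hx) r hr

theorem pd_boostShift (c s : ℝ) (i : Fin 5) {x : E5} (hx : x ≠ 0) :
    pd (bv i) (boostShift c s) x = (c - 1) * bv i 0 + s * (x i * ‖x‖⁻¹) := by
  unfold boostShift
  rw [pd_add ((smoothOff_coord 0).const_mul _) (smoothOff_norm.const_mul _) _ hx,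
    pd_const_mul (smoothOff_coord 0) _ _ hx, pd_const_mul smoothOff_norm _ _ hx, pd_coord,
    pd_norm _ hx, inner_bv, div_eq_mul_inv]

theorem lap_boostShift (c s : ℝ) {x : E5} (hx : x ≠ 0) :
    lap (boostShift c s) x = 4 * s * ‖x‖⁻¹ := by
  unfold boostShift
  rw [lap_add ((smoothOff_coord 0).const_mul _) (smoothOff_norm.const_mul _) hx,
    lap_const_mul (smoothOff_coord 0) _ hx, lap_const_mul smoothOff_norm _ hx, lap_norm hx]
  have : lap (fun y : E5 => y 0) x = 0 := by
    unfold lap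
    refine Finset.sum_eq_zero fun i _ => ?_
    rw [pd_congr (G := fun _ => bv i 0) (fun y _ => pd_coord _ _ _) _ hx]
    simp [pd]
  rw [this]
  ring

theorem IsBoost.pd_comp {c s : ℝ} (h : IsBoost c s) {F : E5 → ℝ} (hF : SmoothOff F) (v : E5)
    {x : E5} (hx : x ≠ 0) :
    pd v (fun y => F (boost c s y)) x =
      pd v F (boost c s x) + pd v (boostShift c s) x * pd (bv 0) F (boost c s x) := by
  have h1 := (hF.differentiableAt (h.boost_ne_zero hx)).hasFDerivAt.comp x
    (hasFDerivAt_boost c s hx)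
  unfold pd
  have h2 : fderiv ℝ (fun y => F (boost c s y)) x = _ := h1.fderiv
  rw [h2]
  simp

/-- The map is x ↦ x + σ(x) e₀ with σ = `boostShift`. The chain rule produces ΔF, a multiple of
∂₀∂₀F that vanishes because c² − s² = 1, and a multiple of ∂₀F: 2s(d − 1)/|x| from Euler's identity
plus 4s/|x| from Δσ. Only ∂₀F is required to be homogeneous, so that the logarithm of the norm is
admissible. -/
theorem IsBoost.lap_comp {c s : ℝ} (h : IsBoost c s) {F : E5 → ℝ} (hF : SmoothOff F) {d : ℤ}
    (hd : HomDeg (d - 1) (pd (bv 0) F)) {x : E5} (hx : x ≠ 0) :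
    lap (fun y => F (boost c s y)) x =
      lap F (boost c s x) + 2 * s * (d + 1) * (‖x‖⁻¹ * pd (bv 0) F (boost c s x)) := by
  set y := boost c s x with hy
  have hy0 : y ≠ 0 := h.boost_ne_zero hx
  have hx' := norm_ne_zero_iff.2 hx
  have h1 : ∀ i, pd (bv i) (pd (bv i) fun z => F (boost c s z)) x =
      pd (bv i) (pd (bv i) F) y
        + 2 * (pd (bv i) (boostShift c s) x * pd (bv i) (pd (bv 0) F) y)
        + pd (bv i) (boostShift c s) x * pd (bv i) (boostShift c s) x
            * pd (bv 0) (pd (bv 0) F) y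
        + pd (bv i) (pd (bv i) (boostShift c s)) x * pd (bv 0) F y := by
    intro i
    rw [pd_congr (fun z hz => h.pd_comp hF (bv i) hz) _ hx,
      pd_add (h.smoothOff_comp (hF.pd _))
        (((smoothOff_boostShift c s).pd _).mul (h.smoothOff_comp (hF.pd _))) _ hx,
      pd_mul ((smoothOff_boostShift c s).pd _) (h.smoothOff_comp (hF.pd _)) _ hx,
      h.pd_comp (hF.pd _) _ hx, h.pd_comp (hF.pd _) _ hx, pd_comm hF (bv 0) (bv i) hy0]
    ring
  have h2 : lap (fun y => F (boost c s y)) x = lap F y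
      + 2 * ∑ i, pd (bv i) (boostShift c s) x * pd (bv i) (pd (bv 0) F) y
      + (∑ i, pd (bv i) (boostShift c s) x * pd (bv i) (boostShift c s) x)
            * pd (bv 0) (pd (bv 0) F) y
      + lap (boostShift c s) x * pd (bv 0) F y := by
    unfold lap
    rw [Finset.sum_congr rfl fun i _ => h1 i]
    simp only [Finset.sum_add_distrib, ← Finset.mul_sum, ← Finset.sum_mul]
  have h3 : ∑ i, pd (bv i) (boostShift c s) x * pd (bv i) (boostShift c s) x =
      (c - 1) ^ 2 + 2 * (c - 1) * s * (x 0 * ‖x‖⁻¹) + s ^ 2 := by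
    have e : ∀ i, pd (bv i) (boostShift c s) x * pd (bv i) (boostShift c s) x =
        bv i 0 * ((c - 1) ^ 2 * bv i 0 + 2 * (c - 1) * s * (x i * ‖x‖⁻¹))
          + s ^ 2 * ‖x‖⁻¹ ^ 2 * (x i * x i) := by
      intro i
      rw [pd_boostShift c s i hx]
      ring
    rw [Finset.sum_congr rfl fun i _ => e i, Finset.sum_add_distrib, ← Finset.mul_sum,
      sum_sq_coord]
    simp [bv]
    field_simp
  have h4 : ∑ i, pd (bv i) (boostShift c s) x * pd (bv i) (pd (bv 0) F) y =
      (c - 1) * pd (bv 0) (pd (bv 0) F) y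
        + s * ‖x‖⁻¹ * ((d - 1) * pd (bv 0) F y
          - boostShift c s x * pd (bv 0) (pd (bv 0) F) y) := by
    have e0 := hd.sum_mul_pd (hF.pd _) hy0
    -- Euler's identity is available along y, not x, whence the substitution x = y − σ(x) e₀.
    have e1 : ∑ i, x i * pd (bv i) (pd (bv 0) F) y = (d - 1) * pd (bv 0) F y
          - boostShift c s x * pd (bv 0) (pd (bv 0) F) y := by
      have e2 : ∀ i, x i = y i - boostShift c s x * bv 0 i := by
        intro i
        simp [hy, boost]
      rw [Finset.sum_congr rfl fun i _ => by rw [e2 i, sub_mul], Finset.sum_sub_distrib, e0]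
      simp [bv]
    rw [← e1, Finset.mul_sum]
    have e3 : ∀ i, pd (bv i) (boostShift c s) x * pd (bv i) (pd (bv 0) F) y =
        bv i 0 * ((c - 1) * pd (bv i) (pd (bv 0) F) y)
        + s * ‖x‖⁻¹ * (x i * pd (bv i) (pd (bv 0) F) y) := by
      intro i
      rw [pd_boostShift c s i hx]
      ring
    rw [Finset.sum_congr rfl fun i _ => e3 i, Finset.sum_add_distrib]
    simp [bv]
  rw [h2, h3, h4, lap_boostShift c s hx]
  unfold boostShift
  have hs := h.sq_sub
  field_simp
  -- The total coefficient of ∂₀∂₀F is 2(c − 1) − 2s² + (c − 1)² + s² = c² − s² − 1.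
  linear_combination ‖x‖ * pd (bv 0) (pd (bv 0) F) y * hs

/-- Δ|x|⁻¹ = −2|x|⁻³, and in degree −1 the cross term is 2|x|⁻³H, so the two cancel. -/
theorem lap_inv_norm_mul {H : E5 → ℝ} (hH : SmoothOff H) (hd : HomDeg (-1) H) {x : E5}
    (hx : x ≠ 0) : lap (fun y => ‖y‖⁻¹ * H y) x = ‖x‖⁻¹ * lap H x := by
  have hx' := norm_ne_zero_iff.2 hx
  have h1 := lap_mul (smoothOff_norm_zpow (-1)) hH hx
  have h2 : ∑ i, pd (bv i) (fun y => ‖y‖ ^ (-1 : ℤ)) x * pd (bv i) H x =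
      ‖x‖ ^ (-3 : ℤ) * H x := by
    have e : ∀ i, pd (bv i) (fun y => ‖y‖ ^ (-1 : ℤ)) x * pd (bv i) H x =
        -‖x‖ ^ (-3 : ℤ) * (x i * pd (bv i) H x) := by
      intro i
      rw [pd_norm_zpow _ _ hx]
      norm_num
      ring
    rw [Finset.sum_congr rfl fun i _ => e i, ← Finset.mul_sum, hd.sum_mul_pd hH hx]
    push_cast
    ring
  rw [h2, lap_norm_zpow _ hx] at h1
  simp only [zpow_neg_one] at h1
  rw [h1]
  norm_num
  ring

/-- In `lap_comp` the error coefficient 2s(d + 1) is 2s for F (d = 0), −2s for ΔF (d = −2) and 0 for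
∂₀F (d = −1). The Laplacian of the first error, computed with `lap_inv_norm_mul`, therefore cancels
the second. -/
theorem IsBoost.lap_lap_comp {c s : ℝ} (h : IsBoost c s) {F : E5 → ℝ} (hF : SmoothOff F)
    (hd : ∀ v, HomDeg (-1) (pd v F)) {x : E5} (hx : x ≠ 0) :
    lap (lap fun y => F (boost c s y)) x = lap (lap F) (boost c s x) := by
  have hd0 : HomDeg (0 - 1) (pd (bv 0) F) := hd (bv 0)
  have hlap : HomDeg (-2) (lap F) := by
    intro y hy r hr
    unfold lap
    rw [Finset.mul_sum]
    exact Finset.sum_congr rfl fun i _ => (hd (bv i)).pd (hF.pd _) (bv i) y hy r hr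
  have h1 : ∀ y, y ≠ 0 → lap (fun y => F (boost c s y)) y =
      lap F (boost c s y) + 2 * s * (‖y‖⁻¹ * pd (bv 0) F (boost c s y)) := by
    intro y hy
    rw [h.lap_comp hF hd0 hy]
    simp
  have hH := h.smoothOff_comp (hF.pd (bv 0))
  have hinv : SmoothOff (fun y => ‖y‖⁻¹) := by simpa using smoothOff_norm_zpow (-1)
  rw [lap_congr h1 hx, lap_add (h.smoothOff_comp hF.lap) ((hinv.mul hH).const_mul _) hx,
    lap_const_mul (hinv.mul hH) _ hx, lap_inv_norm_mul hH (h.homDeg_comp (hd _)) hx,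
    h.lap_comp hF.lap (d := -2) (hlap.pd hF.lap _) hx,
    h.lap_comp (hF.pd _) (d := -1) ((hd _).pd (hF.pd _) _) hx,
    pd_lap hF _ (h.boost_ne_zero hx)]
  push_cast
  ring

/-! ### The Paneitz operator through homogeneous extensions -/

theorem sphereLaplacian_eq {f : S4 → ℝ} (hf : SmoothOnSphere f) (ξ : S4) :
    sphereLaplacian f ξ = lap (homExt f) ξ :=
  laplacian_eq_lap hf.smoothOff (coe_sphere_ne_zero ξ)

theorem HomDeg.apply_radialProj {d : ℤ} {F : E5 → ℝ} (h : HomDeg d F) {x : E5} (hx : x ≠ 0) :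
    F x = ‖x‖ ^ d * F (radialProj x) := by
  rw [← h _ (coe_sphere_ne_zero _) _ (norm_pos_iff.2 hx), norm_smul_radialProj hx]

theorem homExt_sphereLaplacian {f : S4 → ℝ} (hf : SmoothOnSphere f) {x : E5} (hx : x ≠ 0) :
    homExt (sphereLaplacian f) x = ‖x‖ ^ (2 : ℤ) * lap (homExt f) x := by
  have hx' := norm_ne_zero_iff.2 hx
  rw [((homDeg_homExt f).lap hf.smoothOff).apply_radialProj hx, ← mul_assoc, ← zpow_add₀ hx',
    ← sphereLaplacian_eq hf]
  simp [homExt]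

theorem SmoothOff.congr {F G : E5 → ℝ} (hF : SmoothOff F) (h : ∀ x, x ≠ 0 → G x = F x) :
    SmoothOff G := ContDiffOn.congr hF fun x hx => h x hx

theorem SmoothOnSphere.sphereLaplacian {f : S4 → ℝ} (hf : SmoothOnSphere f) :
    SmoothOnSphere (sphereLaplacian f) :=
  smoothOnSphere_of_homExt
    (((smoothOff_norm_zpow 2).mul hf.smoothOff.lap).congr fun _ hx => homExt_sphereLaplacian hf hx)

/-- Δ|x|² contributes 10H and the cross term −8H, since H has degree −2. -/
theorem lap_norm_sq_mul {H : E5 → ℝ} (hH : SmoothOff H) (hd : HomDeg (-2) H) {x : E5}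
    (hx : x ≠ 0) :
    lap (fun y => ‖y‖ ^ (2 : ℤ) * H y) x = ‖x‖ ^ (2 : ℤ) * lap H x + 2 * H x := by
  have h1 := lap_mul (smoothOff_norm_zpow 2) hH hx
  have h2 : ∑ i, _root_.pd (bv i) (fun y => ‖y‖ ^ (2 : ℤ)) x * _root_.pd (bv i) H x =
      -4 * H x := by
    have e : ∀ i, _root_.pd (bv i) (fun y => ‖y‖ ^ (2 : ℤ)) x * _root_.pd (bv i) H x =
        2 * (x i * _root_.pd (bv i) H x) := by
      intro i
      rw [pd_norm_zpow _ _ hx]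
      norm_num
      ring
    rw [Finset.sum_congr rfl fun i _ => e i, ← Finset.mul_sum, hd.sum_mul_pd hH hx]
    push_cast
    ring
  rw [h1, h2, lap_norm_zpow _ hx]
  norm_num
  ring

/-- The degree-zero extension of Δf is |x|²ΔF, where F extends f. Applying the flat Laplacian gives
Δ²f = Δ²F + 2Δf on the sphere, and the last term is absorbed by the −2Δ of P₄. -/
theorem paneitz_eq {f : S4 → ℝ} (hf : SmoothOnSphere f) (ξ : S4) :
    paneitz f ξ = lap (lap (homExt f)) ξ := by
  have hξ := coe_sphere_ne_zero ξ
  unfold paneitz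
  rw [sphereLaplacian_eq hf.sphereLaplacian, sphereLaplacian_eq hf,
    lap_congr (fun y hy => homExt_sphereLaplacian hf hy) hξ,
    lap_norm_sq_mul hf.smoothOff.lap ((homDeg_homExt f).lap hf.smoothOff) hξ, norm_coe_sphere]
  simp

theorem SmoothOnSphere.add {f g : S4 → ℝ} (hf : SmoothOnSphere f) (hg : SmoothOnSphere g) :
    SmoothOnSphere (f + g) := smoothOnSphere_of_homExt (hf.smoothOff.add hg.smoothOff)

theorem SmoothOnSphere.const_smul {f : S4 → ℝ} (hf : SmoothOnSphere f) (a : ℝ) :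
    SmoothOnSphere (a • f) := smoothOnSphere_of_homExt (hf.smoothOff.const_mul a)

theorem SmoothOnSphere.sub {f g : S4 → ℝ} (hf : SmoothOnSphere f) (hg : SmoothOnSphere g) :
    SmoothOnSphere (f - g) := by
  have := hf.add (hg.const_smul (-1))
  rwa [neg_one_smul, ← sub_eq_add_neg] at this

theorem SmoothOnSphere.paneitz {f : S4 → ℝ} (hf : SmoothOnSphere f) :
    SmoothOnSphere (paneitz f) :=
  hf.sphereLaplacian.sphereLaplacian.sub (hf.sphereLaplacian.const_smul 2)

/-! ### The conformal maps of the sphere induced by boosts -/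

/-- The conformal map of the sphere induced by a boost. -/
noncomputable def boostMap (c s : ℝ) (ξ : S4) : S4 := radialProj (boost c s ξ)

theorem IsBoost.boostTime_coe_pos {c s : ℝ} (h : IsBoost c s) (ξ : S4) :
    0 < boostTime c s (ξ : E5) := h.boostTime_pos (coe_sphere_ne_zero ξ)

theorem boostTime_coe (c s : ℝ) (ξ : S4) : boostTime c s (ξ : E5) = c + s * (ξ : E5) 0 := by
  simp [boostTime]

theorem IsBoost.boostTime_smul_boostMap {c s : ℝ} (h : IsBoost c s) (ξ : S4) :
    boostTime c s (ξ : E5) • (boostMap c s ξ : E5) = boost c s ξ := by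
  rw [← h.norm_boost]
  exact norm_smul_radialProj (h.boost_ne_zero (coe_sphere_ne_zero ξ))

theorem IsBoost.coe_boostMap {c s : ℝ} (h : IsBoost c s) (ξ : S4) :
    (boostMap c s ξ : E5) = (boostTime c s (ξ : E5))⁻¹ • boost c s ξ := by
  rw [← h.boostTime_smul_boostMap, smul_smul, inv_mul_cancel₀ (h.boostTime_coe_pos ξ).ne',
    one_smul]

theorem IsBoost.boostMap_radialProj {c s : ℝ} (h : IsBoost c s) {x : E5} (hx : x ≠ 0) :
    boostMap c s (radialProj x) = radialProj (boost c s x) := by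
  unfold boostMap
  rw [← radialProj_smul (norm_pos_iff.2 hx) (h.boost_ne_zero (coe_sphere_ne_zero _)),
    ← boost_smul _ _ (norm_nonneg x), norm_smul_radialProj hx]

theorem IsBoost.homExt_comp_boostMap {c s : ℝ} (h : IsBoost c s) (f : S4 → ℝ) {x : E5}
    (hx : x ≠ 0) : homExt (fun ξ => f (boostMap c s ξ)) x = homExt f (boost c s x) := by
  simp [homExt, h.boostMap_radialProj hx]

theorem IsBoost.boostMap_neg_boostMap {c s : ℝ} (h : IsBoost c s) (ξ : S4) :
    boostMap c (-s) (boostMap c s ξ) = ξ := by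
  conv_lhs => arg 3; unfold boostMap
  rw [h.neg.boostMap_radialProj (h.boost_ne_zero (coe_sphere_ne_zero ξ)), h.boost_neg_boost,
    radialProj_coe_sphere]

theorem IsBoost.boostTime_neg_boostMap {c s : ℝ} (h : IsBoost c s) (ξ : S4) :
    boostTime c (-s) (boostMap c s ξ : E5) = (boostTime c s (ξ : E5))⁻¹ := by
  rw [h.coe_boostMap, boostTime_smul _ _ (inv_nonneg.2 (h.boostTime_coe_pos ξ).le),
    h.boostTime_neg_boost, norm_coe_sphere, mul_one]

theorem IsBoost.smoothOnSphere_comp {c s : ℝ} (h : IsBoost c s) {f : S4 → ℝ}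
    (hf : SmoothOnSphere f) : SmoothOnSphere (fun ξ => f (boostMap c s ξ)) :=
  smoothOnSphere_of_homExt
    ((h.smoothOff_comp hf.smoothOff).congr fun _ hx => h.homExt_comp_boostMap f hx)

/-- The bi-Laplacian of the extension has degree −4, and the boost of ξ has norm q(ξ); rescaling it
to the sphere gives the factor q⁻⁴. -/
theorem IsBoost.paneitz_comp {c s : ℝ} (h : IsBoost c s) {f : S4 → ℝ} (hf : SmoothOnSphere f)
    (ξ : S4) : paneitz (fun η => f (boostMap c s η)) ξ =
      boostTime c s (ξ : E5) ^ (-4 : ℤ) * paneitz f (boostMap c s ξ) := by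
  have hξ := coe_sphere_ne_zero ξ
  have hd := homDeg_homExt f
  rw [paneitz_eq (h.smoothOnSphere_comp hf), paneitz_eq hf,
    lap_congr (fun y hy => lap_congr (fun z hz => h.homExt_comp_boostMap f hz) hy) hξ,
    h.lap_lap_comp hf.smoothOff (fun v => hd.pd hf.smoothOff v) hξ,
    ((hd.lap hf.smoothOff).lap hf.smoothOff.lap).apply_radialProj (h.boost_ne_zero hξ),
    h.norm_boost]
  rfl

/-- The logarithm of the conformal factor. -/
noncomputable def logFactor (c s : ℝ) (ξ : S4) : ℝ := -Real.log (boostTime c s (ξ : E5))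

theorem IsBoost.homExt_logFactor {c s : ℝ} (h : IsBoost c s) {x : E5} (hx : x ≠ 0) :
    homExt (logFactor c s) x = Real.log ‖x‖ + (-1) * Real.log ‖boost c s x‖ := by
  have hx' := norm_pos_iff.2 hx
  unfold homExt logFactor
  rw [h.norm_boost, radialProj_coe hx, boostTime_smul _ _ (inv_nonneg.2 hx'.le),
    Real.log_mul (inv_pos.2 hx').ne' (h.boostTime_pos hx).ne', Real.log_inv]
  ring

theorem IsBoost.smoothOff_log_norm_boost {c s : ℝ} (h : IsBoost c s) :
    SmoothOff (fun x => Real.log ‖boost c s x‖) := h.smoothOff_comp smoothOff_log_norm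

theorem IsBoost.smoothOnSphere_logFactor {c s : ℝ} (h : IsBoost c s) :
    SmoothOnSphere (logFactor c s) :=
  smoothOnSphere_of_homExt
    ((smoothOff_log_norm.add (h.smoothOff_log_norm_boost.const_mul (-1))).congr
      fun _ hx => h.homExt_logFactor hx)

/-- A dilation changes ln |x| only by a constant, which is enough for `lap_lap_comp`. -/
theorem homDeg_pd_log_norm (v : E5) : HomDeg (-1) (_root_.pd v fun y => Real.log ‖y‖) := by
  have e : ∀ y : E5, y ≠ 0 →
      _root_.pd v (fun y => Real.log ‖y‖) y = ‖y‖⁻¹ * (inner ℝ y v / ‖y‖) := fun y hy => by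
    rw [pd_real_comp (k := Real.log) _ (smoothOff_norm.differentiableAt hy)
      (Real.hasDerivAt_log (norm_ne_zero_iff.2 hy)), pd_norm _ hy]
  intro x hx r hr
  have hx' := norm_ne_zero_iff.2 hx
  rw [e _ hx, e _ (smul_ne_zero hr.ne' hx), norm_smul, inner_smul_left, Real.norm_of_nonneg hr.le,
    zpow_neg_one]
  simp
  field_simp

/-- The Q-curvature equation: the extension of w is ln |x| − ln |Bx|, with B the boost, and Δ² ln
|x| = −6|x|⁻⁴ is transported through B. -/
theorem IsBoost.paneitz_logFactor {c s : ℝ} (h : IsBoost c s) (ξ : S4) :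
    paneitz (logFactor c s) ξ = 6 * boostTime c s (ξ : E5) ^ (-4 : ℤ) - 6 := by
  have hξ := coe_sphere_ne_zero ξ
  have hF := h.smoothOff_log_norm_boost
  have h1 : ∀ y, y ≠ 0 → lap (homExt (logFactor c s)) y =
      lap (fun x => Real.log ‖x‖) y + (-1) * lap (fun x => Real.log ‖boost c s x‖) y := by
    intro y hy
    rw [lap_congr (fun x hx => h.homExt_logFactor hx) hy,
      lap_add smoothOff_log_norm (hF.const_mul _) hy, lap_const_mul hF _ hy]
  rw [paneitz_eq h.smoothOnSphere_logFactor, lap_congr h1 hξ,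
    lap_add smoothOff_log_norm.lap (hF.lap.const_mul _) hξ, lap_const_mul hF.lap _ hξ,
    lap_lap_log_norm hξ,
    h.lap_lap_comp (F := fun x => Real.log ‖x‖) smoothOff_log_norm homDeg_pd_log_norm hξ,
    lap_lap_log_norm (h.boost_ne_zero hξ), h.norm_boost, norm_coe_sphere]
  simp
  ring

/-! ### The Jacobian determinant -/

/-- The extension of `boostMap`, homogeneous of degree one. -/
noncomputable def confExt (c s : ℝ) (x : E5) : E5 := (‖x‖ * (boostTime c s x)⁻¹) • boost c s x

theorem IsBoost.smul_boostMap_radialProj {c s : ℝ} (h : IsBoost c s) (x : E5) :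
    ‖x‖ • (boostMap c s (radialProj x) : E5) = confExt c s x := by
  rcases eq_or_ne x 0 with rfl | hx
  · simp [confExt]
  rw [h.boostMap_radialProj hx, radialProj_coe (h.boost_ne_zero hx), h.norm_boost, smul_smul]
  rfl

theorem IsBoost.smoothOff_ratio {c s : ℝ} (h : IsBoost c s) :
    SmoothOff (fun x => ‖x‖ * (boostTime c s x)⁻¹) :=
  smoothOff_norm.mul (SmoothOff.of_contDiffAt fun _ hx =>
    ((smoothOff_boostTime c s).contDiffAt hx).inv (h.boostTime_pos hx).ne')

theorem homDeg_ratio (c s : ℝ) : HomDeg 0 (fun x => ‖x‖ * (boostTime c s x)⁻¹) := by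
  intro x hx r hr
  simp only [boostTime_smul _ _ hr.le, norm_smul, Real.norm_of_nonneg hr.le]
  rw [mul_inv]
  field_simp

theorem homDeg_boostShift (c s : ℝ) : HomDeg 1 (boostShift c s) := by
  intro x hx r hr
  simp [boostShift, norm_smul, abs_of_pos hr]
  ring

/-- With κ = |x|/q(x), the derivative of κB is a rank-two perturbation of κ·id. Euler's identity
makes it a product of two transvections and the scalar κ, whose determinant is κ⁻¹ · κ⁵. -/
theorem IsBoost.exists_hasFDerivAt_confExt {c s : ℝ} (h : IsBoost c s) {x : E5} (hx : x ≠ 0) :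
    ∃ A : E5 →L[ℝ] E5, HasFDerivAt (confExt c s) A x ∧
      A.det = (‖x‖ * (boostTime c s x)⁻¹) ^ 4 := by
  set κ : E5 → ℝ := fun x => ‖x‖ * (boostTime c s x)⁻¹ with hκ
  have hx' := norm_ne_zero_iff.2 hx
  have hq := (h.boostTime_pos hx).ne'
  have hκx : κ x ≠ 0 := mul_ne_zero hx' (inv_ne_zero hq)
  have h1 := (h.smoothOff_ratio.differentiableAt hx).hasFDerivAt.smul (hasFDerivAt_boost c s hx)
  refine ⟨_, h1, ?_⟩
  set du := fderiv ℝ (boostShift c s) x with hdu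
  set dκ := fderiv ℝ κ x with hdκ
  have e1 : du x = boostShift c s x := by
    rw [(homDeg_boostShift c s).euler (smoothOff_boostShift c s) hx]
    simp
  have e2 : dκ x = 0 := by
    rw [(homDeg_ratio c s).euler h.smoothOff_ratio hx]
    simp
  have e3 : du (bv 0) = (c - 1) + s * (x 0 * ‖x‖⁻¹) := by
    have := pd_boostShift c s 0 hx
    unfold _root_.pd at this
    rw [this]
    simp [bv]
  -- The first transvection sends x to Bx, since dσ(x) = σ(x); this absorbs the term dκ ⊗ Bx into a
  -- transvection along x.
  have key : ((κ x • (ContinuousLinearMap.id ℝ E5 + du.smulRight (bv 0))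
      + dκ.smulRight (boost c s x) : E5 →L[ℝ] E5) : E5 →ₗ[ℝ] E5) =
      (LinearMap.transvection (du : E5 →ₗ[ℝ] ℝ) (bv 0)) ∘ₗ
        (κ x • LinearMap.transvection ((κ x)⁻¹ • (dκ : E5 →ₗ[ℝ] ℝ)) x) := by
    ext1 v
    simp [LinearMap.transvection.apply, e1, boost]
    match_scalars <;> field_simp
  unfold ContinuousLinearMap.det
  rw [key, LinearMap.det_comp, LinearMap.det_smul, LinearMap.transvection.det,
    LinearMap.transvection.det]
  -- 1 + dσ(e₀) = c + s x₀/|x|, which is the temporal part divided by |x|.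
  have e4 : 1 + du (bv 0) = (κ x)⁻¹ := by
    rw [e3, hκ]
    simp only [mul_inv, inv_inv]
    unfold boostTime
    field_simp
    ring
  simp only [ContinuousLinearMap.coe_coe, e4, LinearMap.smul_apply, e2, finrank_E5]
  change (κ x)⁻¹ * (κ x ^ (4 + 1) * (1 + (κ x)⁻¹ • (0 : ℝ))) = κ x ^ 4
  simp
  field_simp

theorem IsBoost.absJacobian_boostMap {c s : ℝ} (h : IsBoost c s) (ξ : S4) :
    absJacobian (boostMap c s) ξ = boostTime c s (ξ : E5) ^ (-4 : ℤ) := by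
  obtain ⟨A, hA, hdet⟩ := h.exists_hasFDerivAt_confExt (coe_sphere_ne_zero ξ)
  unfold absJacobian
  simp only [h.smul_boostMap_radialProj]
  change |(fderiv ℝ (confExt c s) (ξ : E5)).det| = _
  rw [hA.fderiv, hdet, norm_coe_sphere, one_mul, abs_of_pos
    (pow_pos (inv_pos.2 (h.boostTime_coe_pos ξ)) 4), inv_pow, zpow_neg]
  norm_cast

/-! ### Dilations are boosts -/

theorem isBoost_of_pos {t : ℝ} (ht : 0 < t) : IsBoost ((t + t⁻¹) / 2) ((t - t⁻¹) / 2) :=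
  ⟨by field_simp; ring, by positivity⟩

theorem pole_coe : (pole : E5) = bv 0 := rfl

theorem coord_lt_one {ξ : S4} (h : ξ ≠ pole) : (ξ : E5) 0 < 1 := by
  have h1 := inner_lt_one_iff_real_of_norm_eq_one (norm_coe_sphere ξ) (norm_coe_sphere pole)
  rw [pole_coe, inner_bv] at h1
  exact h1.2 fun e => h (Subtype.ext e)

theorem coe_orthogonalProjection_pole (x : E5) :
    (((ℝ ∙ (pole : E5))ᗮ.orthogonalProjectionOnto x : (ℝ ∙ (pole : E5))ᗮ) : E5) =
      x - x 0 • bv 0 := by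
  have h1 := (ℝ ∙ (pole : E5)).starProjection_add_starProjection_orthogonal x
  have h2 : (ℝ ∙ (pole : E5)).starProjection x = x 0 • bv 0 := by
    rw [Submodule.starProjection_unit_singleton ℝ (norm_coe_sphere pole), real_inner_comm,
      pole_coe, inner_bv]
  rw [h2] at h1
  rw [eq_sub_iff_add_eq']
  exact h1

/-- With a = ξ₀, both maps have zeroth coordinate (t²(1 + a) − (1 − a))/(t²(1 + a) + (1 − a)) and
multiply the orthogonal part by 2t/(t²(1 + a) + (1 − a)). The pole is separate, as the projection is
undefined there. -/
theorem dilation_eq_boostMap {t : ℝ} (ht : 0 < t) :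
    dilation t = boostMap ((t + t⁻¹) / 2) ((t - t⁻¹) / 2) := by
  have hb := isBoost_of_pos ht
  ext1 ξ
  apply Subtype.ext
  unfold dilation
  split_ifs with hξ
  · rw [hξ, hb.coe_boostMap, boostTime_coe]
    have e1 : boost ((t + t⁻¹) / 2) ((t - t⁻¹) / 2) (pole : E5) = t • bv 0 := by
      ext i
      rcases eq_or_ne i 0 with rfl | hi
      · rw [boost_zero_coord, norm_coe_sphere, pole_coe]
        simp [bv]
        ring
      · rw [boost_coord _ _ _ hi, pole_coe]
        simp [bv, hi]
    rw [e1, pole_coe, smul_smul]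
    have e2 : (t + t⁻¹) / 2 + (t - t⁻¹) / 2 * bv 0 0 = t := by
      simp [bv]
      ring
    rw [e2, inv_mul_cancel₀ ht.ne', one_smul]
  · set a := (ξ : E5) 0 with ha
    have ha1 : 0 < 1 - a := sub_pos.2 (coord_lt_one hξ)
    set p := (ℝ ∙ (pole : E5))ᗮ.orthogonalProjectionOnto (ξ : E5) with hp
    have hpc : (p : E5) = ξ - a • bv 0 := coe_orthogonalProjection_pole _
    have hpn : ‖p‖ ^ 2 = (1 - a) * (1 + a) := by
      change ‖(p : E5)‖ ^ 2 = _
      rw [hpc, norm_sub_sq_real, inner_smul_right, inner_bv, norm_coe_sphere, norm_smul]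
      simp [bv, ← ha]
      ring
    have e0 : inner ℝ (pole : E5) (ξ : E5) = a := by
      rw [real_inner_comm, pole_coe, inner_bv]
    have e1 : ((((stereographic (norm_eq_of_mem_sphere pole)).symm
        (t • stereographic (norm_eq_of_mem_sphere pole) ξ) : S4)) : E5) =
        (‖t • (2 / (1 - a)) • p‖ ^ 2 + 4)⁻¹ •
          ((4 : ℝ) • (t • (2 / (1 - a)) • (p : E5))
            + (‖t • (2 / (1 - a)) • p‖ ^ 2 - 4) • (pole : E5)) := by
      rw [stereographic_apply, e0, ← hp]
      rfl
    have e2 : ‖t • (2 / (1 - a)) • p‖ ^ 2 = 4 * t ^ 2 * (1 + a) / (1 - a) := by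
      rw [norm_smul, norm_smul, mul_pow, mul_pow, hpn, Real.norm_eq_abs, Real.norm_eq_abs,
        sq_abs, sq_abs]
      field_simp
      ring
    have hden : 0 < t ^ 2 * (1 + a) + (1 - a) := by
      have : -1 ≤ a := by
        have := (abs_le.1 (abs_coord_le (ξ : E5) 0)).1
        rwa [norm_coe_sphere] at this
      have : 0 ≤ t ^ 2 * (1 + a) := mul_nonneg (sq_nonneg t) (by linarith)
      linarith
    have hden' : boostTime ((t + t⁻¹) / 2) ((t - t⁻¹) / 2) (ξ : E5)
        = (t ^ 2 * (1 + a) + (1 - a)) / (2 * t) := by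
      rw [boostTime_coe, ← ha]
      field_simp
      ring
    have e3 : (4 * t ^ 2 * (1 + a) / (1 - a) + 4)⁻¹ =
        (1 - a) / (4 * (t ^ 2 * (1 + a) + (1 - a))) := by
      field_simp
    rw [e1, e2, hb.coe_boostMap, hden', e3]
    ext i
    rcases eq_or_ne i 0 with rfl | hi
    · simp only [PiLp.smul_apply, boost_zero_coord, norm_coe_sphere, hpc,
        PiLp.add_apply, PiLp.sub_apply, pole_coe, ← ha, smul_eq_mul]
      simp [bv]
      field_simp
      ring
    · simp only [PiLp.smul_apply, boost_coord _ _ _ hi, hpc,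
        PiLp.add_apply, PiLp.sub_apply, pole_coe, smul_eq_mul]
      simp [bv, hi]
      field_simp

section

/-! ### The surface measure in polar coordinates -/

open scoped ENNReal

theorem toSphere_univ_ne_zero : (volume : Measure E5).toSphere Set.univ ≠ 0 := by
  rw [Ne, Measure.measure_univ_eq_zero]
  exact Measure.toSphere_ne_zero _

instance isProbabilityMeasure_sphereMeasure : IsProbabilityMeasure sphereMeasure :=
  ⟨by
    rw [sphereMeasure, Measure.smul_apply, smul_eq_mul]
    exact ENNReal.inv_mul_cancel toSphere_univ_ne_zero (measure_ne_top _ _)⟩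

theorem toSphere_eq_smul : (volume : Measure E5).toSphere =
    ((volume : Measure E5).toSphere Set.univ) • sphereMeasure := by
  rw [sphereMeasure, smul_smul, ENNReal.mul_inv_cancel toSphere_univ_ne_zero (measure_ne_top _ _),
    one_smul]

theorem measurable_radialProj : Measurable radialProj := by
  refine measurable_of_continuousOn_compl_singleton 0 ?_
  rw [continuousOn_iff_continuous_domRestrict]
  refine continuous_induced_rng.2 ?_
  rw [continuous_iff_continuousAt]
  intro x
  exact ((contDiffAt_coe_radialProj x.2).continuousAt).comp continuous_subtype_val.continuousAt

theorem radialProj_eq_fst (x : ({0}ᶜ : Set E5)) :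
    (homeomorphUnitSphereProd E5 x).1 = radialProj (x : E5) := by
  apply Subtype.ext
  rw [homeomorphUnitSphereProd_apply_fst_coe, radialProj_coe x.2]

theorem integral_norm_mul_radialProj_aux (k : ℝ → ℝ) (g : S4 → ℝ) :
    ∫ x : E5, k ‖x‖ * g (radialProj x) =
      (∫ ξ, g ξ ∂(volume : Measure E5).toSphere) *
        ∫ r : Set.Ioi (0 : ℝ), k r ∂(Measure.volumeIoiPow (Module.finrank ℝ E5 - 1)) := by
  calc ∫ x : E5, k ‖x‖ * g (radialProj x)
      = ∫ x : ({(0)}ᶜ : Set E5), k ‖x.1‖ * g (radialProj x.1) ∂(volume.comap Subtype.val) := by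
        rw [integral_subtype_comap (measurableSet_singleton _).compl
          fun x : E5 => k ‖x‖ * g (radialProj x), restrict_compl_singleton]
    _ = ∫ p : S4 × Set.Ioi (0 : ℝ), g p.1 * k p.2 ∂((volume : Measure E5).toSphere.prod
          (.volumeIoiPow (Module.finrank ℝ E5 - 1))) := by
        rw [← (Measure.measurePreserving_homeomorphUnitSphereProd
          (volume : Measure E5)).integral_comp (Homeomorph.measurableEmbedding _)]
        simp [radialProj_eq_fst, mul_comm]
    _ = _ := integral_prod_mul (f := g) (g := fun r : Set.Ioi (0 : ℝ) => k r)

theorem integral_norm_mul_radialProj (k : ℝ → ℝ) (g : S4 → ℝ) :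
    ∫ x : E5, k ‖x‖ * g (radialProj x) = (∫ x : E5, k ‖x‖) * ∫ ξ, g ξ ∂sphereMeasure := by
  -- The case g = 1 identifies the radial factor with ∫ k(|x|) dx up to the total mass of the
  -- sphere, which the normalization removes.
  have h1 := integral_norm_mul_radialProj_aux k (fun _ => 1)
  simp only [mul_one] at h1
  rw [integral_norm_mul_radialProj_aux, h1, toSphere_eq_smul, integral_smul_measure,
    integral_smul_measure]
  simp
  ring

theorem lintegral_norm_mul_radialProj_aux {k : ℝ → ℝ≥0∞} (hk : Measurable k) {g : S4 → ℝ≥0∞}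
    (hg : Measurable g) :
    ∫⁻ x : E5, k ‖x‖ * g (radialProj x) =
      (∫⁻ ξ, g ξ ∂(volume : Measure E5).toSphere) *
        ∫⁻ r : Set.Ioi (0 : ℝ), k r ∂(Measure.volumeIoiPow (Module.finrank ℝ E5 - 1)) := by
  calc ∫⁻ x : E5, k ‖x‖ * g (radialProj x)
      = ∫⁻ x : ({(0)}ᶜ : Set E5), k ‖x.1‖ * g (radialProj x.1) ∂(volume.comap Subtype.val) := by
        rw [lintegral_subtype_comap (measurableSet_singleton _).compl
          (fun x : E5 => k ‖x‖ * g (radialProj x)), restrict_compl_singleton]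
    _ = ∫⁻ p : S4 × Set.Ioi (0 : ℝ), g p.1 * k p.2 ∂((volume : Measure E5).toSphere.prod
          (.volumeIoiPow (Module.finrank ℝ E5 - 1))) := by
        rw [← (Measure.measurePreserving_homeomorphUnitSphereProd
          (volume : Measure E5)).lintegral_comp_emb (Homeomorph.measurableEmbedding _)]
        simp [radialProj_eq_fst, mul_comm]
    _ = _ := lintegral_prod_mul hg.aemeasurable (hk.comp measurable_subtype_coe).aemeasurable

theorem lintegral_norm_mul_radialProj {k : ℝ → ℝ≥0∞} (hk : Measurable k) {g : S4 → ℝ≥0∞}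
    (hg : Measurable g) :
    ∫⁻ x : E5, k ‖x‖ * g (radialProj x) = (∫⁻ x : E5, k ‖x‖) * ∫⁻ ξ, g ξ ∂sphereMeasure := by
  have h1 := lintegral_norm_mul_radialProj_aux hk (g := fun _ => 1) measurable_const
  simp only [mul_one] at h1
  rw [lintegral_norm_mul_radialProj_aux hk hg, h1, toSphere_eq_smul, lintegral_smul_measure,
    lintegral_smul_measure]
  simp
  ring

/-- Functions whose integrals against one nontrivial radial weight agree have the same integral
over the sphere. -/
theorem lintegral_sphere_eq_of_ball {g₁ g₂ : S4 → ℝ≥0∞} (h₁ : Measurable g₁) (h₂ : Measurable g₂)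
    (h : ∫⁻ x : E5, (Set.Iio (1 : ℝ)).indicator 1 ‖x‖ * g₁ (radialProj x) =
      ∫⁻ x : E5, (Set.Iio (1 : ℝ)).indicator 1 ‖x‖ * g₂ (radialProj x)) :
    ∫⁻ ξ, g₁ ξ ∂sphereMeasure = ∫⁻ ξ, g₂ ξ ∂sphereMeasure := by
  have hk : Measurable ((Set.Iio (1 : ℝ)).indicator (1 : ℝ → ℝ≥0∞)) :=
    measurable_one.indicator measurableSet_Iio
  rw [lintegral_norm_mul_radialProj hk h₁, lintegral_norm_mul_radialProj hk h₂] at h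
  have e : ∫⁻ x : E5, (Set.Iio (1 : ℝ)).indicator (1 : ℝ → ℝ≥0∞) ‖x‖ =
      volume (Metric.ball (0 : E5) 1) := by
    rw [← lintegral_indicator_one Metric.isOpen_ball.measurableSet]
    congr 1
    ext x
    simp [Set.indicator]
  rw [e] at h
  exact (ENNReal.mul_right_inj (Metric.measure_ball_pos _ _ one_pos).ne'
    measure_ball_lt_top.ne).1 h

/-! ### Change of variables under boosts -/

theorem IsBoost.continuous_boostMap {c s : ℝ} (h : IsBoost c s) : Continuous (boostMap c s) := by
  refine continuous_induced_rng.2 ?_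
  rw [continuous_iff_continuousAt]
  intro ξ
  exact ((contDiffAt_coe_radialProj (h.boost_ne_zero (coe_sphere_ne_zero ξ))).continuousAt.comp
    (contDiffAt_boost c s (coe_sphere_ne_zero ξ)).continuousAt).comp
    continuous_subtype_val.continuousAt

/-- The conformal map of a boost as a homeomorphism. -/
noncomputable def IsBoost.homeo {c s : ℝ} (h : IsBoost c s) : S4 ≃ₜ S4 where
  toFun := boostMap c s
  invFun := boostMap c (-s)
  left_inv := h.boostMap_neg_boostMap
  right_inv ξ := by simpa using h.neg.boostMap_neg_boostMap ξ
  continuous_toFun := h.continuous_boostMap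
  continuous_invFun := h.neg.continuous_boostMap

theorem IsBoost.measurableEmbedding {c s : ℝ} (h : IsBoost c s) :
    MeasurableEmbedding (boostMap c s) := h.homeo.measurableEmbedding

theorem IsBoost.confExt_ne_zero {c s : ℝ} (h : IsBoost c s) {x : E5} (hx : x ≠ 0) :
    confExt c s x ≠ 0 :=
  smul_ne_zero (mul_ne_zero (norm_ne_zero_iff.2 hx) (inv_ne_zero (h.boostTime_pos hx).ne'))
    (h.boost_ne_zero hx)

theorem IsBoost.norm_confExt {c s : ℝ} (h : IsBoost c s) (x : E5) : ‖confExt c s x‖ = ‖x‖ := by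
  rw [← h.smul_boostMap_radialProj, norm_smul, norm_coe_sphere]
  simp

theorem IsBoost.radialProj_confExt {c s : ℝ} (h : IsBoost c s) {x : E5} (hx : x ≠ 0) :
    radialProj (confExt c s x) = boostMap c s (radialProj x) := by
  rw [← h.smul_boostMap_radialProj, radialProj_smul (norm_pos_iff.2 hx) (coe_sphere_ne_zero _),
    radialProj_coe_sphere]

theorem IsBoost.confExt_neg_confExt {c s : ℝ} (h : IsBoost c s) {x : E5} (hx : x ≠ 0) :
    confExt c (-s) (confExt c s x) = x := by
  rw [← h.neg.smul_boostMap_radialProj, h.norm_confExt, h.radialProj_confExt hx,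
    h.boostMap_neg_boostMap, norm_smul_radialProj hx]

theorem ratio_eq (c s : ℝ) {x : E5} (hx : x ≠ 0) :
    (‖x‖ * (boostTime c s x)⁻¹) ^ 4 = boostTime c s (radialProj x : E5) ^ (-4 : ℤ) := by
  have hx' := norm_pos_iff.2 hx
  rw [radialProj_coe hx, boostTime_smul _ _ (inv_nonneg.2 hx'.le), zpow_neg, mul_pow, inv_pow]
  norm_cast
  rw [mul_pow, mul_inv, inv_pow, inv_inv]

theorem continuous_boostTime_coe (c s : ℝ) : Continuous fun ξ : S4 => boostTime c s (ξ : E5) := by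
  unfold boostTime
  fun_prop

/-- The density of the pull-back of the surface measure under a boost. -/
noncomputable def boostDensity (c s : ℝ) (ξ : S4) : NNReal :=
  Real.toNNReal (boostTime c s (ξ : E5) ^ (-4 : ℤ))

theorem IsBoost.continuous_zpow {c s : ℝ} (h : IsBoost c s) :
    Continuous fun ξ : S4 => boostTime c s (ξ : E5) ^ (-4 : ℤ) :=
  (continuous_boostTime_coe c s).zpow₀ _ fun ξ => Or.inl (h.boostTime_coe_pos ξ).ne'

theorem IsBoost.coe_boostDensity {c s : ℝ} (h : IsBoost c s) (ξ : S4) :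
    (boostDensity c s ξ : ℝ) = boostTime c s (ξ : E5) ^ (-4 : ℤ) :=
  Real.coe_toNNReal _ (zpow_pos (h.boostTime_coe_pos ξ) _).le

theorem IsBoost.measurable_boostDensity {c s : ℝ} (h : IsBoost c s) :
    Measurable (boostDensity c s) := h.continuous_zpow.measurable.real_toNNReal

/-- The degree-one extension `confExt` preserves the norm, hence the radial weight, acts as the
conformal map on directions, and has Jacobian q⁻⁴ constant on rays. The change of variables in ℝ⁵
thus descends to the sphere. -/
theorem IsBoost.lintegral_comp {c s : ℝ} (h : IsBoost c s) {g : S4 → ℝ≥0∞} (hg : Measurable g) :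
    ∫⁻ ξ, boostDensity c s ξ * g (boostMap c s ξ) ∂sphereMeasure =
      ∫⁻ ξ, g ξ ∂sphereMeasure := by
  refine lintegral_sphere_eq_of_ball (h.measurable_boostDensity.coe_nnreal_ennreal.mul
    (hg.comp h.continuous_boostMap.measurable)) hg ?_
  have himg : confExt c s '' {0}ᶜ = {0}ᶜ := by
    ext x
    constructor
    · rintro ⟨y, hy, rfl⟩
      exact h.confExt_ne_zero hy
    · intro hx
      refine ⟨confExt c (-s) x, h.neg.confExt_ne_zero hx, ?_⟩
      simpa using h.neg.confExt_neg_confExt hx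
  choose! A hA hdet using fun (x : E5) (hx : x ≠ 0) => h.exists_hasFDerivAt_confExt hx
  have key := lintegral_image_eq_lintegral_abs_det_fderiv_mul (volume : Measure E5)
    (s := {0}ᶜ) (f := confExt c s) (f' := A) (measurableSet_singleton _).compl
    (fun x hx => (hA x hx).hasFDerivWithinAt)
    (fun x hx y hy hxy => by
      rw [← h.confExt_neg_confExt hx, hxy, h.confExt_neg_confExt hy])
    (fun x => (Set.Iio (1 : ℝ)).indicator 1 ‖x‖ * g (radialProj x))
  rw [himg, restrict_compl_singleton] at key
  rw [key, ← restrict_compl_singleton (μ := (volume : Measure E5)) 0]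
  refine setLIntegral_congr_fun (measurableSet_singleton _).compl fun x hx => ?_
  have hx0 : x ≠ 0 := hx
  simp only [hdet x hx0, h.norm_confExt, h.radialProj_confExt hx0, ratio_eq c s hx0]
  rw [abs_of_pos (zpow_pos (h.boostTime_coe_pos _) _)]
  change _ * (ENNReal.ofReal _ * _) = _
  ring

theorem IsBoost.measurePreserving {c s : ℝ} (h : IsBoost c s) :
    MeasurePreserving (boostMap c s)
      (sphereMeasure.withDensity fun ξ => (boostDensity c s ξ : ℝ≥0∞)) sphereMeasure := by
  refine ⟨h.continuous_boostMap.measurable, ?_⟩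
  refine Measure.ext_of_lintegral _ fun g hg => ?_
  rw [lintegral_map hg h.continuous_boostMap.measurable,
    ← h.lintegral_comp hg]
  exact lintegral_withDensity_eq_lintegral_mul _ h.measurable_boostDensity.coe_nnreal_ennreal
    (hg.comp h.continuous_boostMap.measurable)

theorem IsBoost.integral_comp {c s : ℝ} (h : IsBoost c s) (g : S4 → ℝ) :
    ∫ ξ, boostTime c s (ξ : E5) ^ (-4 : ℤ) * g (boostMap c s ξ) ∂sphereMeasure =
      ∫ ξ, g ξ ∂sphereMeasure := by
  rw [← h.measurePreserving.integral_comp h.measurableEmbedding g,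
    integral_withDensity_eq_integral_smul h.measurable_boostDensity]
  refine integral_congr_ae (Eventually.of_forall fun ξ => ?_)
  simp only [NNReal.smul_def, h.coe_boostDensity, smul_eq_mul]

theorem IsBoost.boostTime_le {c s : ℝ} (h : IsBoost c s) (ξ : S4) :
    boostTime c s (ξ : E5) ≤ 2 * c := by
  rw [boostTime_coe]
  have h1 := abs_coord_le (ξ : E5) 0
  rw [norm_coe_sphere] at h1
  have h2 : |s * (ξ : E5) 0| ≤ |s| := by
    rw [abs_mul]
    exact mul_le_of_le_one_right (abs_nonneg s) h1
  linarith [le_abs_self (s * (ξ : E5) 0), h.abs_lt]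

/-- Since q ≤ 2c, the density q⁻⁴ is at least (2c)⁻⁴. This bounds composition with the conformal map
on L². -/
theorem IsBoost.map_le {c s : ℝ} (h : IsBoost c s) :
    sphereMeasure.map (boostMap c s) ≤ ENNReal.ofReal ((2 * c) ^ 4) • sphereMeasure := by
  have hm := h.continuous_boostMap.measurable
  refine Measure.le_iff.2 fun t ht => ?_
  have hind : Measurable (t.indicator (1 : S4 → ℝ≥0∞)) := measurable_one.indicator ht
  have hme : Measurable fun ξ => (boostDensity c s ξ : ℝ≥0∞) * t.indicator 1 (boostMap c s ξ) :=
    h.measurable_boostDensity.coe_nnreal_ennreal.mul (hind.comp hm)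
  rw [← lintegral_indicator_one ht, ← lintegral_indicator_one ht, lintegral_map hind hm,
    lintegral_smul_measure, ← h.lintegral_comp hind, smul_eq_mul, ← lintegral_const_mul _ hme]
  refine lintegral_mono fun ξ => ?_
  rw [← mul_assoc]
  refine le_mul_of_one_le_left zero_le ?_
  have hq := h.boostTime_coe_pos ξ
  change (1 : ℝ≥0∞) ≤ ENNReal.ofReal _ * ENNReal.ofReal _
  rw [← ENNReal.ofReal_mul (by positivity), ENNReal.one_le_ofReal, zpow_neg]
  norm_cast
  rw [← div_eq_mul_inv, one_le_div (pow_pos hq 4)]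
  exact pow_le_pow_left₀ hq.le (h.boostTime_le ξ) 4

theorem IsBoost.exists_eLpNorm_comp_le {c s : ℝ} (h : IsBoost c s) :
    ∃ C : ℝ≥0∞, C ≠ ⊤ ∧ ∀ g : S4 → ℝ,
      eLpNorm (fun ξ => g (boostMap c s ξ)) 2 sphereMeasure ≤ C * eLpNorm g 2 sphereMeasure := by
  refine ⟨ENNReal.ofReal ((2 * c) ^ 4) ^ (1 / (2 : ℝ≥0∞)).toReal,
    ENNReal.rpow_ne_top_of_nonneg ENNReal.toReal_nonneg ENNReal.ofReal_ne_top, fun g => ?_⟩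
  have h1 := h.measurableEmbedding.eLpNorm_map_measure (g := g) (p := 2) (μ := sphereMeasure)
  have h2 := eLpNorm_mono_measure (p := 2) g h.map_le
  rw [h1] at h2
  refine h2.trans ?_
  rw [eLpNorm_smul_measure_of_ne_top (by simp), smul_eq_mul]

/-! ### The antipodal map -/

theorem lintegral_sphere_neg {g : S4 → ℝ≥0∞} (hg : Measurable g) :
    ∫⁻ ξ, g (-ξ) ∂sphereMeasure = ∫⁻ ξ, g ξ ∂sphereMeasure := by
  refine lintegral_sphere_eq_of_ball (hg.comp continuous_neg.measurable) hg ?_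
  rw [← lintegral_neg_eq_self (μ := (volume : Measure E5))
    (fun x : E5 => (Set.Iio (1 : ℝ)).indicator 1 ‖x‖ * g (radialProj x)),
    ← restrict_compl_singleton (μ := (volume : Measure E5)) 0]
  refine setLIntegral_congr_fun (measurableSet_singleton _).compl fun x hx => ?_
  have hx0 : x ≠ 0 := hx
  have e : radialProj (-x) = -radialProj x := by
    apply Subtype.ext
    change _ = -(radialProj x : E5)
    rw [radialProj_coe hx0, radialProj_coe (neg_ne_zero.2 hx0)]
    simp
  simp only [e, norm_neg]

theorem integral_sphere_neg (g : S4 → ℝ) :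
    ∫ ξ, g (-ξ) ∂sphereMeasure = ∫ ξ, g ξ ∂sphereMeasure := by
  have hm : MeasurePreserving (fun ξ : S4 => -ξ) sphereMeasure sphereMeasure := by
    refine ⟨continuous_neg.measurable, Measure.ext_of_lintegral _ fun g hg => ?_⟩
    rw [lintegral_map hg continuous_neg.measurable, lintegral_sphere_neg hg]
  exact hm.integral_comp (Homeomorph.neg S4).measurableEmbedding g

end

/-! ### Symmetry of the Laplacian of the sphere -/

theorem contDiff_radial_mul {k : ℝ → ℝ} (hk : ContDiff ℝ ∞ k) (h0 : ∀ r, r < 1 → k r = 0)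
    {H : E5 → ℝ} (hH : SmoothOff H) : ContDiff ℝ ∞ fun x => k ‖x‖ * H x := by
  rw [contDiff_iff_contDiffAt]
  intro x
  rcases eq_or_ne x 0 with rfl | hx
  · refine (contDiffAt_const (c := (0 : ℝ))).congr_of_eventuallyEq ?_
    filter_upwards [Metric.ball_mem_nhds (0 : E5) one_pos] with y hy
    rw [h0 _ (by simpa using hy), zero_mul]
  · exact (hk.contDiffAt.comp x (contDiffAt_norm ℝ hx)).mul (hH.contDiffAt hx)

theorem hasCompactSupport_radial_mul {k : ℝ → ℝ} {R : ℝ} (h1 : ∀ r, R < r → k r = 0)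
    (H : E5 → ℝ) : HasCompactSupport fun x => k ‖x‖ * H x := by
  refine HasCompactSupport.intro (isCompact_closedBall (0 : E5) R) fun x hx => ?_
  rw [h1 _ (by simpa using hx), zero_mul]

theorem integral_fderiv_eq_zero_of_compact {φ : E5 → ℝ} (hφ : ContDiff ℝ ∞ φ)
    (hc : HasCompactSupport φ) (v : E5) : ∫ x, fderiv ℝ φ x v = 0 := by
  have hi : Integrable φ := hφ.continuous.integrable_of_hasCompactSupport hc
  have hd : Continuous fun x => fderiv ℝ φ x v :=
    (hφ.continuous_fderiv (by simp)).clm_apply continuous_const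
  have hi' : Integrable fun x => fderiv ℝ φ x v :=
    hd.integrable_of_hasCompactSupport (hc.fderiv_apply ℝ v)
  -- Integration by parts against the constant function 1.
  have h := integral_mul_fderiv_eq_neg_fderiv_mul_of_integrable (μ := (volume : Measure E5))
    (f := fun _ : E5 => (1 : ℝ)) (g := φ) (v := v) (by simp) (by simpa using hi')
    (by simpa using hi) (fun x _ => differentiableAt_const _)
    (fun x _ => (hφ.differentiable (by simp)) x)
  simpa using h

/-- A smooth radial weight supported in the shell between the radii one and three. -/
noncomputable def shellBump : ContDiffBump (2 : ℝ) := ⟨1 / 2, 1, by norm_num, by norm_num⟩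

theorem shellBump_of_lt {r : ℝ} (hr : r < 1) : shellBump r = 0 := by
  apply shellBump.zero_of_le_dist
  change (1 : ℝ) ≤ _
  rw [Real.dist_eq, abs_sub_comm]
  exact le_trans (by linarith) (le_abs_self _)

theorem shellBump_of_gt {r : ℝ} (hr : 3 < r) : shellBump r = 0 := by
  apply shellBump.zero_of_le_dist
  change (1 : ℝ) ≤ _
  rw [Real.dist_eq]
  exact le_trans (by linarith) (le_abs_self _)

/-- Green's identity: the divergence of k(|x|)(F∇G − G∇F) integrates to zero over ℝ⁵, where k is a
bump on a shell, and polar coordinates isolate the spherical integral with a positive radial factor.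
-/
theorem integral_mul_sphereLaplacian_comm {f g : S4 → ℝ} (hf : SmoothOnSphere f)
    (hg : SmoothOnSphere g) :
    ∫ ξ, f ξ * sphereLaplacian g ξ ∂sphereMeasure =
      ∫ ξ, g ξ * sphereLaplacian f ξ ∂sphereMeasure := by
  set F := homExt f with hF
  set G := homExt g with hG
  have sF : SmoothOff F := hf.smoothOff
  have sG : SmoothOff G := hg.smoothOff
  let k : ℝ → ℝ := shellBump
  have hk : ContDiff ℝ ∞ k := shellBump.contDiff
  have hk0 : ∀ r, r < 1 → k r = 0 := fun r hr => shellBump_of_lt hr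
  have hk1 : ∀ r, 3 < r → k r = 0 := fun r hr => shellBump_of_gt hr
  let H : Fin 5 → E5 → ℝ := fun i x => F x * pd (bv i) G x + (-1) * (G x * pd (bv i) F x)
  have sH : ∀ i, SmoothOff (H i) := fun i =>
    (sF.mul (sG.pd _)).add ((sG.mul (sF.pd _)).const_mul (-1))
  have sK : SmoothOff (fun x => k ‖x‖) :=
    SmoothOff.of_contDiffAt fun x hx => hk.contDiffAt.comp x (contDiffAt_norm ℝ hx)
  have hz : ∑ i, ∫ x, fderiv ℝ (fun y => k ‖y‖ * H i y) x (bv i) = 0 :=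
    Finset.sum_eq_zero fun i _ => integral_fderiv_eq_zero_of_compact
      (contDiff_radial_mul hk hk0 (sH i)) (hasCompactSupport_radial_mul hk1 (H i)) (bv i)
  rw [← integral_finsetSum _ fun i _ => ?_] at hz
  swap
  · refine Continuous.integrable_of_hasCompactSupport ?_
      ((hasCompactSupport_radial_mul hk1 (H i)).fderiv_apply ℝ _)
    exact ((contDiff_radial_mul hk hk0 (sH i)).continuous_fderiv (by simp)).clm_apply
      continuous_const
  have hpt : ∀ x : E5, x ≠ 0 → ∑ i, fderiv ℝ (fun y => k ‖y‖ * H i y) x (bv i) =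
      k ‖x‖ * ‖x‖ ^ (-2 : ℤ) * (fun ξ => f ξ * sphereLaplacian g ξ
        - g ξ * sphereLaplacian f ξ) (radialProj x) := by
    intro x hx
    have hx' := norm_ne_zero_iff.2 hx
    have e1 : ∀ i, fderiv ℝ (fun y => k ‖y‖ * H i y) x (bv i) =
        k ‖x‖ * (F x * pd (bv i) (pd (bv i) G) x - G x * pd (bv i) (pd (bv i) F) x)
        + deriv k ‖x‖ * ‖x‖⁻¹ * (F x * (x i * pd (bv i) G x) - G x * (x i * pd (bv i) F x)) := by
      intro i
      change pd (bv i) (fun y => k ‖y‖ * H i y) x = _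
      rw [pd_mul sK (sH i) _ hx, pd_add (sF.mul (sG.pd _)) ((sG.mul (sF.pd _)).const_mul (-1)) _ hx,
        pd_const_mul (sG.mul (sF.pd _)) _ _ hx, pd_mul sF (sG.pd _) _ hx, pd_mul sG (sF.pd _) _ hx,
        pd_real_comp (k := k) _ (smoothOff_norm.differentiableAt hx)
          ((hk.differentiable (by simp)) _).hasDerivAt, pd_norm _ hx, inner_bv]
      simp only [H]
      ring
    -- The derivative of the weight k meets only x·∇F and x·∇G, which vanish in degree zero.
    have e2 := (homDeg_homExt f).sum_mul_pd sF hx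
    have e3 := (homDeg_homExt g).sum_mul_pd sG hx
    have e4 : lap F x = ‖x‖ ^ (-2 : ℤ) * sphereLaplacian f (radialProj x) := by
      rw [((homDeg_homExt f).lap sF).apply_radialProj hx, sphereLaplacian_eq hf]
      rfl
    have e5 : lap G x = ‖x‖ ^ (-2 : ℤ) * sphereLaplacian g (radialProj x) := by
      rw [((homDeg_homExt g).lap sG).apply_radialProj hx, sphereLaplacian_eq hg]
      rfl
    rw [Finset.sum_congr rfl fun i _ => e1 i, Finset.sum_add_distrib, ← Finset.mul_sum,
      ← Finset.mul_sum, Finset.sum_sub_distrib, Finset.sum_sub_distrib, ← Finset.mul_sum,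
      ← Finset.mul_sum, ← Finset.mul_sum, ← Finset.mul_sum, e2, e3]
    change k ‖x‖ * (F x * lap G x - G x * lap F x) + _ = _
    rw [e4, e5]
    simp only [hF, hG, homExt]
    push_cast
    ring
  have hae : ∀ᵐ x : E5, x ≠ 0 := by
    rw [ae_iff]
    simp
  rw [integral_congr_ae (hae.mono hpt),
    integral_norm_mul_radialProj (fun r => k r * r ^ (-2 : ℤ)) (fun ξ =>
      f ξ * sphereLaplacian g ξ - g ξ * sphereLaplacian f ξ)] at hz
  have hpos : 0 < ∫ x : E5, k ‖x‖ * ‖x‖ ^ (-2 : ℤ) := by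
    have hc := (contDiff_radial_mul hk hk0 (smoothOff_norm_zpow (-2))).continuous
    refine hc.integral_pos_of_hasCompactSupport_nonneg_nonzero
      (hasCompactSupport_radial_mul hk1 _)
      (fun x => mul_nonneg shellBump.nonneg (zpow_nonneg (norm_nonneg x) _))
      (x := (2 : ℝ) • (pole : E5)) ?_
    have e : ‖(2 : ℝ) • (pole : E5)‖ = 2 := by rw [norm_smul, norm_coe_sphere]; simp
    have e' : k 2 = 1 := shellBump.one_of_mem_closedBall
      (Metric.mem_closedBall_self shellBump.rIn_pos.le)
    simp only [e, e']
    norm_num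
  have h0 := (mul_eq_zero.1 hz).resolve_left hpos.ne'
  have hi : ∀ {a b : S4 → ℝ}, SmoothOnSphere a → SmoothOnSphere b →
      Integrable (fun ξ => a ξ * sphereLaplacian b ξ) sphereMeasure := fun ha hb =>
    (ha.continuous.mul hb.sphereLaplacian.continuous).integrable_of_hasCompactSupport
      (HasCompactSupport.of_compactSpace _)
  rw [integral_sub (hi hf hg) (hi hg hf)] at h0
  exact sub_eq_zero.1 h0

/-! ### The bilinear form of the Paneitz operator on smooth functions -/

theorem SmoothOnSphere.integrable {f : S4 → ℝ} (hf : SmoothOnSphere f) :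
    Integrable f sphereMeasure :=
  hf.continuous.integrable_of_hasCompactSupport (HasCompactSupport.of_compactSpace _)

theorem SmoothOnSphere.mul {f g : S4 → ℝ} (hf : SmoothOnSphere f) (hg : SmoothOnSphere g) :
    SmoothOnSphere (fun ξ => f ξ * g ξ) := smoothOnSphere_of_homExt (hf.smoothOff.mul hg.smoothOff)

/-- The bilinear form `∫ f (P₄ g) dw`. -/
noncomputable def paneitzBilin (f g : S4 → ℝ) : ℝ := ∫ ξ, f ξ * paneitz g ξ ∂sphereMeasure

theorem paneitzBilin_eq {f g : S4 → ℝ} (hf : SmoothOnSphere f) (hg : SmoothOnSphere g) :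
    paneitzBilin f g = ∫ ξ, sphereLaplacian f ξ * sphereLaplacian g ξ ∂sphereMeasure
      - 2 * ∫ ξ, f ξ * sphereLaplacian g ξ ∂sphereMeasure := by
  have h1 : ∀ ξ, f ξ * paneitz g ξ = f ξ * sphereLaplacian (sphereLaplacian g) ξ
      - 2 * (f ξ * sphereLaplacian g ξ) := fun ξ => by unfold paneitz; ring
  unfold paneitzBilin
  simp only [h1]
  rw [integral_sub (hf.mul hg.sphereLaplacian.sphereLaplacian).integrable
    ((hf.mul hg.sphereLaplacian).integrable.const_mul 2), integral_const_mul,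
    integral_mul_sphereLaplacian_comm hf hg.sphereLaplacian]
  congr 2
  ext ξ
  ring

theorem paneitzBilin_comm {f g : S4 → ℝ} (hf : SmoothOnSphere f) (hg : SmoothOnSphere g) :
    paneitzBilin f g = paneitzBilin g f := by
  rw [paneitzBilin_eq hf hg, paneitzBilin_eq hg hf, integral_mul_sphereLaplacian_comm hf hg]
  simp only [mul_comm]

theorem paneitzBilin_add_left {f₁ f₂ g : S4 → ℝ} (h₁ : SmoothOnSphere f₁)
    (h₂ : SmoothOnSphere f₂) (hg : SmoothOnSphere g) :
    paneitzBilin (f₁ + f₂) g = paneitzBilin f₁ g + paneitzBilin f₂ g := by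
  unfold paneitzBilin
  rw [← integral_add (h₁.mul hg.paneitz).integrable (h₂.mul hg.paneitz).integrable]
  simp only [Pi.add_apply, add_mul]

theorem paneitzBilin_smul_left (a : ℝ) (f g : S4 → ℝ) :
    paneitzBilin (a • f) g = a * paneitzBilin f g := by
  unfold paneitzBilin
  rw [← integral_const_mul]
  simp only [Pi.smul_apply, smul_eq_mul, mul_assoc]

theorem paneitzBilin_sub_left {f₁ f₂ g : S4 → ℝ} (h₁ : SmoothOnSphere f₁)
    (h₂ : SmoothOnSphere f₂) (hg : SmoothOnSphere g) :
    paneitzBilin (f₁ - f₂) g = paneitzBilin f₁ g - paneitzBilin f₂ g := by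
  have h := paneitzBilin_add_left (h₁.sub h₂) h₂ hg
  rw [sub_add_cancel] at h
  linarith

theorem paneitzBilin_sub_right {f g₁ g₂ : S4 → ℝ} (hf : SmoothOnSphere f)
    (h₁ : SmoothOnSphere g₁) (h₂ : SmoothOnSphere g₂) :
    paneitzBilin f (g₁ - g₂) = paneitzBilin f g₁ - paneitzBilin f g₂ := by
  rw [paneitzBilin_comm hf (h₁.sub h₂), paneitzBilin_sub_left h₁ h₂ hf, paneitzBilin_comm h₁ hf,
    paneitzBilin_comm h₂ hf]

theorem IsBoost.paneitzBilin_comp {c s : ℝ} (h : IsBoost c s) {f : S4 → ℝ}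
    (hf : SmoothOnSphere f) :
    paneitzBilin (fun ξ => f (boostMap c s ξ)) (fun ξ => f (boostMap c s ξ)) =
      paneitzBilin f f := by
  unfold paneitzBilin
  rw [← h.integral_comp (fun ξ => f ξ * paneitz f ξ)]
  refine integral_congr_ae (Eventually.of_forall fun ξ => ?_)
  simp only [h.paneitz_comp hf]
  ring

theorem IsBoost.paneitzBilin_logFactor {c s : ℝ} (h : IsBoost c s) (f : S4 → ℝ) :
    paneitzBilin f (logFactor c s) =
      ∫ ξ, f ξ * (6 * boostTime c s (ξ : E5) ^ (-4 : ℤ) - 6) ∂sphereMeasure := by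
  unfold paneitzBilin
  simp only [h.paneitz_logFactor]

section

/-! ### The Sobolev norm of order two -/

open scoped ENNReal

theorem h2Norm_eq_sum (f : S4 → ℝ) : h2Norm f = ∑ j ∈ Finset.range 3,
    eLpNorm (fun ξ : S4 => iteratedFDeriv ℝ j (homExt f) (ξ : E5)) 2 sphereMeasure := by
  rw [Finset.sum_range_succ, Finset.sum_range_succ, Finset.sum_range_one]
  unfold h2Norm
  congr 2
  · refine eLpNorm_congr_norm_ae (Eventually.of_forall fun ξ => ?_)
    rw [norm_iteratedFDeriv_zero, homExt_coe]
  · refine eLpNorm_congr_norm_ae (Eventually.of_forall fun ξ => ?_)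
    rw [norm_iteratedFDeriv_one]

theorem SmoothOff.continuous_iteratedFDeriv {F : E5 → ℝ} (hF : SmoothOff F) (j : ℕ) :
    Continuous fun ξ : S4 => iteratedFDeriv ℝ j F (ξ : E5) := by
  rw [continuous_iff_continuousAt]
  intro ξ
  have h := (hF.contDiffAt (coe_sphere_ne_zero ξ)).iteratedFDeriv_right (i := j) (m := 0)
    (by simpa using WithTop.coe_le_coe.2 (le_top : (j : ℕ∞) ≤ ⊤))
  exact h.continuousAt.comp continuous_subtype_val.continuousAt

theorem Continuous.memLp_sphere {V : Type*} [NormedAddCommGroup V] {g : S4 → V}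
    (hg : Continuous g) (p : ℝ≥0∞) : MemLp g p sphereMeasure :=
  hg.memLp_of_hasCompactSupport (HasCompactSupport.of_compactSpace _)

theorem SmoothOnSphere.h2Norm_ne_top {f : S4 → ℝ} (hf : SmoothOnSphere f) : h2Norm f ≠ ⊤ := by
  rw [h2Norm_eq_sum]
  exact ENNReal.sum_ne_top.2 fun j _ =>
    ((hf.smoothOff.continuous_iteratedFDeriv j).memLp_sphere 2).eLpNorm_ne_top

theorem SmoothOff.contDiffAt_nat {F : E5 → ℝ} (hF : SmoothOff F) (j : ℕ) {x : E5} (hx : x ≠ 0) :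
    ContDiffAt ℝ j F x :=
  (hF.contDiffAt hx).of_le (WithTop.coe_le_coe.2 (le_top : (j : ℕ∞) ≤ ⊤))

theorem h2Norm_add_le {f g : S4 → ℝ} (hf : SmoothOnSphere f) (hg : SmoothOnSphere g) :
    h2Norm (f + g) ≤ h2Norm f + h2Norm g := by
  simp only [h2Norm_eq_sum, ← Finset.sum_add_distrib]
  refine Finset.sum_le_sum fun j _ => ?_
  have h : (fun ξ : S4 => iteratedFDeriv ℝ j (homExt (f + g)) (ξ : E5)) =
      (fun ξ : S4 => iteratedFDeriv ℝ j (homExt f) (ξ : E5))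
        + fun ξ : S4 => iteratedFDeriv ℝ j (homExt g) (ξ : E5) := by
    ext1 ξ
    exact iteratedFDeriv_add_apply (hf.smoothOff.contDiffAt_nat j (coe_sphere_ne_zero ξ))
      (hg.smoothOff.contDiffAt_nat j (coe_sphere_ne_zero ξ))
  rw [h]
  exact eLpNorm_add_le ((hf.smoothOff.continuous_iteratedFDeriv j).memLp_sphere 2).1
    ((hg.smoothOff.continuous_iteratedFDeriv j).memLp_sphere 2).1 (by norm_num)

theorem h2Norm_neg (f : S4 → ℝ) : h2Norm (-f) = h2Norm f := by
  simp only [h2Norm_eq_sum]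
  refine Finset.sum_congr rfl fun j _ => ?_
  refine eLpNorm_congr_norm_ae (Eventually.of_forall fun ξ => ?_)
  change ‖iteratedFDeriv ℝ j (-homExt f) (ξ : E5)‖ = _
  rw [iteratedFDeriv_neg_apply, norm_neg]

theorem SmoothOnSphere.neg {f : S4 → ℝ} (hf : SmoothOnSphere f) : SmoothOnSphere (-f) := by
  simpa using hf.const_smul (-1)

theorem h2Norm_sub_le {f g : S4 → ℝ} (hf : SmoothOnSphere f) (hg : SmoothOnSphere g) :
    h2Norm (f - g) ≤ h2Norm f + h2Norm g := by
  rw [sub_eq_add_neg, ← h2Norm_neg g]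
  exact h2Norm_add_le hf hg.neg

theorem eLpNorm_le_h2Norm (f : S4 → ℝ) : eLpNorm f 2 sphereMeasure ≤ h2Norm f :=
  le_add_right (le_add_right le_rfl)

theorem eLpNorm_sphereLaplacian_le (f : S4 → ℝ) :
    eLpNorm (sphereLaplacian f) 2 sphereMeasure ≤ 5 * h2Norm f := by
  have h : ∀ ξ, ‖sphereLaplacian f ξ‖ ≤ 5 * ‖iteratedFDeriv ℝ 2 (homExt f) (ξ : E5)‖ := by
    intro ξ
    unfold sphereLaplacian
    rw [InnerProductSpace.laplacian_eq_iteratedFDeriv_orthonormalBasis _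
      (EuclideanSpace.basisFun (Fin 5) ℝ)]
    refine (norm_sum_le _ _).trans ?_
    have : ∀ i ∈ (Finset.univ : Finset (Fin 5)), ‖iteratedFDeriv ℝ 2 (homExt f) (ξ : E5)
        ![EuclideanSpace.basisFun (Fin 5) ℝ i, EuclideanSpace.basisFun (Fin 5) ℝ i]‖ ≤
        ‖iteratedFDeriv ℝ 2 (homExt f) (ξ : E5)‖ := by
      intro i _
      refine (ContinuousMultilinearMap.le_opNorm _ _).trans ?_
      simp
    refine (Finset.sum_le_sum this).trans ?_
    simp
  have h2 := eLpNorm_le_mul_eLpNorm_of_ae_le_mul (μ := sphereMeasure)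
    (Eventually.of_forall h) 2
  refine h2.trans ?_
  have h5 : ENNReal.ofReal 5 = 5 := by norm_num
  rw [h5]
  gcongr
  exact le_add_left le_rfl

/-! ### Boundedness of the Paneitz form in the H² norm -/

theorem enorm_integral_mul_le {a b : S4 → ℝ} (ha : Continuous a) (hb : Continuous b) :
    ‖∫ ξ, a ξ * b ξ ∂sphereMeasure‖ₑ ≤ eLpNorm a 2 sphereMeasure * eLpNorm b 2 sphereMeasure := by
  refine (enorm_integral_le_lintegral_enorm _).trans ?_
  rw [← eLpNorm_one_eq_lintegral_enorm]
  exact eLpNorm_smul_le_mul_eLpNorm (p := 2) (q := 2) (r := 1) (φ := a) (f := b)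
    (hb.memLp_sphere 2).1 (ha.memLp_sphere 2).1

theorem enorm_paneitzBilin_le_of_L2 {f g : S4 → ℝ} (hf : SmoothOnSphere f)
    (hg : SmoothOnSphere g) : ‖paneitzBilin f g‖ₑ ≤
      eLpNorm f 2 sphereMeasure * eLpNorm (paneitz g) 2 sphereMeasure :=
  enorm_integral_mul_le hf.continuous hg.paneitz.continuous

/-- Symmetry of Δ leaves at most two derivatives on each factor. The Laplacian is a trace of five
second derivatives, so 35 = 5·5 + 2·5. -/
theorem enorm_paneitzBilin_le {f g : S4 → ℝ} (hf : SmoothOnSphere f)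
    (hg : SmoothOnSphere g) : ‖paneitzBilin f g‖ₑ ≤ 35 * h2Norm f * h2Norm g := by
  rw [paneitzBilin_eq hf hg]
  refine enorm_sub_le.trans ?_
  rw [enorm_mul]
  have h2 : ‖(2 : ℝ)‖ₑ = 2 := by simp [enorm_eq_nnnorm]
  have h3 := enorm_integral_mul_le hf.sphereLaplacian.continuous hg.sphereLaplacian.continuous
  have h4 := enorm_integral_mul_le hf.continuous hg.sphereLaplacian.continuous
  calc _ ≤ 5 * h2Norm f * (5 * h2Norm g) + 2 * (h2Norm f * (5 * h2Norm g)) := by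
        rw [h2]
        gcongr
        · exact h3.trans (mul_le_mul' (eLpNorm_sphereLaplacian_le f)
            (eLpNorm_sphereLaplacian_le g))
        · exact h4.trans (mul_le_mul' (eLpNorm_le_h2Norm f) (eLpNorm_sphereLaplacian_le g))
    _ = 35 * h2Norm f * h2Norm g := by ring

/-! ### Cauchy sequences and the extension of the quadratic form -/

/-- A sequence of smooth functions that is Cauchy for the `H²` norm. -/
structure IsH2Cauchy (φ : ℕ → S4 → ℝ) : Prop where
  smooth : ∀ n, SmoothOnSphere (φ n)
  cauchy : Tendsto (fun p : ℕ × ℕ => h2Norm (φ p.1 - φ p.2)) atTop (𝓝 0)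

theorem IsH2Approx.isH2Cauchy {u : S4 → ℝ} {φ : ℕ → S4 → ℝ} (h : IsH2Approx u φ) :
    IsH2Cauchy φ := ⟨h.smooth, h.cauchy⟩

theorem IsH2Cauchy.exists_forall_le {φ : ℕ → S4 → ℝ} (h : IsH2Cauchy φ) {ε : ℝ≥0∞} (hε : ε ≠ 0) :
    ∃ N, ∀ n m, N ≤ n → N ≤ m → h2Norm (φ n - φ m) ≤ ε := by
  obtain ⟨⟨a, b⟩, hab⟩ := eventually_atTop.1
    (ENNReal.tendsto_nhds_zero.1 h.cauchy ε (pos_iff_ne_zero.2 hε))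
  exact ⟨max a b, fun n m hn hm =>
    hab (n, m) ⟨(le_max_left a b).trans hn, (le_max_right a b).trans hm⟩⟩

theorem IsH2Cauchy.exists_bound {φ : ℕ → S4 → ℝ} (h : IsH2Cauchy φ) :
    ∃ M : ℝ≥0∞, M ≠ ⊤ ∧ ∃ N, ∀ n, N ≤ n → h2Norm (φ n) ≤ M := by
  obtain ⟨N, hN⟩ := h.exists_forall_le one_ne_zero
  refine ⟨1 + h2Norm (φ N), ENNReal.add_ne_top.2 ⟨ENNReal.one_ne_top, (h.smooth N).h2Norm_ne_top⟩,
    N, fun n hn => ?_⟩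
  have h1 := h2Norm_add_le ((h.smooth n).sub (h.smooth N)) (h.smooth N)
  rw [sub_add_cancel] at h1
  exact h1.trans (add_le_add_left (hN n N hn le_rfl) _)

theorem tendsto_prod_of_le {a b : ℕ × ℕ → ℝ≥0∞} {c : ℕ × ℕ → ℝ≥0∞}
    (ha : Tendsto a atTop (𝓝 0)) (hb : Tendsto b atTop (𝓝 0)) (h : ∀ p, c p ≤ a p + b p) :
    Tendsto c atTop (𝓝 0) := by
  have := ha.add hb
  rw [add_zero] at this
  exact tendsto_of_tendsto_of_tendsto_of_le_of_le tendsto_const_nhds this (fun _ => zero_le) h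

theorem IsH2Cauchy.sub {φ ψ : ℕ → S4 → ℝ} (h : IsH2Cauchy φ) (h' : IsH2Cauchy ψ) :
    IsH2Cauchy fun n => φ n - ψ n := by
  refine ⟨fun n => (h.smooth n).sub (h'.smooth n),
    tendsto_prod_of_le h.cauchy h'.cauchy fun p => ?_⟩
  rw [sub_sub_sub_comm]
  exact h2Norm_sub_le ((h.smooth _).sub (h.smooth _)) ((h'.smooth _).sub (h'.smooth _))

/-- Closability of the form: smallness of g in L² alone suffices, because s can be frozen at a late
index b, where all derivatives go onto the smooth function s_b; the remainder is controlled by the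
H² bound on g and the Cauchy property of s. -/
theorem tendsto_paneitzBilin_zero {g s : ℕ → S4 → ℝ} (hg : IsH2Cauchy g) (hs : IsH2Cauchy s)
    (h0 : Tendsto (fun n => eLpNorm (g n) 2 sphereMeasure) atTop (𝓝 0)) :
    Tendsto (fun n => paneitzBilin (g n) (s n)) atTop (𝓝 0) := by
  rw [tendsto_zero_iff_enorm_tendsto_zero, ENNReal.tendsto_nhds_zero]
  intro ε hε
  obtain ⟨M, hM, N₀, hN₀⟩ := hg.exists_bound
  have hlim : Tendsto (fun p : ℕ × ℕ => 35 * M * h2Norm (s p.1 - s p.2)) atTop (𝓝 0) := by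
    have := ENNReal.Tendsto.const_mul hs.cauchy
      (Or.inr (ENNReal.mul_ne_top (by norm_num : (35 : ℝ≥0∞) ≠ ⊤) hM))
    simpa using this
  have hε2 : 0 < ε / 2 := ENNReal.half_pos hε.ne'
  obtain ⟨⟨a, b⟩, hab⟩ := eventually_atTop.1 (ENNReal.tendsto_nhds_zero.1 hlim (ε / 2) hε2)
  have hb : Tendsto (fun n => eLpNorm (g n) 2 sphereMeasure
      * eLpNorm (paneitz (s b)) 2 sphereMeasure) atTop (𝓝 0) := by
    have := ENNReal.Tendsto.mul_const h0
      (Or.inr ((hs.smooth b).paneitz.continuous.memLp_sphere 2).eLpNorm_ne_top)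
    simpa using this
  filter_upwards [ENNReal.tendsto_nhds_zero.1 hb (ε / 2) hε2, eventually_ge_atTop a,
    eventually_ge_atTop N₀] with n h1 h2 h3
  have e : paneitzBilin (g n) (s n) =
      paneitzBilin (g n) (s b) + paneitzBilin (g n) (s n - s b) := by
    rw [paneitzBilin_sub_right (hg.smooth n) (hs.smooth n) (hs.smooth b)]
    ring
  rw [e, ← ENNReal.add_halves ε]
  refine (enorm_add_le _ _).trans (add_le_add ?_ ?_)
  · exact (enorm_paneitzBilin_le_of_L2 (hg.smooth n) (hs.smooth b)).trans h1
  · refine (enorm_paneitzBilin_le (hg.smooth n) ((hs.smooth n).sub (hs.smooth b))).trans ?_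
    refine le_trans ?_ (hab (n, b) ⟨h2, le_rfl⟩)
    gcongr
    exact hN₀ n h3

/-- By symmetry B(f, f) − B(g, g) = B(f − g, f) + B(f − g, g), which is small when f − g is small
and f, g are bounded in H². -/
theorem IsH2Cauchy.exists_tendsto {φ : ℕ → S4 → ℝ} (h : IsH2Cauchy φ) :
    ∃ Q : ℝ, Tendsto (fun n => paneitzBilin (φ n) (φ n)) atTop (𝓝 Q) := by
  obtain ⟨M, hM, N₀, hN₀⟩ := h.exists_bound
  have hlim : Tendsto (fun p : ℕ × ℕ => 70 * M * h2Norm (φ p.1 - φ p.2)) atTop (𝓝 0) := by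
    have := ENNReal.Tendsto.const_mul h.cauchy
      (Or.inr (ENNReal.mul_ne_top (by norm_num : (70 : ℝ≥0∞) ≠ ⊤) hM))
    simpa using this
  refine cauchySeq_tendsto_of_complete (EMetric.cauchySeq_iff.2 fun ε hε => ?_)
  obtain ⟨δ, hδ, hδε⟩ := exists_between hε
  obtain ⟨⟨a, b⟩, hab⟩ := eventually_atTop.1 (ENNReal.tendsto_nhds_zero.1 hlim δ hδ)
  refine ⟨max N₀ (max a b), fun m hm n hn => lt_of_le_of_lt ?_ hδε⟩
  have sm := h.smooth m
  have sn := h.smooth n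
  have e : paneitzBilin (φ m) (φ m) - paneitzBilin (φ n) (φ n) =
      paneitzBilin (φ m - φ n) (φ m) + paneitzBilin (φ m - φ n) (φ n) := by
    rw [paneitzBilin_sub_left sm sn sm, paneitzBilin_sub_left sm sn sn, paneitzBilin_comm sn sm]
    ring
  rw [edist_eq_enorm_sub, e]
  refine le_trans ?_ (hab (m, n) ⟨le_trans (by simp) hm, le_trans (by simp) hn⟩)
  refine (enorm_add_le _ _).trans ?_
  have h1 := enorm_paneitzBilin_le (sm.sub sn) sm
  have h2 := enorm_paneitzBilin_le (sm.sub sn) sn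
  have h3 : h2Norm (φ m) ≤ M := hN₀ m (le_trans (le_max_left _ _) hm)
  have h4 : h2Norm (φ n) ≤ M := hN₀ n (le_trans (le_max_left _ _) hn)
  calc _ ≤ 35 * h2Norm (φ m - φ n) * M + 35 * h2Norm (φ m - φ n) * M := by
        refine add_le_add (h1.trans ?_) (h2.trans ?_)
        · gcongr
        · gcongr
    _ = 70 * M * h2Norm (φ m - φ n) := by ring

/-- Two approximations of u differ by an H²-Cauchy sequence tending to 0 in L², so closability gives
them the same limit. Hence the default value in `paneitzForm` does not occur once an approximation
exists. -/
theorem IsH2Approx.tendsto_paneitzForm {u : S4 → ℝ} (hu : AEStronglyMeasurable u sphereMeasure)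
    {φ : ℕ → S4 → ℝ} (h : IsH2Approx u φ) :
    Tendsto (fun n => paneitzBilin (φ n) (φ n)) atTop (𝓝 (paneitzForm u)) := by
  obtain ⟨Q, hQ⟩ := h.isH2Cauchy.exists_tendsto
  have hex : ∃ Q : ℝ, ∀ ψ, IsH2Approx u ψ →
      Tendsto (fun n => ∫ ξ, ψ n ξ * paneitz (ψ n) ξ ∂sphereMeasure) atTop (𝓝 Q) := by
    refine ⟨Q, fun ψ hψ => ?_⟩
    have hd : IsH2Cauchy fun n => ψ n - φ n := hψ.isH2Cauchy.sub h.isH2Cauchy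
    have h0 : Tendsto (fun n => eLpNorm (ψ n - φ n) 2 sphereMeasure) atTop (𝓝 0) := by
      have h1 := hψ.tendsto.add h.tendsto
      rw [add_zero] at h1
      refine tendsto_of_tendsto_of_tendsto_of_le_of_le tendsto_const_nhds h1
        (fun _ => zero_le) fun n => ?_
      have e : ψ n - φ n = (ψ n - u) - (φ n - u) := by abel
      rw [e]
      exact eLpNorm_sub_le ((hψ.smooth n).continuous.aestronglyMeasurable.sub hu)
        ((h.smooth n).continuous.aestronglyMeasurable.sub hu) (by norm_num)
    have h2 := (tendsto_paneitzBilin_zero hd hψ.isH2Cauchy h0).add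
      (tendsto_paneitzBilin_zero hd h.isH2Cauchy h0)
    have h3 := h2.add hQ
    simp only [add_zero, zero_add] at h3
    refine h3.congr fun n => ?_
    have sm := hψ.smooth n
    have sn := h.smooth n
    change _ = paneitzBilin (ψ n) (ψ n)
    rw [paneitzBilin_sub_left sm sn sm, paneitzBilin_sub_left sm sn sn, paneitzBilin_comm sn sm]
    ring
  unfold paneitzForm
  rw [dif_pos hex]
  exact hex.choose_spec φ h

/-! ### Composition with smooth maps -/

/-- Faà di Bruno's formula up to order two, with a constant independent of F. It serves both for the
conformal maps and for the charts. -/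
theorem exists_iteratedFDeriv_comp_bound {V : Type*} [NormedAddCommGroup V] [NormedSpace ℝ V]
    {Θ : V → E5} {Ω K : Set V} (hΩ : IsOpen Ω) (hΘ : ContDiffOn ℝ ∞ Θ Ω)
    (hne : ∀ y ∈ Ω, Θ y ≠ 0) (hK : IsCompact K) (hKΩ : K ⊆ Ω) :
    ∃ C : ℝ, 0 ≤ C ∧ ∀ F : E5 → ℝ, SmoothOff F → ∀ y ∈ K, ∀ j ≤ 2,
      ‖iteratedFDeriv ℝ j (fun z => F (Θ z)) y‖ ≤
        C * ∑ i ∈ Finset.range 3, ‖iteratedFDeriv ℝ i F (Θ y)‖ := by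
  have hcont : ∀ i : ℕ, ContinuousOn (iteratedFDerivWithin ℝ i Θ Ω) K := fun i =>
    (hΘ.continuousOn_iteratedFDerivWithin (WithTop.coe_le_coe.2 (le_top : (i : ℕ∞) ≤ ⊤))
      hΩ.uniqueDiffOn).mono hKΩ
  obtain ⟨D₁, hD₁⟩ := hK.exists_bound_of_continuousOn (hcont 1)
  obtain ⟨D₂, hD₂⟩ := hK.exists_bound_of_continuousOn (hcont 2)
  -- The bound 1 ≤ D gives D ≤ D^i for i ≥ 1 and D^j ≤ D² for j ≤ 2.
  set D : ℝ := max 1 (max D₁ D₂) with hD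
  have hD1 : 1 ≤ D := le_max_left _ _
  refine ⟨2 * D ^ 2, by positivity, fun F hF y hy j hj => ?_⟩
  set S := ∑ i ∈ Finset.range 3, ‖iteratedFDeriv ℝ i F (Θ y)‖ with hS
  have hS0 : 0 ≤ S := Finset.sum_nonneg fun i _ => norm_nonneg _
  have h1 := norm_iteratedFDerivWithin_comp_le (n := j) (C := S) (D := D) (x := y) hF hΘ
    (WithTop.coe_le_coe.2 (le_top : (j : ℕ∞) ≤ ⊤)) isOpen_ne_zero.uniqueDiffOn hΩ.uniqueDiffOn
    (fun z hz => hne z hz) (hKΩ hy) (fun i hi => by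
      rw [iteratedFDerivWithin_of_isOpen i isOpen_ne_zero (hne y (hKΩ hy))]
      exact Finset.single_le_sum (f := fun i => ‖iteratedFDeriv ℝ i F (Θ y)‖)
        (fun i _ => norm_nonneg _) (Finset.mem_range.2 (by omega))) (fun i hi1 hi2 => by
      have hle : ‖iteratedFDerivWithin ℝ i Θ Ω y‖ ≤ D := by
        have : i = 1 ∨ i = 2 := by omega
        rcases this with rfl | rfl
        · exact (hD₁ y hy).trans ((le_max_left _ _).trans (le_max_right _ _))
        · exact (hD₂ y hy).trans ((le_max_right _ _).trans (le_max_right _ _))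
      exact hle.trans (le_self_pow₀ hD1 (by omega)))
  rw [iteratedFDerivWithin_of_isOpen j hΩ (hKΩ hy)] at h1
  refine h1.trans ?_
  have h2 : ((j.factorial : ℕ) : ℝ) ≤ 2 := by
    have : j.factorial ≤ 2 := (Nat.factorial_le hj).trans (by norm_num [Nat.factorial])
    exact_mod_cast this
  have h3 : D ^ j ≤ D ^ 2 := pow_le_pow_right₀ hD1 hj
  calc (j.factorial : ℝ) * S * D ^ j ≤ 2 * S * D ^ 2 := by gcongr
    _ = 2 * D ^ 2 * S := by ring

/-- The pointwise size of the two-jet of the homogeneous extension. -/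
noncomputable def jetNorm (f : S4 → ℝ) (ξ : S4) : ℝ :=
  ∑ i ∈ Finset.range 3, ‖iteratedFDeriv ℝ i (homExt f) (ξ : E5)‖

theorem jetNorm_nonneg (f : S4 → ℝ) (ξ : S4) : 0 ≤ jetNorm f ξ :=
  Finset.sum_nonneg fun _ _ => norm_nonneg _

theorem SmoothOnSphere.continuous_jetNorm {f : S4 → ℝ} (hf : SmoothOnSphere f) :
    Continuous (jetNorm f) :=
  continuous_finsetSum _ fun i _ => (hf.smoothOff.continuous_iteratedFDeriv i).norm

theorem eLpNorm_jetNorm_le {f : S4 → ℝ} (hf : SmoothOnSphere f) :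
    eLpNorm (jetNorm f) 2 sphereMeasure ≤ h2Norm f := by
  rw [h2Norm_eq_sum]
  have e : jetNorm f = ∑ i ∈ Finset.range 3,
      fun ξ : S4 => ‖iteratedFDeriv ℝ i (homExt f) (ξ : E5)‖ := by
    ext ξ
    simp [jetNorm]
  rw [e]
  refine (eLpNorm_sum_le (fun i _ =>
    (hf.smoothOff.continuous_iteratedFDeriv i).norm.aestronglyMeasurable) (by norm_num)).trans ?_
  exact Finset.sum_le_sum fun i _ => (eLpNorm_norm _).le

/-- The two-jet of the composition is pointwise dominated by the two-jet of f at the image point,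
and composition is bounded on L². The factor 3 counts the orders 0, 1, 2. -/
theorem IsBoost.exists_h2Norm_comp_le {c s : ℝ} (h : IsBoost c s) :
    ∃ C : ℝ≥0∞, C ≠ ⊤ ∧ ∀ f : S4 → ℝ, SmoothOnSphere f →
      h2Norm (fun ξ => f (boostMap c s ξ)) ≤ C * h2Norm f := by
  have hsm : ContDiffOn ℝ ∞ (fun x : E5 => (boostMap c s (radialProj x) : E5)) {0}ᶜ := by
    intro x hx
    have h1 := (contDiffAt_coe_radialProj (h.boost_ne_zero hx)).comp x (contDiffAt_boost c s hx)
    refine (h1.congr_of_eventuallyEq ?_).contDiffWithinAt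
    filter_upwards [compl_zero_mem_nhds hx] with y hy
    rw [h.boostMap_radialProj hy]
    rfl
  obtain ⟨C, hC0, hC⟩ := exists_iteratedFDeriv_comp_bound isOpen_ne_zero hsm
    (fun y _ => coe_sphere_ne_zero _) (isCompact_sphere (0 : E5) 1)
    (fun y hy => coe_sphere_ne_zero ⟨y, hy⟩)
  obtain ⟨C', hC', hC'2⟩ := h.exists_eLpNorm_comp_le
  refine ⟨3 * (ENNReal.ofReal C * C'), ENNReal.mul_ne_top (by norm_num)
    (ENNReal.mul_ne_top ENNReal.ofReal_ne_top hC'), fun f hf => ?_⟩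
  have e : homExt (fun ξ => f (boostMap c s ξ)) =
      fun x => homExt f (boostMap c s (radialProj x) : E5) := by
    ext x
    rw [homExt_coe]
    rfl
  rw [h2Norm_eq_sum]
  have hj : ∀ j ∈ Finset.range 3, eLpNorm (fun ξ : S4 => iteratedFDeriv ℝ j
      (homExt fun ξ => f (boostMap c s ξ)) (ξ : E5)) 2 sphereMeasure ≤
        ENNReal.ofReal C * C' * h2Norm f := by
    intro j hj
    have hj2 : j ≤ 2 := by
      have := Finset.mem_range.1 hj
      omega
    have hb : ∀ ξ : S4, ‖iteratedFDeriv ℝ j (homExt fun ξ => f (boostMap c s ξ)) (ξ : E5)‖ ≤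
        C * ‖jetNorm f (boostMap c s ξ)‖ := by
      intro ξ
      have := hC (homExt f) hf.smoothOff ξ ξ.2 j hj2
      rw [radialProj_coe_sphere] at this
      rw [e, Real.norm_of_nonneg (jetNorm_nonneg _ _)]
      exact this
    refine (eLpNorm_le_mul_eLpNorm_of_ae_le_mul (Eventually.of_forall hb) 2).trans ?_
    rw [mul_assoc]
    gcongr
    refine (hC'2 (jetNorm f)).trans ?_
    gcongr
    exact eLpNorm_jetNorm_le hf
  refine (Finset.sum_le_sum hj).trans ?_
  rw [Finset.sum_const, Finset.card_range, nsmul_eq_mul]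
  push_cast
  ring_nf
  exact le_rfl

end

section

/-! ### Exponential integrability in dimension four -/

open scoped ENNReal NNReal

theorem fderiv_pow_succ {V : Type*} [NormedAddCommGroup V] [NormedSpace ℝ V] {ψ : V → ℝ}
    (hψ : ContDiff ℝ ∞ ψ) (k : ℕ) (y : V) :
    fderiv ℝ (fun z => ψ z ^ (k + 1)) y = ((k + 1 : ℕ) : ℝ) • (ψ y ^ k • fderiv ℝ ψ y) := by
  have h := ((hψ.differentiable (by simp)) y).hasFDerivAt.pow (k + 1)
  rw [h.fderiv]
  simp [smul_smul]

section Euclidean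

variable {V : Type*} [NormedAddCommGroup V] [NormedSpace ℝ V] [FiniteDimensional ℝ V]
  [MeasurableSpace V] [BorelSpace V]

/-- The embedding W^{1,1} ⊂ L^{4/3} in dimension four, applied to ψ^{k+1}, followed by Hölder with
3/4 + 1/4 = 1. The indicator matters for k = 0, where ψ⁰ = 1 lacks compact support. -/
theorem eLpNorm_pow_succ_le (μ : Measure V) [μ.IsAddHaarMeasure]
    (h4 : Module.finrank ℝ V = 4) {K : Set V} (hK : IsCompact K) {ψ : V → ℝ}
    (hψ : ContDiff ℝ ∞ ψ) (hs : tsupport ψ ⊆ K) (k : ℕ) :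
    eLpNorm (K.indicator fun y => ψ y ^ (k + 1)) (4 / 3 : ℝ≥0) μ ≤
      eLpNormLESNormFDerivOneConst μ (4 / 3 : ℝ≥0) * eLpNorm (fderiv ℝ ψ) 4 μ * (k + 1 : ℕ)
        * eLpNorm (K.indicator fun y => ψ y ^ k) (4 / 3 : ℝ≥0) μ := by
  have hcs : HasCompactSupport ψ := hK.of_isClosed_subset (isClosed_tsupport ψ) hs
  have hzero : ∀ y, y ∉ K → ψ y = 0 := fun y hy => image_eq_zero_of_notMem_tsupport fun h => hy (hs h)
  have hzero' : ∀ y, y ∉ K → fderiv ℝ ψ y = 0 := fun y hy =>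
    Function.notMem_support.1 fun h => hy (hs (support_fderiv_subset ℝ h))
  have e1 : (K.indicator fun y => ψ y ^ (k + 1)) = fun y => ψ y ^ (k + 1) := by
    ext y
    by_cases hy : y ∈ K
    · rw [Set.indicator_of_mem hy]
    · rw [Set.indicator_of_notMem hy, hzero y hy, zero_pow (Nat.succ_ne_zero k)]
  have e2 : fderiv ℝ (fun y => ψ y ^ (k + 1)) =
      ((k + 1 : ℕ) : ℝ) • ((K.indicator fun y => ψ y ^ k) • fderiv ℝ ψ) := by
    ext1 y
    rw [fderiv_pow_succ hψ]
    by_cases hy : y ∈ K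
    · simp [Set.indicator_of_mem hy]
    · simp [hzero' y hy]
  have hconj : NNReal.HolderConjugate (Module.finrank ℝ V : ℝ≥0) (4 / 3) := by
    rw [h4]
    rw [NNReal.holderConjugate_iff]
    constructor
    · norm_num
    · rw [← NNReal.coe_inj]
      push_cast
      norm_num
  have h1 := eLpNorm_le_eLpNorm_fderiv_one μ (u := fun y => ψ y ^ (k + 1))
    ((hψ.pow (k + 1)).of_le (by simp)) (hcs.comp_left (g := fun r : ℝ => r ^ (k + 1)) (by simp))
    hconj
  have hm1 : AEStronglyMeasurable (fderiv ℝ ψ) μ :=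
    (hψ.continuous_fderiv (by simp)).aestronglyMeasurable
  have hm2 : AEStronglyMeasurable (K.indicator fun y => ψ y ^ k) μ :=
    ((hψ.continuous.pow k).aestronglyMeasurable).indicator hK.measurableSet
  have htri : ENNReal.HolderTriple ((4 / 3 : ℝ≥0) : ℝ≥0∞) 4 1 := by
    constructor
    have : ((4 / 3 : ℝ≥0) : ℝ≥0∞)⁻¹ = ((3 / 4 : ℝ≥0) : ℝ≥0∞) := by
      rw [← ENNReal.coe_inv (by norm_num)]
      norm_num
    have h' : (4 : ℝ≥0∞)⁻¹ = ((1 / 4 : ℝ≥0) : ℝ≥0∞) := by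
      rw [one_div, ENNReal.coe_inv (by norm_num)]
      norm_num
    rw [this, h', ← ENNReal.coe_add, inv_one]
    norm_cast
    rw [← NNReal.coe_inj]
    push_cast
    norm_num
  have h2 := eLpNorm_smul_le_mul_eLpNorm hm1 hm2 (hpqr := htri)
  rw [e1]
  refine h1.trans ?_
  rw [e2]
  have h5 := eLpNorm_const_smul_le (c := ((k + 1 : ℕ) : ℝ)) (p := 1) (μ := μ)
    (f := (K.indicator fun y => ψ y ^ k) • fderiv ℝ ψ)
  have h3 : ‖((k + 1 : ℕ) : ℝ)‖ₑ = (k + 1 : ℕ) := by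
    rw [enorm_eq_nnnorm, Real.nnnorm_natCast]
    simp
  rw [h3] at h5
  calc _ ≤ (eLpNormLESNormFDerivOneConst μ (4 / 3 : ℝ≥0) : ℝ≥0∞) * ((k + 1 : ℕ) *
        (eLpNorm (K.indicator fun y => ψ y ^ k) (4 / 3 : ℝ≥0) μ * eLpNorm (fderiv ℝ ψ) 4 μ)) := by
        refine mul_le_mul_right (h5.trans ?_) _
        exact mul_le_mul_right h2 _
    _ = _ := by ring

theorem eLpNorm_pow_le (μ : Measure V) [μ.IsAddHaarMeasure]
    (h4 : Module.finrank ℝ V = 4) {K : Set V} (hK : IsCompact K) {ψ : V → ℝ}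
    (hψ : ContDiff ℝ ∞ ψ) (hs : tsupport ψ ⊆ K) (k : ℕ) :
    eLpNorm (K.indicator fun y => ψ y ^ k) (4 / 3 : ℝ≥0) μ ≤
      (k.factorial : ℝ≥0∞) * (eLpNormLESNormFDerivOneConst μ (4 / 3 : ℝ≥0)
        * eLpNorm (fderiv ℝ ψ) 4 μ) ^ k
        * eLpNorm (K.indicator fun _ => (1 : ℝ)) (4 / 3 : ℝ≥0) μ := by
  induction k with
  | zero => simp
  | succ k ih =>
    refine (eLpNorm_pow_succ_le μ h4 hK hψ hs k).trans ?_
    refine (mul_le_mul_right ih _).trans (le_of_eq ?_)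
    rw [Nat.factorial_succ, pow_succ]
    push_cast
    ring

theorem ofReal_exp_abs_eq_tsum (a : ℝ) : ENNReal.ofReal (Real.exp (4 * |a|)) =
    ∑' k : ℕ, (4 : ℝ≥0∞) ^ k * (k.factorial : ℝ≥0∞)⁻¹ * ‖a ^ k‖ₑ := by
  rw [Real.exp_eq_exp_ℝ, NormedSpace.exp_eq_tsum_div, ENNReal.ofReal_tsum_of_nonneg
    (fun n => by positivity) (Real.summable_pow_div_factorial _)]
  congr 1
  ext k
  rw [mul_pow, ENNReal.ofReal_div_of_pos (by positivity), ENNReal.ofReal_mul (by positivity),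
    ENNReal.ofReal_pow (by norm_num), ENNReal.ofReal_natCast, ← abs_pow,
    ← Real.norm_eq_abs, ofReal_norm]
  simp only [ENNReal.ofReal_ofNat]
  rw [div_eq_mul_inv]
  ring

/-- Sobolev embedding W^{1,2} ⊂ L⁴ in dimension four (1/4 = 1/2 − 1/4), applied to the derivative.
-/
theorem eLpNorm_fderiv_le_iteratedFDeriv (μ : Measure V) [μ.IsAddHaarMeasure]
    (h4 : Module.finrank ℝ V = 4) {ψ : V → ℝ} (hψ : ContDiff ℝ ∞ ψ) (hcs : HasCompactSupport ψ) :
    eLpNorm (fderiv ℝ ψ) 4 μ ≤ SNormLESNormFDerivOfEqConst (V →L[ℝ] ℝ) μ (2 : ℝ≥0)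
      * eLpNorm (iteratedFDeriv ℝ 2 ψ) 2 μ := by
  have hsm : ContDiff ℝ 1 (fderiv ℝ ψ) := (hψ.fderiv_right (m := ∞) (by simp)).of_le (by simp)
  have hexp : (((4 : ℝ≥0) : ℝ))⁻¹ = ((2 : ℝ≥0)⁻¹ : ℝ≥0) - (Module.finrank ℝ V : ℝ)⁻¹ := by
    rw [h4]
    push_cast
    norm_num
  have h1 := eLpNorm_le_eLpNorm_fderiv_of_eq μ hsm (hcs.fderiv ℝ) (p := 2) (p' := 4)
    one_le_two (by rw [h4]; norm_num) hexp
  have hn : ∀ y, ‖fderiv ℝ (fderiv ℝ ψ) y‖ ≤ ‖iteratedFDeriv ℝ 2 ψ y‖ := fun y => by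
    rw [← norm_iteratedFDeriv_one, norm_iteratedFDeriv_fderiv]
  have h2 := eLpNorm_mono (f := fderiv ℝ (fderiv ℝ ψ)) (g := iteratedFDeriv ℝ 2 ψ)
    (p := (2 : ℝ≥0)) (μ := μ) hn
  exact h1.trans (mul_le_mul_right h2 _)

/-- A local Adams-type inequality: smooth functions supported in a fixed compact subset of a
four-dimensional space and with small second derivatives in `L²` are uniformly exponentially
integrable. -/
theorem exists_lintegral_exp_le (μ : Measure V) [μ.IsAddHaarMeasure]
    (h4 : Module.finrank ℝ V = 4) {K : Set V} (hK : IsCompact K) :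
    ∃ ε C : ℝ≥0∞, ε ≠ 0 ∧ C ≠ ⊤ ∧ ∀ ψ : V → ℝ, ContDiff ℝ ∞ ψ → tsupport ψ ⊆ K →
      eLpNorm (iteratedFDeriv ℝ 2 ψ) 2 μ ≤ ε →
      ∫⁻ y in K, ENNReal.ofReal (Real.exp (4 * |ψ y|)) ∂μ ≤ C := by
  set C₁ : ℝ≥0 := SNormLESNormFDerivOfEqConst (V →L[ℝ] ℝ) μ (2 : ℝ≥0) with hC₁
  set C₂ : ℝ≥0 := eLpNormLESNormFDerivOneConst μ (4 / 3 : ℝ≥0) with hC₂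
  set A := eLpNorm (K.indicator fun _ => (1 : ℝ)) (4 / 3 : ℝ≥0) μ *
    (μ.restrict K) Set.univ ^ (1 / (1 : ℝ≥0∞).toReal - 1 / ((4 / 3 : ℝ≥0) : ℝ≥0∞).toReal) with hA
  have hAtop : A ≠ ⊤ := by
    refine ENNReal.mul_ne_top ?_ (ENNReal.rpow_ne_top_of_nonneg (by norm_num) ?_)
    · exact (memLp_indicator_const _ hK.measurableSet _ (Or.inr hK.measure_lt_top.ne)).eLpNorm_ne_top
    · simpa using hK.measure_lt_top.ne
  -- This ε makes 4 C₂ ‖∇ψ‖₄ ≤ 1/2. The k! of `eLpNorm_pow_le` cancels that of the exponential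
  -- series, which is then dominated by A Σ 2⁻ᵏ = 2A.
  refine ⟨(8 * ((C₁ * C₂ : ℝ≥0) + 1 : ℝ≥0∞))⁻¹, 2 * A, ?_, ENNReal.mul_ne_top (by norm_num) hAtop,
    fun ψ hψ hs hε => ?_⟩
  · refine ENNReal.inv_ne_zero.2 (ENNReal.mul_ne_top (by norm_num) ?_)
    exact ENNReal.add_ne_top.2 ⟨ENNReal.coe_ne_top, ENNReal.one_ne_top⟩
  have hcs : HasCompactSupport ψ := hK.of_isClosed_subset (isClosed_tsupport ψ) hs
  have hG : eLpNorm (fderiv ℝ ψ) 4 μ ≤ C₁ * eLpNorm (iteratedFDeriv ℝ 2 ψ) 2 μ :=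
    eLpNorm_fderiv_le_iteratedFDeriv μ h4 hψ hcs
  set r : ℝ≥0∞ := 4 * (C₂ * eLpNorm (fderiv ℝ ψ) 4 μ) with hr
  have hr2 : r ≤ 2⁻¹ := by
    have h1 : r * 2 ≤ 1 := by
      calc r * 2 ≤ 4 * (C₂ * (C₁ * (8 * ((C₁ * C₂ : ℝ≥0) + 1 : ℝ≥0∞))⁻¹)) * 2 := by
            rw [hr]
            gcongr
            exact hG.trans (by gcongr)
        _ = 8 * ((C₁ * C₂ : ℝ≥0) : ℝ≥0∞) * (8 * ((C₁ * C₂ : ℝ≥0) + 1 : ℝ≥0∞))⁻¹ := by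
            push_cast
            ring
        _ ≤ (8 * ((C₁ * C₂ : ℝ≥0) + 1 : ℝ≥0∞)) * (8 * ((C₁ * C₂ : ℝ≥0) + 1 : ℝ≥0∞))⁻¹ := by
            gcongr
            exact le_self_add
        _ ≤ 1 := ENNReal.mul_inv_le_one _
    rw [← one_div]
    exact (ENNReal.le_div_iff_mul_le (by simp) (by simp)).2 h1
  have hterm : ∀ k : ℕ, ∫⁻ y in K, (4 : ℝ≥0∞) ^ k * (k.factorial : ℝ≥0∞)⁻¹ * ‖ψ y ^ k‖ₑ ∂μ ≤
      r ^ k * A := by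
    intro k
    have hm : AEStronglyMeasurable (fun y => ψ y ^ k) (μ.restrict K) :=
      (hψ.continuous.pow k).aestronglyMeasurable
    rw [lintegral_const_mul'' _ hm.enorm, ← eLpNorm_one_eq_lintegral_enorm]
    have h1 := eLpNorm_le_eLpNorm_mul_rpow_measure_univ (p := 1) (q := ((4 / 3 : ℝ≥0) : ℝ≥0∞))
      (by rw [← ENNReal.coe_one, ENNReal.coe_le_coe, ← NNReal.coe_le_coe]; push_cast; norm_num) hm
    rw [← eLpNorm_indicator_eq_eLpNorm_restrict hK.measurableSet] at h1
    have h2 := eLpNorm_pow_le μ h4 hK hψ hs k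
    have hf0 : (k.factorial : ℝ≥0∞) ≠ 0 := by exact_mod_cast k.factorial_ne_zero
    have hft : (k.factorial : ℝ≥0∞) ≠ ⊤ := ENNReal.natCast_ne_top _
    calc _ ≤ (4 : ℝ≥0∞) ^ k * (k.factorial : ℝ≥0∞)⁻¹ * (((k.factorial : ℝ≥0∞)
            * (C₂ * eLpNorm (fderiv ℝ ψ) 4 μ) ^ k
            * eLpNorm (K.indicator fun _ => (1 : ℝ)) (4 / 3 : ℝ≥0) μ) * (μ.restrict K) Set.univ ^
              (1 / (1 : ℝ≥0∞).toReal - 1 / ((4 / 3 : ℝ≥0) : ℝ≥0∞).toReal)) := by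
          rw [← eLpNorm_indicator_eq_eLpNorm_restrict hK.measurableSet]
          rw [← eLpNorm_indicator_eq_eLpNorm_restrict hK.measurableSet] at h1
          refine mul_le_mul_right (h1.trans ?_) _
          gcongr
      _ = ((k.factorial : ℝ≥0∞)⁻¹ * (k.factorial : ℝ≥0∞)) * (r ^ k * A) := by
          rw [hr, mul_pow, hA]
          ring
      _ = r ^ k * A := by rw [ENNReal.inv_mul_cancel hf0 hft, one_mul]
  simp only [ofReal_exp_abs_eq_tsum]
  have hmeas : ∀ k : ℕ, AEMeasurable
      (fun y => (4 : ℝ≥0∞) ^ k * (k.factorial : ℝ≥0∞)⁻¹ * ‖ψ y ^ k‖ₑ) (μ.restrict K) := fun k =>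
    ((hψ.continuous.pow k).enorm.measurable.const_mul _).aemeasurable
  rw [lintegral_tsum hmeas]
  calc _ ≤ ∑' k : ℕ, (2⁻¹ : ℝ≥0∞) ^ k * A := ENNReal.tsum_le_tsum fun k =>
        (hterm k).trans (by gcongr)
    _ = 2 * A := by
        rw [ENNReal.tsum_mul_right, ENNReal.tsum_geometric]
        simp

end Euclidean

end

section

/-! ### Gnomonic charts -/

open scoped ENNReal NNReal

/-- The tangent hyperplane of the sphere at `ξ`, as a linear subspace. -/
noncomputable abbrev tangentHyp (ξ : S4) : Submodule ℝ E5 := (ℝ ∙ (ξ : E5))ᗮ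

theorem finrank_tangentHyp (ξ : S4) : Module.finrank ℝ (tangentHyp ξ) = 4 := by
  have : Fact (Module.finrank ℝ E5 = 4 + 1) := ⟨finrank_E5⟩
  exact Submodule.finrank_orthogonal_span_singleton (coe_sphere_ne_zero ξ)

theorem inner_tangentHyp (ξ : S4) (y : tangentHyp ξ) : inner ℝ (ξ : E5) (y : E5) = 0 :=
  Submodule.mem_orthogonal_singleton_iff_inner_right.1 y.2

theorem inner_smul_add_tangentHyp (ξ : S4) (r : ℝ) (y : tangentHyp ξ) :
    inner ℝ (ξ : E5) (r • (ξ : E5) + y) = r := by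
  rw [inner_add_right, inner_tangentHyp, inner_smul_right, real_inner_self_eq_norm_sq,
    norm_coe_sphere]
  simp

/-- The decomposition of the space into the line through `ξ` and its orthogonal complement. -/
noncomputable def splitEquiv (ξ : S4) : (ℝ × tangentHyp ξ) ≃L[ℝ] E5 :=
  LinearEquiv.toContinuousLinearEquiv
    { toFun := fun p => p.1 • (ξ : E5) + p.2
      map_add' := fun p q => by
        simp only [Prod.fst_add, Prod.snd_add, Submodule.coe_add, add_smul]
        abel
      map_smul' := fun a p => by
        simp only [Prod.smul_fst, Prod.smul_snd, Submodule.coe_smul, smul_add, smul_smul,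
          smul_eq_mul, RingHom.id_apply]
      invFun := fun x => (inner ℝ (ξ : E5) x, ⟨x - inner ℝ (ξ : E5) x • (ξ : E5), by
        rw [Submodule.mem_orthogonal_singleton_iff_inner_right, inner_sub_right, inner_smul_right,
          real_inner_self_eq_norm_sq, norm_coe_sphere]
        simp⟩)
      left_inv := fun p => by
        refine Prod.ext (inner_smul_add_tangentHyp ξ _ _) (Subtype.ext ?_)
        simp only [inner_smul_add_tangentHyp]
        abel
      right_inv := fun x => by simp }

theorem splitEquiv_apply (ξ : S4) (p : ℝ × tangentHyp ξ) :
    splitEquiv ξ p = p.1 • (ξ : E5) + p.2 := rfl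

/-- The inverse of the gnomonic projection. -/
noncomputable def gnomonic (ξ : S4) (y : tangentHyp ξ) : S4 := radialProj ((ξ : E5) + y)

theorem smul_add_ne_zero (ξ : S4) {r : ℝ} (hr : 0 < r) (y : tangentHyp ξ) :
    r • (ξ : E5) + y ≠ 0 := by
  intro h
  have := inner_smul_add_tangentHyp ξ r y
  rw [h, inner_zero_right] at this
  linarith

theorem add_tangentHyp_ne_zero (ξ : S4) (y : tangentHyp ξ) : (ξ : E5) + y ≠ 0 := by
  simpa using smul_add_ne_zero ξ one_pos y

theorem contDiff_gnomonic (ξ : S4) : ContDiff ℝ ∞ fun y : tangentHyp ξ => (gnomonic ξ y : E5) := by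
  rw [contDiff_iff_contDiffAt]
  intro y
  have h : ContDiff ℝ ∞ fun y : tangentHyp ξ => (ξ : E5) + y :=
    contDiff_const.add (tangentHyp ξ).subtypeL.contDiff
  exact ContDiffAt.comp (g := fun x : E5 => (radialProj x : E5))
    (f := fun y : tangentHyp ξ => (ξ : E5) + y) y
    (contDiffAt_coe_radialProj (add_tangentHyp_ne_zero ξ y)) h.contDiffAt

theorem continuous_gnomonic (ξ : S4) : Continuous (gnomonic ξ) :=
  continuous_induced_rng.2 (contDiff_gnomonic ξ).continuous

theorem gnomonic_smul (ξ : S4) {r : ℝ} (hr : 0 < r) (z : tangentHyp ξ) :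
    radialProj (r • (ξ : E5) + (r • z : tangentHyp ξ)) = gnomonic ξ z := by
  rw [Submodule.coe_smul, ← smul_add, radialProj_smul hr (add_tangentHyp_ne_zero ξ z)]
  rfl

theorem measurable_radialProj_split (ξ : S4) (r : ℝ) :
    Measurable fun y : tangentHyp ξ => radialProj (r • (ξ : E5) + y) :=
  measurable_radialProj.comp (by fun_prop)

theorem lintegral_gnomonic_scale (ξ : S4) {r : ℝ} (hr : 0 < r) (R : ℝ) {g : S4 → ℝ≥0∞}
    (hg : Measurable g) :
    ∫⁻ y in Metric.closedBall (0 : tangentHyp ξ) R, g (radialProj (r • (ξ : E5) + y)) =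
      ENNReal.ofReal (r ^ 4) *
        ∫⁻ z in Metric.closedBall (0 : tangentHyp ξ) (R / r), g (gnomonic ξ z) := by
  set F : tangentHyp ξ → ℝ≥0∞ := (Metric.closedBall (0 : tangentHyp ξ) R).indicator
    fun y => g (radialProj (r • (ξ : E5) + y)) with hF
  have hFm : Measurable F :=
    (hg.comp (measurable_radialProj_split ξ r)).indicator Metric.isClosed_closedBall.measurableSet
  have h1 := lintegral_map (μ := (volume : Measure (tangentHyp ξ))) hFm
    (measurable_const_smul r : Measurable fun z : tangentHyp ξ => r • z)
  rw [Measure.map_addHaar_smul _ hr.ne', finrank_tangentHyp, lintegral_smul_measure,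
    smul_eq_mul] at h1
  have h2 : ∀ z : tangentHyp ξ, F (r • z) =
      (Metric.closedBall (0 : tangentHyp ξ) (R / r)).indicator (fun z => g (gnomonic ξ z)) z := by
    intro z
    have hiff : r • z ∈ Metric.closedBall (0 : tangentHyp ξ) R ↔
        z ∈ Metric.closedBall (0 : tangentHyp ξ) (R / r) := by
      rw [mem_closedBall_zero_iff, mem_closedBall_zero_iff, norm_smul, Real.norm_of_nonneg hr.le,
        le_div_iff₀' hr]
    by_cases hz : z ∈ Metric.closedBall (0 : tangentHyp ξ) (R / r)
    · rw [Set.indicator_of_mem hz, hF, Set.indicator_of_mem (hiff.2 hz), gnomonic_smul ξ hr]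
    · rw [Set.indicator_of_notMem hz, hF, Set.indicator_of_notMem fun h => hz (hiff.1 h)]
  simp only [h2] at h1
  rw [lintegral_indicator Metric.isClosed_closedBall.measurableSet,
    lintegral_indicator Metric.isClosed_closedBall.measurableSet] at h1
  rw [← h1, ← mul_assoc, ← ENNReal.ofReal_mul (by positivity), abs_of_pos (by positivity),
    mul_inv_cancel₀ (by positivity)]
  simp

/-- The ratio between the product measure and Lebesgue measure. -/
theorem exists_map_splitEquiv (ξ : S4) : ∃ a : ℝ≥0, a ≠ 0 ∧
    (volume : Measure (ℝ × tangentHyp ξ)).map (splitEquiv ξ) = a • (volume : Measure E5) := by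
  have : (volume : Measure (ℝ × tangentHyp ξ)).IsAddHaarMeasure := by
    rw [Measure.volume_eq_prod]
    infer_instance
  have h := (splitEquiv ξ).isAddHaarMeasure_map (volume : Measure (ℝ × tangentHyp ξ))
  exact ⟨_, (Measure.addHaarScalarFactor_pos_of_isAddHaarMeasure _ _).ne',
    Measure.isAddLeftInvariant_eq_smul _ _⟩

theorem lintegral_split (ξ : S4) {a : ℝ≥0}
    (ha : (volume : Measure (ℝ × tangentHyp ξ)).map (splitEquiv ξ) = a • (volume : Measure E5))
    {k : ℝ → ℝ≥0∞} (hk : Measurable k) {g : S4 → ℝ≥0∞} (hg : Measurable g) :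
    ∫⁻ r : ℝ, ∫⁻ y : tangentHyp ξ, k ‖r • (ξ : E5) + y‖ * g (radialProj (r • (ξ : E5) + y)) =
      a * (∫⁻ x : E5, k ‖x‖) * ∫⁻ η, g η ∂sphereMeasure := by
  have hm : Measurable fun x : E5 => k ‖x‖ * g (radialProj x) :=
    (hk.comp measurable_norm).mul (hg.comp measurable_radialProj)
  have hT : Measurable (splitEquiv ξ) := (splitEquiv ξ).continuous.measurable
  have h1 := lintegral_map (μ := (volume : Measure (ℝ × tangentHyp ξ))) hm hT
  have hmT : Measurable fun p : ℝ × tangentHyp ξ =>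
      k ‖splitEquiv ξ p‖ * g (radialProj (splitEquiv ξ p)) := hm.comp hT
  rw [ha, Measure.volume_eq_prod, lintegral_prod _ hmT.aemeasurable] at h1
  simp only [splitEquiv_apply] at h1
  rw [← h1, lintegral_smul_measure, lintegral_norm_mul_radialProj hk hg, mul_assoc]
  rfl

/-- The chart integral is averaged over the parallel hyperplanes at heights r in [1, 2], which sweep
out a region of ℝ⁵, and polar coordinates are used there. The radius 8 covers the rescaled ball of
radius 4 when r ≤ 2, and then |rξ + y| ≤ 2 + 8 = 10. -/
theorem map_gnomonic_le (ξ : S4) : ∃ C : ℝ≥0∞, C ≠ ⊤ ∧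
    ((volume : Measure (tangentHyp ξ)).restrict (Metric.closedBall 0 4)).map (gnomonic ξ) ≤
      C • sphereMeasure := by
  obtain ⟨a, -, ha⟩ := exists_map_splitEquiv ξ
  set k : ℝ → ℝ≥0∞ := (Set.Iic (10 : ℝ)).indicator 1 with hk
  have hkm : Measurable k := measurable_one.indicator measurableSet_Iic
  have hkfin : ∫⁻ x : E5, k ‖x‖ ≠ ⊤ := by
    have e : ∀ x : E5, k ‖x‖ = (Metric.closedBall (0 : E5) 10).indicator 1 x := by
      intro x
      simp [hk, Set.indicator]
    simp only [e]
    rw [lintegral_indicator_one Metric.isClosed_closedBall.measurableSet]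
    exact measure_closedBall_lt_top.ne
  refine ⟨a * ∫⁻ x : E5, k ‖x‖, ENNReal.mul_ne_top ENNReal.coe_ne_top hkfin, ?_⟩
  refine Measure.le_iff.2 fun t ht => ?_
  have hg : Measurable (t.indicator (1 : S4 → ℝ≥0∞)) := measurable_one.indicator ht
  rw [← lintegral_indicator_one ht, ← lintegral_indicator_one ht,
    lintegral_map hg (continuous_gnomonic ξ).measurable, lintegral_smul_measure, smul_eq_mul,
    ← lintegral_split ξ ha hkm hg]
  set g := t.indicator (1 : S4 → ℝ≥0∞)
  calc ∫⁻ z in Metric.closedBall (0 : tangentHyp ξ) 4, g (gnomonic ξ z)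
      = ∫⁻ _ in Set.Icc (1 : ℝ) 2, ∫⁻ z in Metric.closedBall (0 : tangentHyp ξ) 4,
          g (gnomonic ξ z) := by
        rw [setLIntegral_const, Real.volume_Icc]
        norm_num
    _ ≤ ∫⁻ r in Set.Icc (1 : ℝ) 2, ∫⁻ y : tangentHyp ξ,
          k ‖r • (ξ : E5) + y‖ * g (radialProj (r • (ξ : E5) + y)) := by
        refine setLIntegral_mono' measurableSet_Icc fun r hr => ?_
        have hr0 : (0 : ℝ) < r := lt_of_lt_of_le one_pos hr.1
        calc _ ≤ ENNReal.ofReal (r ^ 4) *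
              ∫⁻ z in Metric.closedBall (0 : tangentHyp ξ) (8 / r), g (gnomonic ξ z) := by
              rw [← one_mul (∫⁻ z in Metric.closedBall (0 : tangentHyp ξ) 4, g (gnomonic ξ z))]
              refine mul_le_mul' ?_ (lintegral_mono_set (Metric.closedBall_subset_closedBall ?_))
              · rw [ENNReal.one_le_ofReal]
                exact one_le_pow₀ hr.1
              · rw [le_div_iff₀ hr0]
                linarith [hr.2]
          _ = ∫⁻ y in Metric.closedBall (0 : tangentHyp ξ) 8,
                g (radialProj (r • (ξ : E5) + y)) := (lintegral_gnomonic_scale ξ hr0 8 hg).symm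
          _ ≤ ∫⁻ y in Metric.closedBall (0 : tangentHyp ξ) 8,
                k ‖r • (ξ : E5) + y‖ * g (radialProj (r • (ξ : E5) + y)) := by
              refine setLIntegral_mono' Metric.isClosed_closedBall.measurableSet fun y hy => ?_
              have hle : ‖r • (ξ : E5) + y‖ ≤ 10 := by
                refine (norm_add_le _ _).trans ?_
                rw [norm_smul, norm_coe_sphere, Real.norm_of_nonneg hr0.le]
                have h8 : ‖(y : E5)‖ ≤ 8 := mem_closedBall_zero_iff.1 hy
                linarith [hr.2]
              rw [hk, Set.indicator_of_mem (Set.mem_Iic.2 hle), Pi.one_apply, one_mul]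
          _ ≤ _ := setLIntegral_le_lintegral _ _
    _ ≤ _ := setLIntegral_le_lintegral _ _

/-- The spherical cap around `ξ`. -/
def sphereCap (ξ : S4) : Set S4 := {η | 9 / 10 < inner ℝ (ξ : E5) (η : E5)}

theorem isOpen_sphereCap (ξ : S4) : IsOpen (sphereCap ξ) :=
  isOpen_lt continuous_const (continuous_const.inner continuous_subtype_val)

theorem mem_sphereCap (ξ : S4) : ξ ∈ sphereCap ξ := by
  change (9 / 10 : ℝ) < inner ℝ (ξ : E5) (ξ : E5)
  rw [real_inner_self_eq_norm_sq, norm_coe_sphere]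
  norm_num

/-- The converse comparison: the part of the cone over the cap with norm in (5/4, 3/2) lies in the
heights r ∈ [1, 2] with |y| ≤ 2. The factor 16 bounds the scaling r⁴. -/
theorem exists_lintegral_sphereCap_le (ξ : S4) : ∃ C : ℝ≥0∞, C ≠ ⊤ ∧
    ∀ g : S4 → ℝ≥0∞, Measurable g → ∫⁻ η in sphereCap ξ, g η ∂sphereMeasure ≤
      C * ∫⁻ z in Metric.closedBall (0 : tangentHyp ξ) 2, g (gnomonic ξ z) := by
  obtain ⟨a, ha0, ha⟩ := exists_map_splitEquiv ξ
  set k : ℝ → ℝ≥0∞ := (Set.Ioo (5 / 4 : ℝ) (3 / 2)).indicator 1 with hk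
  have hkm : Measurable k := measurable_one.indicator measurableSet_Ioo
  set A := ∫⁻ x : E5, k ‖x‖ with hA
  have hAe : A = volume ((fun x : E5 => ‖x‖) ⁻¹' Set.Ioo (5 / 4 : ℝ) (3 / 2)) := by
    rw [← lintegral_indicator_one (measurable_norm measurableSet_Ioo)]
    rfl
  have hA0 : A ≠ 0 := by
    rw [hAe]
    refine (isOpen_Ioo.preimage continuous_norm).measure_ne_zero _ ⟨(11 / 8 : ℝ) • (ξ : E5), ?_⟩
    simp only [Set.mem_preimage, norm_smul, norm_coe_sphere]
    norm_num
  have hAtop : A ≠ ⊤ := by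
    rw [hAe]
    refine ((measure_mono ?_).trans_lt (measure_closedBall_lt_top (x := (0 : E5)) (r := 2))).ne
    intro x hx
    rw [mem_closedBall_zero_iff]
    linarith [hx.2]
  have ha0' : (a : ℝ≥0∞) ≠ 0 := by exact_mod_cast ha0
  refine ⟨(a * A)⁻¹ * 16, ENNReal.mul_ne_top (ENNReal.inv_ne_top.2 (mul_ne_zero ha0' hA0))
    (by norm_num), fun g hg => ?_⟩
  have hU := (isOpen_sphereCap ξ).measurableSet
  have hgU : Measurable ((sphereCap ξ).indicator g) := hg.indicator hU
  have key : (a : ℝ≥0∞) * A * ∫⁻ η in sphereCap ξ, g η ∂sphereMeasure ≤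
      16 * ∫⁻ z in Metric.closedBall (0 : tangentHyp ξ) 2, g (gnomonic ξ z) := by
    rw [← lintegral_indicator hU, ← lintegral_split ξ ha hkm hgU]
    have hpt : ∀ (r : ℝ) (y : tangentHyp ξ),
        k ‖r • (ξ : E5) + y‖ * (sphereCap ξ).indicator g (radialProj (r • (ξ : E5) + y)) ≤
          (Set.Icc (1 : ℝ) 2).indicator (fun r => (Metric.closedBall (0 : tangentHyp ξ) 2).indicator
            (fun y => g (radialProj (r • (ξ : E5) + y))) y) r := by
      intro r y
      set x : E5 := r • (ξ : E5) + y with hx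
      by_cases h1 : ‖x‖ ∈ Set.Ioo (5 / 4 : ℝ) (3 / 2)
      swap
      · rw [hk, Set.indicator_of_notMem h1, zero_mul]
        exact zero_le
      by_cases h2 : radialProj x ∈ sphereCap ξ
      swap
      · rw [Set.indicator_of_notMem h2, mul_zero]
        exact zero_le
      have hx0 : x ≠ 0 := norm_pos_iff.1 (lt_trans (by norm_num) h1.1)
      have hr : r = ‖x‖ * inner ℝ (ξ : E5) (radialProj x : E5) := by
        rw [← inner_smul_right, norm_smul_radialProj hx0, hx, inner_smul_add_tangentHyp]
      have h2' : (9 / 10 : ℝ) < inner ℝ (ξ : E5) (radialProj x : E5) := h2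
      have h3 : inner ℝ (ξ : E5) (radialProj x : E5) ≤ 1 := by
        have := real_inner_le_norm (ξ : E5) (radialProj x : E5)
        rwa [norm_coe_sphere, norm_coe_sphere, one_mul] at this
      -- The height is r = |x|⟨ξ, x/|x|⟩ > (5/4)(9/10) > 1.
      have hr1 : 1 ≤ r := by nlinarith [h1.1]
      have hr2 : r ≤ 2 := by nlinarith [h1.1, h1.2]
      have hy : ‖(y : E5)‖ ≤ 2 := by
        have e : ‖x‖ ^ 2 = r ^ 2 + ‖(y : E5)‖ ^ 2 := by
          rw [hx, norm_add_sq_real, inner_smul_left, inner_tangentHyp, norm_smul, norm_coe_sphere]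
          simp
        nlinarith [h1.2, norm_nonneg (y : E5), norm_nonneg x]
      have hym : y ∈ Metric.closedBall (0 : tangentHyp ξ) 2 := mem_closedBall_zero_iff.2 hy
      have hrm : r ∈ Set.Icc (1 : ℝ) 2 := ⟨hr1, hr2⟩
      rw [Set.indicator_of_mem hrm, Set.indicator_of_mem hym, Set.indicator_of_mem h2, hk,
        Set.indicator_of_mem h1, Pi.one_apply, one_mul]
    have hin : ∀ r : ℝ, ∫⁻ y : tangentHyp ξ, (Set.Icc (1 : ℝ) 2).indicator (fun r =>
        (Metric.closedBall (0 : tangentHyp ξ) 2).indicator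
          (fun y => g (radialProj (r • (ξ : E5) + y))) y) r =
        (Set.Icc (1 : ℝ) 2).indicator (fun r => ∫⁻ y in Metric.closedBall (0 : tangentHyp ξ) 2,
          g (radialProj (r • (ξ : E5) + y))) r := by
      intro r
      by_cases hr : r ∈ Set.Icc (1 : ℝ) 2
      · simp only [Set.indicator_of_mem hr]
        rw [lintegral_indicator Metric.isClosed_closedBall.measurableSet]
      · simp only [Set.indicator_of_notMem hr, lintegral_zero]
    calc _ ≤ ∫⁻ r : ℝ, ∫⁻ y : tangentHyp ξ, (Set.Icc (1 : ℝ) 2).indicator (fun r =>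
        (Metric.closedBall (0 : tangentHyp ξ) 2).indicator
          (fun y => g (radialProj (r • (ξ : E5) + y))) y) r :=
          lintegral_mono fun r => lintegral_mono fun y => hpt r y
      _ = ∫⁻ r in Set.Icc (1 : ℝ) 2, ∫⁻ y in Metric.closedBall (0 : tangentHyp ξ) 2,
          g (radialProj (r • (ξ : E5) + y)) := by
          simp only [hin]
          rw [lintegral_indicator measurableSet_Icc]
      _ ≤ ∫⁻ _ in Set.Icc (1 : ℝ) 2,
          16 * ∫⁻ z in Metric.closedBall (0 : tangentHyp ξ) 2, g (gnomonic ξ z) := by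
          refine setLIntegral_mono' measurableSet_Icc fun r hr => ?_
          have hr0 : (0 : ℝ) < r := lt_of_lt_of_le one_pos hr.1
          rw [lintegral_gnomonic_scale ξ hr0 2 hg]
          refine mul_le_mul' ?_ (lintegral_mono_set (Metric.closedBall_subset_closedBall ?_))
          · have : r ^ 4 ≤ 2 ^ 4 := pow_le_pow_left₀ hr0.le hr.2 4
            calc ENNReal.ofReal (r ^ 4) ≤ ENNReal.ofReal 16 :=
                  ENNReal.ofReal_le_ofReal (by linarith)
              _ = 16 := by norm_num
          · rw [div_le_iff₀ hr0]
            linarith [hr.1]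
      _ = _ := by
          rw [setLIntegral_const, Real.volume_Icc]
          norm_num
  have hne : (a : ℝ≥0∞) * A ≠ 0 := mul_ne_zero ha0' hA0
  have hnt : (a : ℝ≥0∞) * A ≠ ⊤ := ENNReal.mul_ne_top ENNReal.coe_ne_top hAtop
  calc _ = ((a : ℝ≥0∞) * A)⁻¹ * (a * A * ∫⁻ η in sphereCap ξ, g η ∂sphereMeasure) := by
        rw [← mul_assoc, ENNReal.inv_mul_cancel hne hnt, one_mul]
    _ ≤ ((a : ℝ≥0∞) * A)⁻¹ *
          (16 * ∫⁻ z in Metric.closedBall (0 : tangentHyp ξ) 2, g (gnomonic ξ z)) := by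
        gcongr
    _ = _ := by rw [mul_assoc]

/-! ### Exponential integrability on the sphere -/

/-- The function is pulled back to a gnomonic chart and cut off; the second derivative of the result
in L² is bounded by the H² norm on the sphere, so the local inequality applies. -/
theorem exists_lintegral_sphereCap_exp_le (ξ : S4) :
    ∃ ε C : ℝ≥0∞, ε ≠ 0 ∧ C ≠ ⊤ ∧ ∀ f : S4 → ℝ, SmoothOnSphere f → h2Norm f ≤ ε →
      ∫⁻ η in sphereCap ξ, ENNReal.ofReal (Real.exp (4 * |f η|)) ∂sphereMeasure ≤ C := by
  set K : Set (tangentHyp ξ) := Metric.closedBall 0 4 with hKdef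
  have hK : IsCompact K := isCompact_closedBall _ _
  obtain ⟨ε, C, hε, hC, hexp⟩ := exists_lintegral_exp_le (volume : Measure (tangentHyp ξ))
    (finrank_tangentHyp ξ) hK
  obtain ⟨C₁, hC₁, hmap⟩ := map_gnomonic_le ξ
  obtain ⟨C₂, hC₂, hcap⟩ := exists_lintegral_sphereCap_le ξ
  obtain ⟨C₃, hC₃, hjet⟩ := exists_iteratedFDeriv_comp_bound isOpen_univ
    (contDiff_gnomonic ξ).contDiffOn (fun y _ => coe_sphere_ne_zero _) hK (Set.subset_univ K)
  -- The cutoff is 1 on the ball of radius 2 that covers the cap, and its support lies inside K, of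
  -- radius 4.
  let χ : ContDiffBump (0 : tangentHyp ξ) := ⟨2, 3, by norm_num, by norm_num⟩
  have hχ : ContDiff ℝ ∞ χ := χ.contDiff
  have hχK : tsupport χ ⊆ K := by
    rw [χ.tsupport_eq]
    refine Metric.closedBall_subset_closedBall ?_
    change (3 : ℝ) ≤ 4
    norm_num
  have hχcont : ∀ i : ℕ, Continuous (iteratedFDeriv ℝ i χ) := fun i =>
    hχ.continuous_iteratedFDeriv (WithTop.coe_le_coe.2 (le_top : (i : ℕ∞) ≤ ⊤))
  choose B hB using fun i : ℕ => hK.exists_bound_of_continuousOn (hχcont i).continuousOn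
  set D : ℝ := ∑ i ∈ Finset.range 3, ((Nat.choose 2 i : ℕ) : ℝ) * |B i| * C₃ with hD
  set C₄ : ℝ≥0∞ := ENNReal.ofReal D * C₁ ^ (1 / (2 : ℝ≥0∞)).toReal with hC₄
  have hC₄top : C₄ ≠ ⊤ := ENNReal.mul_ne_top ENNReal.ofReal_ne_top
    (ENNReal.rpow_ne_top_of_nonneg ENNReal.toReal_nonneg hC₁)
  refine ⟨ε / (C₄ + 1), C₂ * C, ?_, ENNReal.mul_ne_top hC₂ hC, fun f hf hfε => ?_⟩
  · exact ENNReal.div_ne_zero.2 ⟨hε, ENNReal.add_ne_top.2 ⟨hC₄top, ENNReal.one_ne_top⟩⟩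
  have hfg : ContDiff ℝ ∞ fun y => homExt f (gnomonic ξ y : E5) := by
    rw [contDiff_iff_contDiffAt]
    intro y
    exact ContDiffAt.comp (g := homExt f) (f := fun y => (gnomonic ξ y : E5)) y
      (hf.smoothOff.contDiffAt (coe_sphere_ne_zero _)) (contDiff_gnomonic ξ).contDiffAt
  set ψ : tangentHyp ξ → ℝ := fun y => χ y * homExt f (gnomonic ξ y : E5) with hψ
  have hψs : ContDiff ℝ ∞ ψ := hχ.mul hfg
  have hψK : tsupport ψ ⊆ K := (tsupport_mul_subset_left).trans hχK
  have hder : ∀ y, ‖iteratedFDeriv ℝ 2 ψ y‖ ≤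
      D * ‖K.indicator (fun z => jetNorm f (gnomonic ξ z)) y‖ := by
    intro y
    by_cases hy : y ∈ K
    · rw [Set.indicator_of_mem hy, Real.norm_of_nonneg (jetNorm_nonneg _ _)]
      refine (norm_iteratedFDeriv_mul_le hχ hfg y (n := 2)
        (WithTop.coe_le_coe.2 (le_top : ((2 : ℕ) : ℕ∞) ≤ ⊤))).trans ?_
      rw [hD, Finset.sum_mul]
      refine Finset.sum_le_sum fun i hi => ?_
      have h1 := (hB i y hy).trans (le_abs_self _)
      have h2 : ‖iteratedFDeriv ℝ (2 - i) (fun z => homExt f (gnomonic ξ z : E5)) y‖ ≤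
          C₃ * jetNorm f (gnomonic ξ y) := hjet (homExt f) hf.smoothOff y hy (2 - i) (by omega)
      have h3 : (0 : ℝ) ≤ ((Nat.choose 2 i : ℕ) : ℝ) := Nat.cast_nonneg _
      calc _ ≤ ((Nat.choose 2 i : ℕ) : ℝ) * |B i| * (C₃ * jetNorm f (gnomonic ξ y)) := by
            gcongr
        _ = _ := by ring
    · have : iteratedFDeriv ℝ 2 ψ y = 0 := Function.notMem_support.1 fun h =>
        hy (hψK (support_iteratedFDeriv_subset 2 h))
      rw [this, norm_zero, Set.indicator_of_notMem hy]
      simp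
  have hjm : AEStronglyMeasurable (jetNorm f) (Measure.map (gnomonic ξ) (volume.restrict K)) :=
    hf.continuous_jetNorm.aestronglyMeasurable
  have hsmall : eLpNorm (iteratedFDeriv ℝ 2 ψ) 2 volume ≤ C₄ * h2Norm f := by
    have h1 := eLpNorm_le_mul_eLpNorm_of_ae_le_mul (μ := (volume : Measure (tangentHyp ξ)))
      (f := iteratedFDeriv ℝ 2 ψ) (Eventually.of_forall hder) 2
    refine h1.trans ?_
    rw [hC₄, mul_assoc]
    refine mul_le_mul_right ?_ _
    rw [eLpNorm_indicator_eq_eLpNorm_restrict hK.measurableSet]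
    have h2 := eLpNorm_map_measure (p := 2) hjm (continuous_gnomonic ξ).measurable.aemeasurable
    have h3 := eLpNorm_mono_measure (p := 2) (jetNorm f) hmap
    rw [h2, eLpNorm_smul_measure_of_ne_top (by simp), smul_eq_mul] at h3
    exact h3.trans (mul_le_mul_right (eLpNorm_jetNorm_le hf) _)
  have hle : eLpNorm (iteratedFDeriv ℝ 2 ψ) 2 volume ≤ ε := by
    refine hsmall.trans ?_
    calc C₄ * h2Norm f ≤ (C₄ + 1) * (ε / (C₄ + 1)) := mul_le_mul' le_self_add hfε
      _ ≤ ε := ENNReal.mul_div_le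
  have hfm : Measurable fun η => ENNReal.ofReal (Real.exp (4 * |f η|)) :=
    (Real.continuous_exp.comp (continuous_const.mul hf.continuous.abs)).measurable.ennreal_ofReal
  refine (hcap _ hfm).trans (mul_le_mul_right ?_ _)
  refine le_trans ?_ (hexp ψ hψs hψK hle)
  calc _ = ∫⁻ z in Metric.closedBall (0 : tangentHyp ξ) 2,
        ENNReal.ofReal (Real.exp (4 * |ψ z|)) := by
        refine setLIntegral_congr_fun Metric.isClosed_closedBall.measurableSet fun z hz => ?_
        have : χ z = 1 := χ.one_of_mem_closedBall hz
        simp only [hψ, this, one_mul, homExt_coe]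
    _ ≤ _ := lintegral_mono_set (Metric.closedBall_subset_closedBall (by norm_num))

/-- Write u = φ_N − (φ_N − u) with φ_N smooth, hence bounded. The differences φ_N − φ_n have small
H² norm, so the uniform exponential bound passes to φ_N − u by Fatou along an a.e. convergent
subsequence; no smallness of u is needed. -/
theorem MemH2.integrableOn_sphereCap {u : S4 → ℝ} (hu : MemH2 u) (ξ : S4) :
    IntegrableOn (fun η => Real.exp (4 * u η)) (sphereCap ξ) sphereMeasure := by
  obtain ⟨hu2, φ, hφ⟩ := hu
  obtain ⟨ε, C, hε, hC, hexp⟩ := exists_lintegral_sphereCap_exp_le ξ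
  obtain ⟨N, hN⟩ := hφ.isH2Cauchy.exists_forall_le hε
  obtain ⟨ns, hns, hae⟩ := (tendstoInMeasure_of_tendsto_eLpNorm (by norm_num)
    (fun n => (hφ.smooth n).continuous.aestronglyMeasurable) hu2.1
    hφ.tendsto).exists_seq_tendsto_ae
  set G : ℕ → S4 → ℝ≥0∞ := fun i η => ENNReal.ofReal (Real.exp (4 * |(φ N - φ (ns i)) η|))
    with hG
  have hGm : ∀ i, Measurable (G i) := fun i =>
    (Real.continuous_exp.comp (continuous_const.mul
      ((hφ.smooth N).sub (hφ.smooth (ns i))).continuous.abs)).measurable.ennreal_ofReal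
  have hbound : ∫⁻ η in sphereCap ξ, ENNReal.ofReal (Real.exp (4 * |φ N η - u η|))
      ∂sphereMeasure ≤ C := by
    calc _ = ∫⁻ η in sphereCap ξ, liminf (fun i => G i η) atTop ∂sphereMeasure := by
          refine lintegral_congr_ae ((ae_restrict_of_ae hae).mono fun η hη => ?_)
          have : Tendsto (fun i => G i η) atTop
              (𝓝 (ENNReal.ofReal (Real.exp (4 * |φ N η - u η|)))) := by
            refine (ENNReal.continuous_ofReal.tendsto _).comp ?_
            refine (Real.continuous_exp.tendsto _).comp ?_
            exact ((tendsto_const_nhds.sub hη).abs).const_mul 4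
          exact this.liminf_eq.symm
      _ ≤ liminf (fun i => ∫⁻ η in sphereCap ξ, G i η ∂sphereMeasure) atTop :=
          lintegral_liminf_le hGm
      _ ≤ C := by
          refine liminf_le_of_frequently_le' (Eventually.frequently ?_)
          filter_upwards [eventually_ge_atTop N] with i hi
          exact hexp _ ((hφ.smooth N).sub (hφ.smooth _))
            (hN N (ns i) le_rfl (hi.trans hns.le_apply))
  obtain ⟨M, hM⟩ := isCompact_univ.exists_bound_of_continuousOn
    (hφ.smooth N).continuous.continuousOn
  refine ⟨(Real.continuous_exp.comp_aestronglyMeasurable (hu2.1.const_mul 4)).restrict, ?_⟩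
  rw [HasFiniteIntegral]
  calc _ ≤ ∫⁻ η in sphereCap ξ, ENNReal.ofReal (Real.exp (4 * M)) *
        ENNReal.ofReal (Real.exp (4 * |φ N η - u η|)) ∂sphereMeasure := by
        refine lintegral_mono fun η => ?_
        rw [← ENNReal.ofReal_mul (Real.exp_pos _).le, ← Real.exp_add, ← ofReal_norm,
          Real.norm_of_nonneg (Real.exp_pos _).le]
        refine ENNReal.ofReal_le_ofReal (Real.exp_le_exp.2 ?_)
        have h1 : φ N η ≤ M := (le_abs_self _).trans (hM η (Set.mem_univ _))
        have h2 := neg_abs_le (φ N η - u η)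
        linarith
    _ = ENNReal.ofReal (Real.exp (4 * M)) * ∫⁻ η in sphereCap ξ,
        ENNReal.ofReal (Real.exp (4 * |φ N η - u η|)) ∂sphereMeasure :=
        lintegral_const_mul' _ _ ENNReal.ofReal_ne_top
    _ < ⊤ := ENNReal.mul_lt_top ENNReal.ofReal_lt_top (hbound.trans_lt hC.lt_top)

theorem MemH2.integrable_exp {u : S4 → ℝ} (hu : MemH2 u) :
    Integrable (fun η => Real.exp (4 * u η)) sphereMeasure := by
  have hloc : LocallyIntegrable (fun η => Real.exp (4 * u η)) sphereMeasure := fun ξ =>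
    ⟨sphereCap ξ, (isOpen_sphereCap ξ).mem_nhds (mem_sphereCap ξ), hu.integrableOn_sphereCap ξ⟩
  exact integrableOn_univ.1 (hloc.integrableOn_isCompact isCompact_univ)

end

/-! ### The conformal transform -/

theorem conformalTransform_eq {t : ℝ} (ht : 0 < t) (u : S4 → ℝ) :
    conformalTransform t u = fun ξ => u (boostMap ((t + t⁻¹) / 2) ((t - t⁻¹) / 2) ξ) +
      5 / 4 * logFactor ((t + t⁻¹) / 2) ((t - t⁻¹) / 2) ξ := by
  funext ξ
  rw [conformalTransform, dilation_eq_boostMap ht, (isBoost_of_pos ht).absJacobian_boostMap,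
    Real.log_zpow, logFactor]
  push_cast
  ring

theorem tendsto_integral_mul_of_eLpNorm {g : ℕ → S4 → ℝ} {u h : S4 → ℝ}
    (hg : ∀ n, MemLp (g n) 2 sphereMeasure) (hu : MemLp u 2 sphereMeasure) (hh : Continuous h)
    (hlim : Tendsto (fun n => eLpNorm (g n - u) 2 sphereMeasure) atTop (𝓝 0)) :
    Tendsto (fun n => ∫ ξ, g n ξ * h ξ ∂sphereMeasure) atTop
      (𝓝 (∫ ξ, u ξ * h ξ ∂sphereMeasure)) := by
  obtain ⟨M, hM⟩ := isCompact_univ.exists_bound_of_continuousOn hh.continuousOn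
  have hint : ∀ {f : S4 → ℝ}, MemLp f 2 sphereMeasure →
      Integrable (fun ξ => f ξ * h ξ) sphereMeasure := fun hf =>
    hf.integrable_mul (hh.memLp_sphere 2)
  refine tendsto_integral_of_L1' _ (hint hu).aestronglyMeasurable (Eventually.of_forall fun n => hint (hg n)) ?_
  have hle : ∀ n, eLpNorm ((fun ξ => g n ξ * h ξ) - fun ξ => u ξ * h ξ) 1 sphereMeasure ≤
      ENNReal.ofReal M * eLpNorm (g n - u) 2 sphereMeasure := by
    intro n
    refine (eLpNorm_le_mul_eLpNorm_of_ae_le_mul (g := g n - u) (c := M)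
      (Eventually.of_forall fun ξ => ?_) 1).trans ?_
    · rw [Pi.sub_apply, ← sub_mul, norm_mul, mul_comm]
      exact mul_le_mul_of_nonneg_right (hM ξ (Set.mem_univ _)) (norm_nonneg _)
    · exact mul_le_mul_right (eLpNorm_le_eLpNorm_of_exponent_le (by norm_num)
        ((hg n).sub hu).aestronglyMeasurable) _
  refine tendsto_of_tendsto_of_tendsto_of_le_of_le tendsto_const_nhds ?_ (fun _ => zero_le) hle
  simpa using ENNReal.Tendsto.const_mul hlim (Or.inr ENNReal.ofReal_ne_top)

theorem integral_logFactor_neg (c s : ℝ) :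
    ∫ ξ, logFactor c (-s) ξ ∂sphereMeasure = ∫ ξ, logFactor c s ξ ∂sphereMeasure := by
  rw [← integral_sphere_neg]
  refine integral_congr_ae (Eventually.of_forall fun ξ => ?_)
  simp only [logFactor, boostTime_coe]
  simp

/-! ### Transformation of the form, the mean and the exponential moments -/

namespace IsBoost

variable {c s : ℝ}

theorem logFactor_neg_boostMap (h : IsBoost c s) (ξ : S4) :
    logFactor c (-s) (boostMap c s ξ) = -logFactor c s ξ := by
  rw [logFactor, logFactor, h.boostTime_neg_boostMap, Real.log_inv]

/-- At the image point, the logarithmic factor of the inverse boost is −w. A change of variables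
replaces the left side by minus the integral of that factor, and the antipodal map exchanges s and
−s. -/
theorem integral_zpow_mul_logFactor (h : IsBoost c s) :
    ∫ ξ, boostTime c s ξ ^ (-4 : ℤ) * logFactor c s ξ ∂sphereMeasure =
      -∫ ξ, logFactor c s ξ ∂sphereMeasure := by
  rw [← integral_logFactor_neg c s, ← integral_neg,
    ← h.integral_comp fun ξ => -logFactor c (-s) ξ]
  simp only [h.logFactor_neg_boostMap, neg_neg]

theorem memLp_comp (h : IsBoost c s) {u : S4 → ℝ} (hu : MemLp u 2 sphereMeasure) :
    MemLp (fun ξ => u (boostMap c s ξ)) 2 sphereMeasure :=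
  (hu.of_measure_le_smul ENNReal.ofReal_ne_top h.map_le).comp_of_map
    h.continuous_boostMap.measurable.aemeasurable

theorem tendsto_eLpNorm_comp (h : IsBoost c s) {u : S4 → ℝ} {φ : ℕ → S4 → ℝ}
    (hφ : IsH2Approx u φ) :
    Tendsto (fun n => eLpNorm ((fun ξ => φ n (boostMap c s ξ)) - fun ξ => u (boostMap c s ξ)) 2
      sphereMeasure) atTop (𝓝 0) := by
  obtain ⟨C, hC, hle⟩ := h.exists_eLpNorm_comp_le
  refine tendsto_of_tendsto_of_tendsto_of_le_of_le tendsto_const_nhds ?_ (fun _ => zero_le)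
    fun n => hle (φ n - u)
  simpa using ENNReal.Tendsto.const_mul hφ.tendsto (Or.inr hC)

theorem tendsto_h2Norm_comp (h : IsBoost c s) {u : S4 → ℝ} {φ : ℕ → S4 → ℝ}
    (hφ : IsH2Approx u φ) :
    Tendsto (fun p : ℕ × ℕ => h2Norm fun ξ => (φ p.1 - φ p.2) (boostMap c s ξ)) atTop (𝓝 0) := by
  obtain ⟨C, hC, hle⟩ := h.exists_h2Norm_comp_le
  have h1 : Tendsto (fun p : ℕ × ℕ => C * h2Norm (φ p.1 - φ p.2)) atTop (𝓝 0) := by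
    simpa only [mul_zero] using ENNReal.Tendsto.const_mul hφ.cauchy (Or.inr hC)
  exact tendsto_of_tendsto_of_tendsto_of_le_of_le tendsto_const_nhds h1
    (fun _ => zero_le) fun p => hle _ ((hφ.smooth p.1).sub (hφ.smooth p.2))

theorem isH2Approx_comp_add (h : IsBoost c s) {u : S4 → ℝ} {φ : ℕ → S4 → ℝ}
    (hφ : IsH2Approx u φ) (a : ℝ) :
    IsH2Approx (fun ξ => u (boostMap c s ξ) + a * logFactor c s ξ)
      (fun n => (fun ξ => φ n (boostMap c s ξ)) + a • logFactor c s) := by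
  refine ⟨fun n => ?_, ?_, ?_⟩
  · exact (h.smoothOnSphere_comp (hφ.smooth n)).add (h.smoothOnSphere_logFactor.const_smul a)
  · refine (h.tendsto_h2Norm_comp hφ).congr fun p => congrArg h2Norm (funext fun ξ => ?_)
    simp only [Pi.sub_apply, Pi.add_apply, add_sub_add_right_eq_sub]
  · refine (h.tendsto_eLpNorm_comp hφ).congr fun n => ?_
    refine congrArg (fun f => eLpNorm f 2 sphereMeasure) (funext fun ξ => ?_)
    simp only [Pi.sub_apply, Pi.add_apply, Pi.smul_apply, smul_eq_mul, add_sub_add_right_eq_sub]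

theorem memH2_comp_add (h : IsBoost c s) {u : S4 → ℝ} (hu : MemH2 u) (a : ℝ) :
    MemH2 fun ξ => u (boostMap c s ξ) + a * logFactor c s ξ := by
  obtain ⟨hu2, φ, hφ⟩ := hu
  exact ⟨(h.memLp_comp hu2).add
    ((h.smoothOnSphere_logFactor.continuous.memLp_sphere 2).const_mul a),
    _, h.isH2Approx_comp_add hφ a⟩

theorem paneitzBilin_comp_add (h : IsBoost c s) {f : S4 → ℝ} (hf : SmoothOnSphere f) (a : ℝ) :
    paneitzBilin ((fun ξ => f (boostMap c s ξ)) + a • logFactor c s)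
        ((fun ξ => f (boostMap c s ξ)) + a • logFactor c s) =
      paneitzBilin f f
        + 2 * a * ∫ ξ, f (boostMap c s ξ) * (6 * boostTime c s ξ ^ (-4 : ℤ) - 6) ∂sphereMeasure
        + a ^ 2 * ∫ ξ, logFactor c s ξ * (6 * boostTime c s ξ ^ (-4 : ℤ) - 6) ∂sphereMeasure := by
  have hg := h.smoothOnSphere_comp hf
  have hw := h.smoothOnSphere_logFactor
  have haw := hw.const_smul a
  rw [paneitzBilin_add_left hg haw (hg.add haw), paneitzBilin_comm hg (hg.add haw),
    paneitzBilin_add_left hg haw hg, paneitzBilin_smul_left, paneitzBilin_smul_left,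
    paneitzBilin_comm hw (hg.add haw), paneitzBilin_add_left hg haw hw, paneitzBilin_smul_left,
    paneitzBilin_comm hw hg, h.paneitzBilin_logFactor, h.paneitzBilin_logFactor,
    h.paneitzBilin_comp hf]
  ring

theorem integral_comp_mul_curvature (h : IsBoost c s) {u : S4 → ℝ}
    (hu : MemLp u 2 sphereMeasure) :
    ∫ ξ, u (boostMap c s ξ) * (6 * boostTime c s ξ ^ (-4 : ℤ) - 6) ∂sphereMeasure =
      6 * ∫ ξ, u ξ ∂sphereMeasure - 6 * ∫ ξ, u (boostMap c s ξ) ∂sphereMeasure := by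
  have hub := h.memLp_comp hu
  have hi : Integrable (fun ξ : S4 => boostTime c s ξ ^ (-4 : ℤ) * u (boostMap c s ξ)) sphereMeasure :=
    (h.continuous_zpow.memLp_sphere 2).integrable_mul hub
  rw [← h.integral_comp u, ← integral_const_mul, ← integral_const_mul, ← integral_sub
    (hi.const_mul 6) ((hub.integrable (by norm_num)).const_mul 6)]
  refine integral_congr_ae (Eventually.of_forall fun ξ => ?_)
  ring

theorem integral_logFactor_mul_curvature (h : IsBoost c s) :
    ∫ ξ, logFactor c s ξ * (6 * boostTime c s ξ ^ (-4 : ℤ) - 6) ∂sphereMeasure =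
      -12 * ∫ ξ, logFactor c s ξ ∂sphereMeasure := by
  have hw := h.smoothOnSphere_logFactor
  have hi : Integrable (fun ξ : S4 => boostTime c s ξ ^ (-4 : ℤ) * logFactor c s ξ) sphereMeasure :=
    (h.continuous_zpow.memLp_sphere 2).integrable_mul (hw.continuous.memLp_sphere 2)
  calc _ = ∫ ξ, (6 * (boostTime c s ξ ^ (-4 : ℤ) * logFactor c s ξ) - 6 * logFactor c s ξ)
        ∂sphereMeasure := by
        refine integral_congr_ae (Eventually.of_forall fun ξ => ?_)
        ring
    _ = _ := by
        rw [integral_sub (hi.const_mul 6) (hw.integrable.const_mul 6), integral_const_mul,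
          integral_const_mul, h.integral_zpow_mul_logFactor]
        ring

/-- The identity for smooth functions passes to the limit: the quadratic term by definition of the
form, and the cross term by L² convergence, since P₄w is continuous. -/
theorem paneitzForm_comp_add (h : IsBoost c s) {u : S4 → ℝ} (hu : MemH2 u) (a : ℝ) :
    paneitzForm (fun ξ => u (boostMap c s ξ) + a * logFactor c s ξ) =
      paneitzForm u + 12 * a * (∫ ξ, u ξ ∂sphereMeasure - ∫ ξ, u (boostMap c s ξ) ∂sphereMeasure)
        - 12 * a ^ 2 * ∫ ξ, logFactor c s ξ ∂sphereMeasure := by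
  have hv := (h.memH2_comp_add hu a).1.1
  obtain ⟨hu2, φ, hφ⟩ := hu
  have h1 := (h.isH2Approx_comp_add hφ a).tendsto_paneitzForm hv
  simp only [h.paneitzBilin_comp_add (hφ.smooth _)] at h1
  have hcurv : Continuous fun ξ : S4 => 6 * boostTime c s ξ ^ (-4 : ℤ) - 6 :=
    (continuous_const.mul h.continuous_zpow).sub continuous_const
  have h2 := tendsto_integral_mul_of_eLpNorm
    (fun n => (h.smoothOnSphere_comp (hφ.smooth n)).continuous.memLp_sphere 2)
    (h.memLp_comp hu2) hcurv (h.tendsto_eLpNorm_comp hφ)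
  have h3 := ((hφ.tendsto_paneitzForm hu2.1).add (h2.const_mul (2 * a))).add_const
    (a ^ 2 * ∫ ξ, logFactor c s ξ * (6 * boostTime c s ξ ^ (-4 : ℤ) - 6) ∂sphereMeasure)
  rw [tendsto_nhds_unique h1 h3, h.integral_comp_mul_curvature hu2,
    h.integral_logFactor_mul_curvature]
  ring

theorem exp_comp_add (h : IsBoost c s) (u : S4 → ℝ) (ξ : S4) :
    Real.exp (4 * (u (boostMap c s ξ) + 5 / 4 * logFactor c s ξ)) =
      boostTime c s ξ ^ (-4 : ℤ) *
        (Real.exp (4 * u (boostMap c s ξ)) * boostTime c (-s) (boostMap c s ξ)) := by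
  have hq := h.boostTime_coe_pos ξ
  have e : 4 * (u (boostMap c s ξ) + 5 / 4 * logFactor c s ξ) =
      4 * u (boostMap c s ξ) + ((-5 : ℤ) : ℝ) * Real.log (boostTime c s ξ) := by
    rw [logFactor]
    push_cast
    ring
  rw [e, Real.exp_add, ← Real.log_zpow, Real.exp_log (zpow_pos hq _), h.boostTime_neg_boostMap,
    -- The exponent −5 = −4·(5/4) splits into the Jacobian q⁻⁴ and one further q⁻¹, the temporal
    -- part of the inverse boost at the image point.
    show (-5 : ℤ) = -4 + -1 from rfl, zpow_add₀ hq.ne', zpow_neg_one]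
  ring

/-- The spare factor q⁻¹ times ξ is the spatial part of the inverse boost of (1, φ_t ξ), so the
integrand is a pull-back weighted by the Jacobian. -/
theorem integral_exp_comp_add_mul (h : IsBoost c s) (u : S4 → ℝ) (i : Fin 5) :
    ∫ ξ, Real.exp (4 * (u (boostMap c s ξ) + 5 / 4 * logFactor c s ξ)) * (ξ : E5) i
        ∂sphereMeasure =
      ∫ η, Real.exp (4 * u η) * boost c (-s) η i ∂sphereMeasure := by
  rw [← h.integral_comp fun η => Real.exp (4 * u η) * boost c (-s) η i]
  refine integral_congr_ae (Eventually.of_forall fun ξ => ?_)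
  have hξ := h.neg.boostTime_smul_boostMap (boostMap c s ξ)
  rw [h.boostMap_neg_boostMap] at hξ
  simp only [← hξ, h.exp_comp_add, PiLp.smul_apply, smul_eq_mul]
  ring

theorem integral_exp_comp_add (h : IsBoost c s) (u : S4 → ℝ) :
    ∫ ξ, Real.exp (4 * (u (boostMap c s ξ) + 5 / 4 * logFactor c s ξ)) ∂sphereMeasure =
      ∫ η, Real.exp (4 * u η) * boostTime c (-s) η ∂sphereMeasure := by
  rw [← h.integral_comp fun η => Real.exp (4 * u η) * boostTime c (-s) η]
  simp only [h.exp_comp_add]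

/-- The Lorentz norm of the vector of exponential moments is invariant. -/
theorem sq_sub_sum_sq_integral_exp (h : IsBoost c s) {u : S4 → ℝ}
    (hu : Integrable (fun η => Real.exp (4 * u η)) sphereMeasure) :
    (∫ ξ, Real.exp (4 * (u (boostMap c s ξ) + 5 / 4 * logFactor c s ξ)) ∂sphereMeasure) ^ 2 -
        ∑ i : Fin 5, (∫ ξ, Real.exp (4 * (u (boostMap c s ξ) + 5 / 4 * logFactor c s ξ)) *
          (ξ : E5) i ∂sphereMeasure) ^ 2 =
      (∫ ξ, Real.exp (4 * u ξ) ∂sphereMeasure) ^ 2 -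
        ∑ i : Fin 5, (∫ ξ, Real.exp (4 * u ξ) * (ξ : E5) i ∂sphereMeasure) ^ 2 := by
  have hcoord : Integrable (fun η : S4 => Real.exp (4 * u η) * (η : E5) 0) sphereMeasure := by
    refine hu.mul_of_top_left ?_
    exact Continuous.memLp_sphere (by fun_prop) _
  have h0 : ∫ η : S4, Real.exp (4 * u η) * boostTime c (-s) η ∂sphereMeasure =
      c * ∫ η, Real.exp (4 * u η) ∂sphereMeasure
        - s * ∫ η : S4, Real.exp (4 * u η) * (η : E5) 0 ∂sphereMeasure := by
    rw [← integral_const_mul, ← integral_const_mul,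
      ← integral_sub (hu.const_mul c) (hcoord.const_mul s)]
    refine integral_congr_ae (Eventually.of_forall fun η => ?_)
    simp only [boostTime_coe]
    ring
  have h1 : ∫ η : S4, Real.exp (4 * u η) * boost c (-s) η 0 ∂sphereMeasure =
      c * ∫ η : S4, Real.exp (4 * u η) * (η : E5) 0 ∂sphereMeasure
        - s * ∫ η, Real.exp (4 * u η) ∂sphereMeasure := by
    rw [← integral_const_mul, ← integral_const_mul,
      ← integral_sub (hcoord.const_mul c) (hu.const_mul s)]
    refine integral_congr_ae (Eventually.of_forall fun η => ?_)
    simp only [boost_zero_coord, norm_coe_sphere]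
    ring
  simp only [h.integral_exp_comp_add, h.integral_exp_comp_add_mul, Fin.sum_univ_succ (n := 4),
    h0, h1, boost_coord c (-s) _ (Fin.succ_ne_zero _)]
  -- Only the total mass and the zeroth moment mix, by the matrix with rows (c, −s) and (−s, c), of
  -- determinant c² − s² = 1.
  linear_combination ((∫ η, Real.exp (4 * u η) ∂sphereMeasure) ^ 2 -
    (∫ η : S4, Real.exp (4 * u η) * (η : E5) 0 ∂sphereMeasure) ^ 2) * h.sq_sub

end IsBoost

theorem proposition3 (u : S4 → ℝ) (hu : MemH2 u) (t : ℝ) (ht : 0 < t) :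
    MemH2 (conformalTransform t u) ∧
      momentumJ (4 / 5) u = momentumJ (4 / 5) (conformalTransform t u) := by
  have h := isBoost_of_pos ht
  rw [conformalTransform_eq ht]
  refine ⟨h.memH2_comp_add hu _, ?_⟩
  have hi := integral_add ((h.memLp_comp hu.1).integrable (by norm_num))
    (h.smoothOnSphere_logFactor.integrable.const_mul (5 / 4))
  rw [integral_const_mul] at hi
  rw [momentumJ, momentumJ, h.paneitzForm_comp_add hu, h.sq_sub_sum_sq_integral_exp
    hu.integrable_exp, hi]
  -- The cancellation uses (2/5)·12·(5/4) = 6 and (2/5)·12·(5/4)² = 6·(5/4).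
  ring
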